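/- Let $Z=Z_1Z_2\cdots$ be a stationary, aperiodic, irreducible Markov chain on a finite set $\mathcal A$, and let $\tau$ be the forward shift on $\mathcal A^{\mathbb N}$. Let $h_k:\mathcal A^{\mathbb N}\times\mathcal A^{\mathbb N}\to\mathbb R$ $(k\ge 1)$ be kernels such that (H0) each $h_k$ is symmetric; (H1) there is $C<\infty$ with $|h_k|\le C$ for all $k\ge1$; (H2) $h_k(x,y)$ depends only on the first $k$ entries of $x$ and of $y$; and assume that there are constants $C<\infty$ and $0<\beta<1$ such that $$E|h_k(Z,\tau^iZ)|\le C\beta^k\qquad\text{for all } k,i\ge1 .$$ Let $h=\sum_{k\ge1}h_k$ and $$W_n=\sum_{i=1}^n\sum_{j=i+1}^n h(\tau^iZ,\tau^jZ),$$ and let $H_k(z)=E\,h_k(z,Z)$ be the Hoeffding projection of $h_k$. Then: (i) the series defining $h(\tau^iZ,\tau^jZ)$ for $1\le i<j$ and the series $\sum_{k\ge1} H_k(\tau^iZ)$ for $i\ge 0$ converge absolutely almost surely, the series $\kappa=\sum_{k\ge1}E H_k(Z)$ converges absolutely, and for each $n$ the random variable $\sum_{i=1}^n\sum_{k\ge1}H_k(\tau^iZ)$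 has a finite second moment; (ii) the limit $$\sigma^2=\lim_{n\to\infty}\frac1n\,E\Bigl(\sum_{i=1}^n\sum_{k\ge1}H_k(\tau^iZ)-n\kappa\Bigr)^2$$ exists in $[0,\infty)$; (iii) as $n\to\infty$, $$\frac{W_n-\tfrac12 n^2\kappa}{n^{3/2}}\Longrightarrow \mathrm{Normal}(0,\sigma^2)$$ in distribution, where $\mathrm{Normal}(0,0)$ is the point mass at $0$. -/

import Mathlib

open MeasureTheory ProbabilityTheory Filter Topology

namespace MarkovUStat

/-- `Z` (the sequence `Z ω 0, Z ω 1, …`) is, under `μ`, a stationary Markov chain on the finite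
state space `A` with transition probability matrix `Q` and stationary distribution `p`. -/
structure IsStationaryMarkovChain {Ω A : Type*} [MeasurableSpace Ω] [MeasurableSpace A] [Fintype A]
    (μ : Measure Ω) (p : A → ℝ) (Q : Matrix A A ℝ) (Z : Ω → ℕ → A) : Prop where
  measurable : Measurable Z
  initial_nonneg : ∀ a, 0 ≤ p a
  initial_sum : ∑ a, p a = 1
  trans_nonneg : ∀ a b, 0 ≤ Q a b
  trans_sum : ∀ a, ∑ b, Q a b = 1
  stationary : ∀ b, ∑ a, p a * Q a b = p b
  law : ∀ (m k : ℕ) (w : ℕ → A),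
    μ.real {ω | ∀ j ≤ k, Z ω (m + j) = w j} =
      p (w 0) * ∏ j ∈ Finset.range k, Q (w j) (w (j + 1))

/-- Every state has period one: the greatest common divisor of the possible return times is one. -/
def IsAperiodic {A : Type*} [Fintype A] [DecidableEq A] (Q : Matrix A A ℝ) : Prop :=
  ∀ (a : A) (d : ℕ), (∀ n : ℕ, 1 ≤ n → 0 < (Q ^ n) a a → d ∣ n) → d = 1

/-- The `i`-th iterate of the forward shift on the sequence space. -/
def shift {A : Type*} (i : ℕ) (z : ℕ → A) : ℕ → A := fun j => z (i + j)

/-- The kernel `h = ∑_{k ≥ 1} h_k`; the family is indexed by `ℕ` and `h 0` is not used. -/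
noncomputable def kernelSum {A : Type*} (h : ℕ → (ℕ → A) → (ℕ → A) → ℝ) (x y : ℕ → A) : ℝ :=
  ∑' k : ℕ, h (k + 1) x y

/-- The `U`-statistic of order two with kernel `g`:
`∑_{i=1}^n ∑_{j=i+1}^n g (τ^i z, τ^j z)`. -/
noncomputable def uStatistic {A : Type*} (g : (ℕ → A) → (ℕ → A) → ℝ) (n : ℕ) (z : ℕ → A) : ℝ :=
  ∑ i ∈ Finset.Icc 1 n, ∑ j ∈ Finset.Icc (i + 1) n, g (shift i z) (shift j z)

/-- The Hoeffding projection `z ↦ E g (z, Z)` of the kernel `g`. -/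
noncomputable def hoeffding {Ω A : Type*} [MeasurableSpace Ω] (μ : Measure Ω) (Z : Ω → ℕ → A)
    (g : (ℕ → A) → (ℕ → A) → ℝ) (z : ℕ → A) : ℝ :=
  ∫ ω, g z (Z ω) ∂μ

/-- The constant `κ = ∑_{k ≥ 1} E H_k (Z)`, where `H_k` is the Hoeffding projection of `h_k`. -/
noncomputable def kappa {Ω A : Type*} [MeasurableSpace Ω] (μ : Measure Ω) (Z : Ω → ℕ → A)
    (h : ℕ → (ℕ → A) → (ℕ → A) → ℝ) : ℝ :=
  ∑' k : ℕ, ∫ ω, hoeffding μ Z (h (k + 1)) (Z ω) ∂μ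

/-- `∑_{i=1}^n ∑_{k ≥ 1} H_k (τ^i z) - n κ`. -/
noncomputable def centeredProjectionSum {Ω A : Type*} [MeasurableSpace Ω] (μ : Measure Ω)
    (Z : Ω → ℕ → A) (h : ℕ → (ℕ → A) → (ℕ → A) → ℝ) (n : ℕ) (z : ℕ → A) : ℝ :=
  (∑ i ∈ Finset.Icc 1 n, ∑' k : ℕ, hoeffding μ Z (h (k + 1)) (shift i z)) - n * kappa μ Z h

end MarkovUStat

/-!
The statement is first transferred to the law `ν` of the chain on sequence space. Some power of the
transition matrix of an irreducible aperiodic chain is positive, so Doeblin's contraction argument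
gives `|Qⁿ(a, b) - p(b)| ≤ K ρⁿ p(b)` (`exists_geometric_bound`). Hence the chain is `ψ`-mixing
with a geometric rate: decoupling the past from a future separated from it by a gap `g` costs a
factor `K ρ^g` (`IsStationaryMarkovChain.isPsiMixing`), and likewise for a stretch of time
decoupled from everything on its two sides (`IsPsiMixing.two_sided`).

Mixing carries the assumption `E |h_k (Z, τ^i Z)| ≤ C β^k` over to independent copies of the chain
(`MixingKernelFamily.integral_integral_abs_le`), so the projections `H_k` are geometrically small
in mean. As they are bounded, `∑ H_k - κ` is approximated by functions `f_L` of the first `L`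
entries with an error `Ψ η^L`, where `Ψ` is square integrable
(`MixingKernelFamily.exists_isGeometricApprox`). This yields geometric decay of autocovariances and
the existence of the limiting variance (`IsGeometricApprox.exists_tendsto_variance`).

Now let `L` grow very slowly with `n`, like `n ^ (1 / 16)`, and keep only the kernels `h_k` with
`k ≤ L`. Up to a term that is small in mean, the Hoeffding decomposition
(`MixingKernelFamily.uStatistic_truncated_eq`) writes `W_n - n² κ / 2` as `n ∑ f_L (τ^i Z)` plus a
degenerate `U`-statistic. In the second moment of the latter a quadruple of times one of which is
far from the other three contributes almost nothing, so it is of order `n² L⁴` and negligible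
against `n³` (`integral_uStatistic_sq_le`). The sum of the `f_L` satisfies a central limit theorem
by the Stein–Tikhomirov method: expanding `exp (i u S)` around the sum with the neighbours of one
time left out shows that the characteristic function of the normalized sum almost solves the
differential equation `φ' = -σ² t φ` of the Gaussian one (`norm_charFun_sum_sub_exp_le`,
`IsGeometricApprox.tendsto_integral_expI`). Lévy's continuity theorem and Slutsky's theorem finish
the proof (`MixingKernelFamily.tendstoInDistribution_uStatistic`). A vanishing limiting variance
needs no separate treatment.
-/

namespace MarkovUStat

/-! ### Geometric convergence of the transition matrix -/

section Matrix

variable {A : Type*} [Fintype A] {Q : Matrix A A ℝ} {p : A → ℝ}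

/-- A stochastic matrix whose rows all dominate `δ p` contracts the sup norm of functions with
`p`-mean zero by the factor `1 - δ`. -/
lemma abs_sum_mul_le_of_minorization {R : Matrix A A ℝ} (hR1 : ∀ a, ∑ b, R a b = 1)
    (hp1 : ∑ a, p a = 1)
    {δ : ℝ} (hδ : ∀ a b, δ * p b ≤ R a b) {f : A → ℝ} (hf : ∑ b, p b * f b = 0) {c : ℝ}
    (hc : ∀ b, |f b| ≤ c) (a : A) : |∑ b, R a b * f b| ≤ (1 - δ) * c := by
  have h₁ : ∑ b, R a b * f b = ∑ b, (R a b - δ * p b) * f b := by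
    simp_rw [sub_mul, Finset.sum_sub_distrib, mul_assoc, ← Finset.mul_sum, hf]
    simp
  rw [h₁]
  calc |∑ b, (R a b - δ * p b) * f b| ≤ ∑ b, |(R a b - δ * p b) * f b| :=
        Finset.abs_sum_le_sum_abs _ _
    _ ≤ ∑ b, (R a b - δ * p b) * c := by
        refine Finset.sum_le_sum fun b _ => ?_
        rw [abs_mul, abs_of_nonneg (sub_nonneg.2 (hδ a b))]
        exact mul_le_mul_of_nonneg_left (hc b) (sub_nonneg.2 (hδ a b))
    _ = (1 - δ) * c := by
        rw [← Finset.sum_mul, Finset.sum_sub_distrib, hR1, ← Finset.mul_sum, hp1, mul_one]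

variable [DecidableEq A]

lemma sum_pow_eq_one (hQ1 : ∀ a, ∑ b, Q a b = 1) (n : ℕ) (a : A) : ∑ b, (Q ^ n) a b = 1 := by
  induction n generalizing a with
  | zero => simp [Matrix.one_apply]
  | succ n ih =>
    simp_rw [pow_succ, Matrix.mul_apply]
    rw [Finset.sum_comm]
    simp_rw [← Finset.mul_sum, hQ1, mul_one, ih]

lemma sum_stationary_pow (hst : ∀ b, ∑ a, p a * Q a b = p b) (n : ℕ) (b : A) :
    ∑ a, p a * (Q ^ n) a b = p b := by
  induction n generalizing b with
  | zero => simp [Matrix.one_apply]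
  | succ n ih =>
    simp_rw [pow_succ, Matrix.mul_apply, Finset.mul_sum, ← mul_assoc]
    rw [Finset.sum_comm]
    simp_rw [← Finset.sum_mul, ih, hst]

lemma pow_add_apply_pos (hQ : ∀ a b, 0 ≤ Q a b) {m n : ℕ} {a b c : A} (h₁ : 0 < (Q ^ m) a b)
    (h₂ : 0 < (Q ^ n) b c) : 0 < (Q ^ (m + n)) a c := by
  rw [pow_add, Matrix.mul_apply]
  exact Finset.sum_pos'
    (fun x _ => mul_nonneg (Matrix.pow_apply_nonneg hQ m a x) (Matrix.pow_apply_nonneg hQ n x c))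
    ⟨b, Finset.mem_univ b, mul_pos h₁ h₂⟩

/-- Schur's theorem on numerical semigroups applies to the set of return times to a state. -/
lemma IsAperiodic.eventually_return_pos (hQ : ∀ a b, 0 ≤ Q a b) (hap : IsAperiodic Q) (a : A) :
    ∃ N, ∀ n ≥ N, 0 < (Q ^ n) a a := by
  let s : Set ℕ := {n | 1 ≤ n ∧ 0 < (Q ^ n) a a}
  let T : AddSubmonoid ℕ :=
    { carrier := {n | 0 < (Q ^ n) a a}
      add_mem' := fun hm hn => pow_add_apply_pos hQ hm hn
      zero_mem' := by simp }
  have hgcd : Nat.setGcd s = 1 := hap a _ fun n hn hpos => Nat.setGcd_dvd_of_mem ⟨hn, hpos⟩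
  obtain ⟨N, hN⟩ := Nat.exists_mem_closure_of_ge s
  have hle : AddSubmonoid.closure s ≤ T := AddSubmonoid.closure_le.2 fun n hn => hn.2
  exact ⟨N, fun n hn => hle (hN n hn (by simp [hgcd]))⟩

/-- An irreducible aperiodic nonnegative matrix is primitive. -/
lemma exists_pow_pos (hirr : Q.IsIrreducible) (hap : IsAperiodic Q) :
    ∃ m, ∀ a b, 0 < (Q ^ m) a b := by
  have hQ := hirr.nonneg
  have hirr' := (Matrix.isIrreducible_iff_exists_pow_pos hQ).1 hirr
  choose k _ hk using hirr'
  choose N hN using hap.eventually_return_pos hQ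
  refine ⟨∑ a, N a + ∑ a, ∑ b, k a b, fun a b => ?_⟩
  have h₁ : N a ≤ ∑ a, N a := Finset.single_le_sum (fun _ _ => Nat.zero_le _) (Finset.mem_univ a)
  have h₂ : k a b ≤ ∑ b, k a b :=
    Finset.single_le_sum (fun _ _ => Nat.zero_le _) (Finset.mem_univ b)
  have h₃ : ∑ b, k a b ≤ ∑ a, ∑ b, k a b :=
    Finset.single_le_sum (f := fun a => ∑ b, k a b) (fun _ _ => Nat.zero_le _) (Finset.mem_univ a)
  have := pow_add_apply_pos hQ (hN a (∑ a, N a + ∑ a, ∑ b, k a b - k a b) (by omega)) (hk a b)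
  rwa [Nat.sub_add_cancel (by omega)] at this

lemma stationary_pos (hirr : Q.IsIrreducible) (hp : ∀ a, 0 ≤ p a) (hp1 : ∑ a, p a = 1)
    (hst : ∀ b, ∑ a, p a * Q a b = p b) (b : A) : 0 < p b := by
  have hQ := hirr.nonneg
  obtain ⟨a, ha⟩ : ∃ a, 0 < p a := by
    by_contra! h
    have : ∑ a, p a ≤ 0 := Finset.sum_nonpos fun a _ => h a
    linarith
  obtain ⟨k, _, hk⟩ := (Matrix.isIrreducible_iff_exists_pow_pos hQ).1 hirr a b
  rw [← sum_stationary_pow hst k b]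
  exact Finset.sum_pos' (fun x _ => mul_nonneg (hp x) (Matrix.pow_apply_nonneg hQ k x b))
    ⟨a, Finset.mem_univ a, mul_pos ha hk⟩

/-- Geometric ergodicity: some power of the transition matrix is positive, so its rows dominate a
multiple of the stationary distribution, and each further such power contracts the deviation from
it. The bound is relative to `p b` because this is what makes the chain `ψ`-mixing. -/
lemma exists_geometric_bound (hirr : Q.IsIrreducible) (hap : IsAperiodic Q) (hp : ∀ a, 0 ≤ p a)
    (hp1 : ∑ a, p a = 1) (hQ1 : ∀ a, ∑ b, Q a b = 1) (hst : ∀ b, ∑ a, p a * Q a b = p b) :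
    ∃ K ρ : ℝ, 0 ≤ K ∧ 0 < ρ ∧ ρ < 1 ∧ ∀ n a b, |(Q ^ n) a b - p b| ≤ K * ρ ^ n * p b := by
  classical
  have hQ := hirr.nonneg
  have hpos := stationary_pos hirr hp hp1 hst
  have hne : Nonempty A := by
    by_contra h
    rw [not_nonempty_iff] at h
    simp at hp1
  obtain ⟨m, hm⟩ := exists_pow_pos hirr hap
  obtain ⟨q, hq⟩ := Finite.exists_min fun q : A × A => (Q ^ (m + 1)) q.1 q.2
  obtain ⟨b₀, hb₀⟩ := Finite.exists_min p
  have hm' : 0 < (Q ^ (m + 1)) q.1 q.2 := by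
    rw [pow_succ', Matrix.mul_apply]
    obtain ⟨c, hc⟩ : ∃ c, 0 < Q q.1 c := by
      by_contra! h
      have : ∑ c, Q q.1 c ≤ 0 := Finset.sum_nonpos fun c _ => h c
      linarith [hQ1 q.1]
    exact Finset.sum_pos' (fun x _ => mul_nonneg (hQ _ _) (hm _ _).le)
      ⟨c, Finset.mem_univ c, mul_pos hc (hm _ _)⟩
  -- the cap `1 / 2` keeps the contraction factor `1 - δ`, and with it `ρ`, positive
  set δ : ℝ := min ((Q ^ (m + 1)) q.1 q.2) (1 / 2) with hδdef
  have hδ0 : 0 < δ := lt_min hm' (by norm_num)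
  have hδ1 : δ ≤ 1 / 2 := min_le_right _ _
  have hp_le : ∀ b, p b ≤ 1 := fun b => hp1 ▸ Finset.single_le_sum (fun a _ => hp a)
    (Finset.mem_univ b)
  have hminor : ∀ a b, δ * p b ≤ (Q ^ (m + 1)) a b := fun a b =>
    calc δ * p b ≤ δ * 1 := by gcongr; exact hp_le b
      _ ≤ (Q ^ (m + 1)) q.1 q.2 := by rw [mul_one]; exact min_le_left _ _
      _ ≤ _ := hq (a, b)
  -- the deviation from `p` after `(m + 1) k + r` steps
  have key : ∀ k r a b, |(Q ^ ((m + 1) * k + r)) a b - p b| ≤ (1 - δ) ^ k := by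
    intro k r
    induction k with
    | zero =>
      intro a b
      have h₁ := Matrix.pow_apply_nonneg hQ r a b
      have h₂ : (Q ^ r) a b ≤ 1 := sum_pow_eq_one hQ1 r a ▸
        Finset.single_le_sum (fun x _ => Matrix.pow_apply_nonneg hQ r a x) (Finset.mem_univ b)
      have h₃ := hp b
      have h₄ := hp_le b
      simp only [mul_zero, zero_add, pow_zero]
      rw [abs_le]
      constructor <;> linarith
    | succ k ih =>
      intro a b
      have h₁ : (Q ^ ((m + 1) * (k + 1) + r)) a b - p b =
          ∑ c, (Q ^ (m + 1)) a c * ((Q ^ ((m + 1) * k + r)) c b - p b) := by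
        simp_rw [mul_sub, Finset.sum_sub_distrib, ← Finset.sum_mul, sum_pow_eq_one hQ1, one_mul,
          ← Matrix.mul_apply, ← pow_add]
        ring_nf
      rw [h₁, pow_succ' (1 - δ)]
      refine abs_sum_mul_le_of_minorization (sum_pow_eq_one hQ1 _) hp1 hminor ?_
        (fun c => ih c b) a
      simp_rw [mul_sub, Finset.sum_sub_distrib, ← Finset.sum_mul, hp1, one_mul,
        sum_stationary_pow hst, sub_self]
  have hbase : (0 : ℝ) < 1 - δ := by linarith
  have hbase1 : 1 - δ < 1 := by linarith
  have hexp : (0 : ℝ) < 1 / ((m : ℝ) + 1) := by positivity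
  refine ⟨(p b₀)⁻¹ * (1 - δ)⁻¹, (1 - δ) ^ (1 / ((m : ℝ) + 1)), ?_, Real.rpow_pos_of_pos hbase _,
    Real.rpow_lt_one hbase.le hbase1 hexp, fun n a b => ?_⟩
  · have := hpos b₀
    positivity
  have h₁ := key (n / (m + 1)) (n % (m + 1)) a b
  rw [Nat.div_add_mod] at h₁
  have h₂ : (1 - δ) ^ (n / (m + 1)) ≤ (1 - δ)⁻¹ * ((1 - δ) ^ (1 / ((m : ℝ) + 1))) ^ n := by
    rw [← Real.rpow_natCast, ← Real.rpow_natCast, ← Real.rpow_mul hbase.le,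
      ← Real.rpow_neg_one, ← Real.rpow_add hbase]
    refine Real.rpow_le_rpow_of_exponent_ge hbase hbase1.le ?_
    have h₃ : n < (m + 1) * (n / (m + 1) + 1) := Nat.lt_mul_div_succ n (Nat.succ_pos m)
    have h₄ : (n : ℝ) < ((m : ℝ) + 1) * ((n / (m + 1) : ℕ) + 1) := by exact_mod_cast h₃
    have h₅ : 1 / ((m : ℝ) + 1) * n ≤ (n / (m + 1) : ℕ) + 1 := by
      rw [one_div, inv_mul_le_iff₀ (by positivity)]
      exact h₄.le
    linarith
  have h₆ : 1 ≤ (p b₀)⁻¹ * p b := by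
    rw [← div_eq_inv_mul, le_div_iff₀ (hpos b₀), one_mul]
    exact hb₀ b
  calc _ ≤ _ := h₁.trans h₂
    _ ≤ ((1 - δ)⁻¹ * ((1 - δ) ^ (1 / ((m : ℝ) + 1))) ^ n) * ((p b₀)⁻¹ * p b) :=
        le_mul_of_one_le_right (by positivity) h₆
    _ = _ := by ring

end Matrix

/-! ### The law of the chain on sequence space -/

section Law

variable {A : Type*} [MeasurableSpace A]

@[fun_prop]
lemma measurable_shift (i : ℕ) : Measurable (shift i : (ℕ → A) → ℕ → A) :=
  measurable_pi_lambda _ fun j => measurable_pi_apply (i + j)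

variable [DiscreteMeasurableSpace A]

lemma measurableSet_cylinder_le (m k : ℕ) (w : ℕ → A) :
    MeasurableSet {z : ℕ → A | ∀ j ≤ k, z (m + j) = w j} := by
  have : {z : ℕ → A | ∀ j ≤ k, z (m + j) = w j} =
      ⋂ j ∈ Finset.Iic k, (fun z : ℕ → A => z (m + j)) ⁻¹' {w j} := by
    ext z
    simp
  rw [this]
  exact Finset.measurableSet_biInter _ fun j _ => measurable_pi_apply (m + j) (.of_discrete)

variable [Fintype A]

/-- The law of a stationary Markov chain on sequence space makes the coordinate process a
stationary Markov chain. -/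
lemma IsStationaryMarkovChain.map_law {Ω : Type*} [MeasurableSpace Ω] {μ : Measure Ω}
    {p : A → ℝ} {Q : Matrix A A ℝ} {Z : Ω → ℕ → A} (hZ : IsStationaryMarkovChain μ p Q Z) :
    IsStationaryMarkovChain (μ.map Z) p Q id where
  measurable := measurable_id
  initial_nonneg := hZ.initial_nonneg
  initial_sum := hZ.initial_sum
  trans_nonneg := hZ.trans_nonneg
  trans_sum := hZ.trans_sum
  stationary := hZ.stationary
  law m k w := by
    rw [← hZ.law m k w]
    exact map_measureReal_apply hZ.measurable (measurableSet_cylinder_le m k w)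

variable {ν : Measure (ℕ → A)} [IsProbabilityMeasure ν] {p : A → ℝ} {Q : Matrix A A ℝ}

/-- The word `u` of length `a + 1`, continued by its last letter. -/
def extendWord (a : ℕ) (u : Finset.Iic a → A) (j : ℕ) : A :=
  u ⟨min j a, Finset.mem_Iic.2 (min_le_right j a)⟩

omit [Fintype A] [MeasurableSpace A] [DiscreteMeasurableSpace A] in
lemma extendWord_restrict {a j : ℕ} (hj : j ≤ a) (z : ℕ → A) :
    extendWord a (Preorder.frestrictLe (π := fun _ => A) a z) j = z j := by
  simp [extendWord, hj]

omit [Fintype A] [MeasurableSpace A] [DiscreteMeasurableSpace A] in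
lemma restrict_eq_iff {a : ℕ} (z : ℕ → A) (u : Finset.Iic a → A) :
    Preorder.frestrictLe (π := fun _ => A) a z = u ↔ ∀ j ≤ a, z j = extendWord a u j := by
  constructor
  · rintro rfl j hj
    rw [extendWord_restrict hj]
  · intro h
    ext ⟨j, hj⟩
    have hj' := Finset.mem_Iic.1 hj
    rw [Preorder.frestrictLe_apply, h j hj']
    simp [extendWord, hj']

lemma IsStationaryMarkovChain.measurePreserving_shift
    (hZ : IsStationaryMarkovChain ν p Q id) (i : ℕ) : MeasurePreserving (shift i) ν ν := by
  refine ⟨measurable_shift i, ?_⟩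
  have hm : IsProbabilityMeasure (ν.map (shift i)) :=
    Measure.isProbabilityMeasure_map (measurable_shift i).aemeasurable
  have hfam : IsProjectiveMeasureFamily (α := fun _ : ℕ => A) fun I : Finset ℕ =>
      ν.map (I.restrict (π := fun _ : ℕ => A)) := by
    intro I J hJI
    rw [Measure.map_map (by fun_prop) (by fun_prop)]
    rfl
  have h₁ : IsProjectiveLimit (α := fun _ : ℕ => A) ν fun I : Finset ℕ =>
      ν.map (I.restrict (π := fun _ : ℕ => A)) := fun I => rfl
  refine IsProjectiveLimit.unique ((isProjectiveLimit_nat_iff hfam _).2 fun n => ?_) h₁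
  rw [Measure.map_map (by fun_prop) (by fun_prop)]
  refine Measure.ext_of_singleton fun u => ?_
  rw [Measure.map_apply (by fun_prop) .of_discrete, Measure.map_apply (by fun_prop) .of_discrete,
    ← measureReal_eq_measureReal_iff]
  have e₀ : (Finset.Iic n).restrict (π := fun _ => A) ⁻¹' {u} =
      {z : ℕ → A | ∀ j ≤ n, id z (0 + j) = extendWord n u j} := by
    ext z
    simp only [Set.mem_ofPred_eq, id, zero_add]
    exact restrict_eq_iff z u
  have e₁ : (Preorder.frestrictLe (π := fun _ => A) n ∘ shift i) ⁻¹' {u} =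
      {z : ℕ → A | ∀ j ≤ n, id z (i + j) = extendWord n u j} := by
    ext z
    exact restrict_eq_iff (shift i z) u
  rw [e₀, e₁, hZ.law, hZ.law]

/-- The joint probability of two words separated by a gap of `g` steps. -/
lemma IsStationaryMarkovChain.law_gap [DecidableEq A] (hZ : IsStationaryMarkovChain ν p Q id)
    (a g k : ℕ) (u w : ℕ → A) :
    ν.real {z | (∀ j ≤ a, z j = u j) ∧ ∀ j ≤ k, z (a + g + j) = w j} =
      (p (u 0) * ∏ j ∈ Finset.range a, Q (u j) (u (j + 1))) * (Q ^ g) (u a) (w 0) *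
        ∏ j ∈ Finset.range k, Q (w j) (w (j + 1)) := by
  induction g generalizing k w with
  | zero =>
    by_cases h : u a = w 0
    · let v : ℕ → A := fun j => if j ≤ a then u j else w (j - a)
      have hv : ∀ j, v (a + j) = w j := by
        intro j
        rcases Nat.eq_zero_or_pos j with rfl | hj
        · simpa [v] using h
        · simp [v, show ¬ (a + j ≤ a) by omega]
      have e : {z : ℕ → A | (∀ j ≤ a, z j = u j) ∧ ∀ j ≤ k, z (a + 0 + j) = w j} =
          {z : ℕ → A | ∀ j ≤ a + k, id z (0 + j) = v j} := by
        ext z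
        simp only [Set.mem_ofPred_eq, id, zero_add, add_zero]
        constructor
        · rintro ⟨h₁, h₂⟩ j hj
          by_cases hja : j ≤ a
          · simp [v, hja, h₁ j hja]
          · obtain ⟨l, rfl⟩ := Nat.exists_eq_add_of_le (Nat.le_of_not_le hja)
            rw [hv, h₂ l (by omega)]
        · intro h₁
          refine ⟨fun j hj => ?_, fun j hj => ?_⟩
          · rw [h₁ j (by omega)]
            simp [v, hj]
          · rw [h₁ (a + j) (by omega), hv]
      rw [e, hZ.law, Finset.prod_range_add, ← mul_assoc]
      congr 1
      · rw [h, pow_zero, Matrix.one_apply_eq, mul_one]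
        congr 1
        refine Finset.prod_congr rfl fun j hj => ?_
        have := Finset.mem_range.1 hj
        simp [v, show j ≤ a by omega, show j + 1 ≤ a by omega]
      · refine Finset.prod_congr rfl fun j _ => ?_
        rw [hv, add_assoc, hv]
    · have e : {z : ℕ → A | (∀ j ≤ a, z j = u j) ∧ ∀ j ≤ k, z (a + 0 + j) = w j} = ∅ := by
        ext z
        simp only [Set.mem_ofPred_eq, Set.mem_empty_iff_false, iff_false, not_and, add_zero]
        intro h₁ h₂
        exact h (by rw [← h₁ a le_rfl, ← h₂ 0 (Nat.zero_le _), add_zero])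
      rw [e, measureReal_empty, pow_zero, Matrix.one_apply_ne h]
      simp
  | succ g ih =>
    let v : A → ℕ → A := fun c j => match j with
      | 0 => c
      | j + 1 => w j
    have e : {z : ℕ → A | (∀ j ≤ a, z j = u j) ∧ ∀ j ≤ k, z (a + (g + 1) + j) = w j} =
        ⋃ c ∈ (Finset.univ : Finset A),
          {z | (∀ j ≤ a, z j = u j) ∧ ∀ j ≤ k + 1, z (a + g + j) = v c j} := by
      ext z
      simp only [Set.mem_ofPred_eq, Finset.mem_univ, Set.iUnion_true, Set.mem_iUnion]
      constructor
      · rintro ⟨h₁, h₂⟩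
        refine ⟨z (a + g), h₁, fun j hj => ?_⟩
        cases j with
        | zero => rfl
        | succ j =>
          change _ = w j
          rw [← h₂ j (by omega)]
          congr 1
          omega
      · rintro ⟨c, h₁, h₂⟩
        refine ⟨h₁, fun j hj => ?_⟩
        have := h₂ (j + 1) (by omega)
        change _ = w j at this
        rw [← this]
        congr 1
        omega
    rw [e, measureReal_biUnion_finset]
    · have hprod : ∀ c, ∏ j ∈ Finset.range (k + 1), Q (v c j) (v c (j + 1)) =
          (∏ j ∈ Finset.range k, Q (w j) (w (j + 1))) * Q c (w 0) := fun c => by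
        rw [Finset.prod_range_succ']
      simp_rw [ih, hprod]
      rw [pow_succ, Matrix.mul_apply, Finset.mul_sum, Finset.sum_mul]
      refine Finset.sum_congr rfl fun c _ => ?_
      change _ * (Q ^ g) (u a) c * _ = _
      ring
    · intro c _ d _ hcd
      rw [Function.onFun, Set.disjoint_left]
      rintro z ⟨-, h₁⟩ ⟨-, h₂⟩
      exact hcd ((h₁ 0 (Nat.zero_le _)).symm.trans (h₂ 0 (Nat.zero_le _)))
    · intro c _
      have h₁ := measurableSet_cylinder_le 0 a u
      simp only [zero_add] at h₁
      exact h₁.inter (measurableSet_cylinder_le (a + g) (k + 1) (v c))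

/-- A function of a sequence that depends on finitely many entries is measurable. -/
lemma measurable_of_dependsOn {E : Type*} [MeasurableSpace E] {f : (ℕ → A) → E} {a : ℕ}
    (hf : DependsOn f (Set.Iic a)) : Measurable f := by
  have : f = (fun u => f (extendWord a u)) ∘ Preorder.frestrictLe (π := fun _ => A) a := by
    ext z
    refine hf fun j hj => ?_
    rw [extendWord_restrict hj]
  rw [this]
  exact (measurable_of_finite _).comp (by fun_prop)

/-- `ψ`-mixing with a geometric rate: for functions `G` of the past up to time `a` and of a finite
stretch of the future from time `a + g` on, replacing the past by an independent copy changes the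
expectation by at most `K ρ ^ g` times the expectation of `|G|` under independence. -/
def IsPsiMixing (ν : Measure (ℕ → A)) (K ρ : ℝ) : Prop :=
  ∀ (a g N : ℕ) (G : (ℕ → A) → (ℕ → A) → ℂ), (∀ y, DependsOn (fun x => G x y) (Set.Iic a)) →
    (∀ x, DependsOn (G x) (Set.Icc (a + g) N)) →
    ‖∫ z, G z z ∂ν - ∫ x, ∫ y, G x y ∂ν ∂ν‖ ≤ K * ρ ^ g * ∫ x, ∫ y, ‖G x y‖ ∂ν ∂ν

omit [DiscreteMeasurableSpace A] [Fintype A] in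
lemma integral_comp_fintype {X E : Type*} [Fintype X] [MeasurableSpace X]
    [MeasurableSingletonClass X]
    [NormedAddCommGroup E] [NormedSpace ℝ E] [CompleteSpace E] {U : (ℕ → A) → X}
    (hU : Measurable U) (f : X → E) :
    ∫ z, f (U z) ∂ν = ∑ u, ν.real (U ⁻¹' {u}) • f u := by
  have : DiscreteMeasurableSpace X := MeasurableSingletonClass.toDiscreteMeasurableSpace
  have hprob := Measure.isProbabilityMeasure_map (μ := ν) hU.aemeasurable
  rw [← integral_map (f := f) hU.aemeasurable (StronglyMeasurable.of_discrete.aestronglyMeasurable),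
    integral_fintype .of_finite]
  refine Finset.sum_congr rfl fun u _ => ?_
  rw [map_measureReal_apply hU (measurableSet_singleton u)]

/-- A geometrically ergodic finite Markov chain is geometrically `ψ`-mixing. -/
lemma IsStationaryMarkovChain.isPsiMixing [DecidableEq A]
    (hZ : IsStationaryMarkovChain ν p Q id) {K ρ : ℝ}
    (hQ : ∀ n a b, |(Q ^ n) a b - p b| ≤ K * ρ ^ n * p b) : IsPsiMixing ν K ρ := by
  intro a g N G hG₁ hG₂
  classical
  let k := N - (a + g)
  let U : (ℕ → A) → (Finset.Iic a → A) := Preorder.frestrictLe (π := fun _ => A) a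
  let W : (ℕ → A) → (Finset.Iic k → A) :=
    fun z => Preorder.frestrictLe (π := fun _ => A) k (shift (a + g) z)
  have hU : Measurable U := by fun_prop
  have hW : Measurable W := by
    have : W = Preorder.frestrictLe (π := fun _ => A) k ∘ shift (a + g) := rfl
    rw [this]
    fun_prop
  let back : (Finset.Iic k → A) → ℕ → A := fun w j => extendWord k w (j - (a + g))
  let G' : (Finset.Iic a → A) → (Finset.Iic k → A) → ℂ := fun u w => G (extendWord a u) (back w)
  have hGG' : ∀ x y, G x y = G' (U x) (W y) := by
    intro x y
    have h₁ : G x y = G (extendWord a (U x)) y := hG₁ y fun j hj => by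
      rw [extendWord_restrict hj]
    rw [h₁]
    refine hG₂ _ fun j hj => ?_
    have hj₁ := hj.1
    have hj₂ := hj.2
    simp only [back, W]
    rw [extendWord_restrict (by omega)]
    simp only [shift]
    congr 1
    omega
  let P : (Finset.Iic a → A) → ℝ := fun u => ν.real (U ⁻¹' {u})
  let R : (Finset.Iic k → A) → ℝ := fun w => ν.real (W ⁻¹' {w})
  let J : (Finset.Iic a → A) → (Finset.Iic k → A) → ℝ :=
    fun u w => ν.real ((fun z => (U z, W z)) ⁻¹' {(u, w)})
  have hP : ∀ u, P u = p (extendWord a u 0) *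
      ∏ j ∈ Finset.range a, Q (extendWord a u j) (extendWord a u (j + 1)) := by
    intro u
    rw [← hZ.law 0 a]
    change ν.real _ = ν.real _
    congr 1
    ext z
    simpa using restrict_eq_iff z u
  have hR : ∀ w, R w = p (extendWord k w 0) *
      ∏ j ∈ Finset.range k, Q (extendWord k w j) (extendWord k w (j + 1)) := by
    intro w
    rw [← hZ.law (a + g) k]
    change ν.real _ = ν.real _
    congr 1
    ext z
    exact restrict_eq_iff (shift (a + g) z) w
  have hJ : ∀ u w, J u w = P u * (Q ^ g) (extendWord a u a) (extendWord k w 0) *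
      ∏ j ∈ Finset.range k, Q (extendWord k w j) (extendWord k w (j + 1)) := by
    intro u w
    rw [hP, ← hZ.law_gap a g k]
    change ν.real _ = ν.real _
    congr 1
    ext z
    simp only [Set.mem_preimage, Set.mem_singleton_iff, Prod.mk.injEq]
    exact and_congr (restrict_eq_iff z u) (restrict_eq_iff (shift (a + g) z) w)
  have hJPR : ∀ u w, |J u w - P u * R w| ≤ K * ρ ^ g * (P u * R w) := by
    intro u w
    have hprod : 0 ≤ ∏ j ∈ Finset.range k, Q (extendWord k w j) (extendWord k w (j + 1)) :=
      Finset.prod_nonneg fun j _ => hZ.trans_nonneg _ _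
    have hP0 : 0 ≤ P u := measureReal_nonneg
    have e : J u w - P u * R w = P u * ((Q ^ g) (extendWord a u a) (extendWord k w 0) -
        p (extendWord k w 0)) *
        ∏ j ∈ Finset.range k, Q (extendWord k w j) (extendWord k w (j + 1)) := by
      rw [hJ, hR]
      ring
    rw [e, abs_mul, abs_mul, abs_of_nonneg hP0, abs_of_nonneg hprod]
    calc _ ≤ P u * (K * ρ ^ g * p (extendWord k w 0)) *
          ∏ j ∈ Finset.range k, Q (extendWord k w j) (extendWord k w (j + 1)) := by
          gcongr
          exact hQ _ _ _
      _ = _ := by rw [hR]; ring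
  have hjoint : ∫ z, G z z ∂ν = ∑ u, ∑ w, J u w • G' u w := by
    simp_rw [hGG']
    rw [integral_comp_fintype (hU.prodMk hW) fun q => G' q.1 q.2, Fintype.sum_prod_type]
  have hindep : ∀ {E : Type} [NormedAddCommGroup E] [NormedSpace ℝ E] [CompleteSpace E]
      (f : (Finset.Iic a → A) → (Finset.Iic k → A) → E),
      ∫ x, ∫ y, f (U x) (W y) ∂ν ∂ν = ∑ u, ∑ w, (P u * R w) • f u w := by
    intro E _ _ _ f
    rw [integral_comp_fintype hU fun u => ∫ y, f u (W y) ∂ν]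
    refine Finset.sum_congr rfl fun u _ => ?_
    rw [integral_comp_fintype hW (f u), Finset.smul_sum]
    simp_rw [smul_smul]
    rfl
  rw [hjoint]
  simp_rw [hGG']
  rw [hindep G', hindep fun u w => ‖G' u w‖]
  simp_rw [← Finset.sum_sub_distrib, ← sub_smul]
  rw [Finset.mul_sum]
  refine (norm_sum_le _ _).trans (Finset.sum_le_sum fun u _ => ?_)
  rw [Finset.mul_sum]
  refine (norm_sum_le _ _).trans (Finset.sum_le_sum fun w _ => ?_)
  rw [norm_smul, Real.norm_eq_abs, smul_eq_mul, ← mul_assoc]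
  exact mul_le_mul_of_nonneg_right (hJPR u w) (norm_nonneg _)

end Law

/-! ### Two-sided mixing -/

section TwoSided

variable {A : Type*} [MeasurableSpace A] [DiscreteMeasurableSpace A] [Fintype A]

lemma measurable_uncurry_of_dependsOn {E : Type*} [MeasurableSpace E] {f : (ℕ → A) → (ℕ → A) → E}
    {a b : ℕ} (hf₁ : ∀ y, DependsOn (fun x => f x y) (Set.Iic a))
    (hf₂ : ∀ x, DependsOn (f x) (Set.Iic b)) : Measurable (Function.uncurry f) := by
  have : Function.uncurry f = (fun q => f (extendWord a q.1) (extendWord b q.2)) ∘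
      Prod.map (Preorder.frestrictLe (π := fun _ => A) a)
        (Preorder.frestrictLe (π := fun _ => A) b) := by
    ext ⟨x, y⟩
    simp only [Function.uncurry, Function.comp, Prod.map]
    exact (hf₁ y fun j hj => (extendWord_restrict hj x).symm).trans
      (hf₂ _ fun j hj => (extendWord_restrict hj y).symm)
  rw [this]
  exact (measurable_of_finite _).comp (by fun_prop)

variable {ν : Measure (ℕ → A)} [IsProbabilityMeasure ν]

lemma norm_integral_le_of_bound {Ω E : Type*} [MeasurableSpace Ω] {P : Measure Ω}
    [IsProbabilityMeasure P] [NormedAddCommGroup E] [NormedSpace ℝ E]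
    {f : Ω → E} {c : ℝ} (hf : ∀ z, ‖f z‖ ≤ c) : ‖∫ z, f z ∂P‖ ≤ c := by
  simpa using norm_integral_le_of_norm_le_const (μ := P) (Eventually.of_forall hf)

omit [DiscreteMeasurableSpace A] [Fintype A] in
lemma abs_integral_le_of_bound {f : (ℕ → A) → ℝ} {c : ℝ} (hf : ∀ z, |f z| ≤ c) :
    |∫ z, f z ∂ν| ≤ c := by
  rw [← Real.norm_eq_abs]
  exact norm_integral_le_of_bound hf

lemma integrable_of_dependsOn {E : Type*} [NormedAddCommGroup E] [MeasurableSpace E] [BorelSpace E]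
    [SecondCountableTopology E] {f : (ℕ → A) → E} {a : ℕ} {c : ℝ}
    (hf : DependsOn f (Set.Iic a)) (hc : ∀ z, ‖f z‖ ≤ c) : Integrable f ν :=
  Integrable.of_bound (measurable_of_dependsOn hf).aestronglyMeasurable c (Eventually.of_forall hc)

variable {K ρ : ℝ}

omit [DiscreteMeasurableSpace A] [Fintype A] in
lemma IsPsiMixing.norm_integral_sub_le (hν : IsPsiMixing ν K ρ) (hK : 0 ≤ K) (hρ : 0 ≤ ρ)
    {a g N : ℕ} {G : (ℕ → A) → (ℕ → A) → ℂ} (hG₁ : ∀ y, DependsOn (fun x => G x y) (Set.Iic a))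
    (hG₂ : ∀ x, DependsOn (G x) (Set.Icc (a + g) N)) {B : ℝ} (hB : ∀ x y, ‖G x y‖ ≤ B) :
    ‖∫ z, G z z ∂ν - ∫ x, ∫ y, G x y ∂ν ∂ν‖ ≤ K * ρ ^ g * B := by
  refine (hν a g N G hG₁ hG₂).trans (mul_le_mul_of_nonneg_left ?_ (by positivity))
  refine (Real.le_norm_self _).trans (norm_integral_le_of_bound fun x => ?_)
  exact norm_integral_le_of_bound fun y => by simpa using hB x y

/-- The sequence that follows `y` before time `a` and `w` from time `a` on. -/
def splice (a : ℕ) (y w : ℕ → A) (j : ℕ) : A := if j < a then y j else w j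

/-- Two-sided mixing: if `G x y` depends on the entries of `x` in `[a, b)` and on the entries of
`y` at distance at least `g` from this interval, then the two arguments may be decoupled. The left
part, the middle part and the right part of the sequence are made independent of each other by
applying one-sided mixing at both ends of the interval, and the left and right part are put
together again by a third application. -/
lemma IsPsiMixing.two_sided (hν : IsPsiMixing ν K ρ) (hK : 0 ≤ K) (hρ : 0 ≤ ρ) {a b g N : ℕ}
    (hab : a ≤ b) (hg : 1 ≤ g) {G : (ℕ → A) → (ℕ → A) → ℂ}
    (hG₁ : ∀ y, DependsOn (fun x => G x y) (Set.Ico a b))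
    (hG₂ : ∀ x, DependsOn (G x) {j | j + g ≤ a ∨ b + g ≤ j ∧ j ≤ N}) {B : ℝ}
    (hB : ∀ x y, ‖G x y‖ ≤ B) :
    ‖∫ z, G z z ∂ν - ∫ x, ∫ y, G x y ∂ν ∂ν‖ ≤ 3 * (K * ρ ^ g * B) := by
  obtain ⟨z₀⟩ := ν.nonempty_of_neZero
  have hB0 : 0 ≤ B := (norm_nonneg _).trans (hB z₀ z₀)
  have hxdep : ∀ {x x' : ℕ → A} (y), (∀ j, a ≤ j → j < b → x j = x' j) → G x y = G x' y :=
    fun y h => hG₁ y fun j hj => h j hj.1 hj.2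
  have hydep : ∀ (x) {y y' : ℕ → A},
      (∀ j, j + g ≤ a ∨ b + g ≤ j ∧ j ≤ N → y j = y' j) → G x y = G x y' :=
    fun x _ _ h => hG₂ x fun j hj => h j hj
  have hint : ∀ (f : (ℕ → A) → ℂ), DependsOn f (Set.Iic (max (b + g) N)) → (∀ z, ‖f z‖ ≤ B) →
      Integrable f ν := fun f => integrable_of_dependsOn
  -- separate the left part
  have hA : ‖∫ z, G z z ∂ν - ∫ y, ∫ w, G w (splice a y w) ∂ν ∂ν‖ ≤ K * ρ ^ g * B := by
    by_cases hga : g ≤ a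
    · have key := hν.norm_integral_sub_le hK hρ (a := a - g) (g := g) (N := max b N)
        (G := fun y w => G w (splice a y w)) ?_ ?_ fun y w => hB w _
      · have e : ∀ z : ℕ → A, splice a z z = z := fun z => by
          ext j
          simp [splice]
        simpa only [e] using key
      · intro w y y' h
        refine hydep w fun j hj => ?_
        by_cases hja : j < a
        · simp only [splice, hja, if_true]
          exact h j (Set.mem_Iic.2 (by omega))
        · simp [splice, hja]
      · intro y w w' h
        have h' : ∀ j, a ≤ j → j ≤ max b N → w j = w' j := fun j h₁ h₂ =>
          h j ⟨by omega, h₂⟩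
        change G w _ = G w' _
        rw [hxdep _ fun j h₁ h₂ => h' j h₁ (le_max_of_le_left h₂.le)]
        refine hydep w' fun j hj => ?_
        by_cases hja : j < a
        · simp [splice, hja]
        · simp only [splice, hja, if_false]
          exact h' j (by omega) (by omega)
    · have e : ∀ y w : ℕ → A, G w (splice a y w) = G w w := fun y w => hydep w fun j hj => by
        simp [splice, show ¬ j < a by omega]
      simp only [e, integral_const, probReal_univ, one_smul, sub_self, norm_zero]
      positivity
  -- separate the middle part from the right part
  have hM : ∀ y, ‖∫ w, G w (splice a y w) ∂ν - ∫ w, ∫ w', G w (splice a y w') ∂ν ∂ν‖ ≤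
      K * ρ ^ g * B := by
    intro y
    refine hν.norm_integral_sub_le hK hρ (a := b) (g := g) (N := N)
      (G := fun w w' => G w (splice a y w')) ?_ ?_ fun w w' => hB w _
    · intro w' w₁ w₂ h
      exact hxdep _ fun j _ h₂ => h j h₂.le
    · intro w w₁ w₂ h
      refine hydep w fun j hj => ?_
      by_cases hja : j < a
      · simp [splice, hja]
      · simp only [splice, hja, if_false]
        exact h j ⟨by omega, by omega⟩
  -- join the left part and the right part
  have hC : ∀ x, ‖∫ y, G x y ∂ν - ∫ y, ∫ w', G x (splice a y w') ∂ν ∂ν‖ ≤ K * ρ ^ g * B := by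
    intro x
    have key := hν.norm_integral_sub_le hK hρ (a := b) (g := g) (N := N)
      (G := fun y w' => G x (splice a y w')) ?_ ?_ fun w w' => hB x _
    · have e : ∀ z : ℕ → A, splice a z z = z := fun z => by
        ext j
        simp [splice]
      simpa only [e] using key
    · intro w' y y' h
      refine hydep x fun j hj => ?_
      by_cases hja : j < a
      · simp only [splice, hja, if_true]
        exact h j (Set.mem_Iic.2 (by omega))
      · simp [splice, hja]
    · intro y w₁ w₂ h
      refine hydep x fun j hj => ?_
      by_cases hja : j < a
      · simp [splice, hja]
      · simp only [splice, hja, if_false]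
        exact h j ⟨by omega, by omega⟩
  let Φ : (ℕ → A) → (ℕ → A) → ℂ := fun y w => ∫ w', G w (splice a y w') ∂ν
  have hΦB : ∀ y w, ‖Φ y w‖ ≤ B := fun y w => norm_integral_le_of_bound fun w' => hB _ _
  have hΦ₁ : ∀ w, DependsOn (fun y => Φ y w) (Set.Iic (max (b + g) N)) := by
    intro w y y' h
    refine integral_congr_ae (.of_forall fun w' => hydep w fun j hj => ?_)
    have := h j (Set.mem_Iic.2 (by omega))
    simp [splice, this]
  have hΦ₂ : ∀ y, DependsOn (Φ y) (Set.Iic (max (b + g) N)) := by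
    intro y w w' h
    exact integral_congr_ae (.of_forall fun _ =>
      hxdep _ fun j _ h₂ => h j (Set.mem_Iic.2 (by omega)))
  have hΦint : Integrable (Function.uncurry Φ) (ν.prod ν) :=
    Integrable.of_bound (measurable_uncurry_of_dependsOn hΦ₁ hΦ₂).aestronglyMeasurable B
      (.of_forall fun q => hΦB q.1 q.2)
  have hswap : ∫ y, ∫ w, Φ y w ∂ν ∂ν = ∫ w, ∫ y, Φ y w ∂ν ∂ν := integral_integral_swap hΦint
  have hM' : ‖∫ y, ∫ w, G w (splice a y w) ∂ν ∂ν - ∫ y, ∫ w, Φ y w ∂ν ∂ν‖ ≤ K * ρ ^ g * B := by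
    rw [← integral_sub]
    · exact norm_integral_le_of_bound hM
    · refine hint _ (fun y y' h => ?_) fun y => norm_integral_le_of_bound fun w => hB _ _
      refine integral_congr_ae (.of_forall fun w => hydep w fun j hj => ?_)
      have := h j (Set.mem_Iic.2 (by omega))
      simp [splice, this]
    · exact hΦint.integral_prod_left
  have hC' : ‖∫ x, ∫ y, G x y ∂ν ∂ν - ∫ w, ∫ y, Φ y w ∂ν ∂ν‖ ≤ K * ρ ^ g * B := by
    rw [← integral_sub]
    · exact norm_integral_le_of_bound hC
    · refine hint _ (fun x x' h => ?_) fun y => norm_integral_le_of_bound fun w => hB _ _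
      exact integral_congr_ae (.of_forall fun _ =>
        hxdep _ fun j _ h₂ => h j (Set.mem_Iic.2 (by omega)))
    · exact hΦint.integral_prod_right
  calc ‖∫ z, G z z ∂ν - ∫ x, ∫ y, G x y ∂ν ∂ν‖
      = ‖(∫ z, G z z ∂ν - ∫ y, ∫ w, G w (splice a y w) ∂ν ∂ν) +
          (∫ y, ∫ w, G w (splice a y w) ∂ν ∂ν - ∫ y, ∫ w, Φ y w ∂ν ∂ν) -
          (∫ x, ∫ y, G x y ∂ν ∂ν - ∫ w, ∫ y, Φ y w ∂ν ∂ν)‖ := by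
        rw [hswap]
        congr 1
        ring
    _ ≤ K * ρ ^ g * B + K * ρ ^ g * B + K * ρ ^ g * B :=
        (norm_sub_le _ _).trans (add_le_add ((norm_add_le _ _).trans (add_le_add hA hM')) hC')
    _ = _ := by ring

lemma IsPsiMixing.two_sided_real (hν : IsPsiMixing ν K ρ) (hK : 0 ≤ K) (hρ : 0 ≤ ρ)
    {a b g N : ℕ} (hab : a ≤ b) (hg : 1 ≤ g) {G : (ℕ → A) → (ℕ → A) → ℝ}
    (hG₁ : ∀ y, DependsOn (fun x => G x y) (Set.Ico a b))
    (hG₂ : ∀ x, DependsOn (G x) {j | j + g ≤ a ∨ b + g ≤ j ∧ j ≤ N}) {B : ℝ}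
    (hB : ∀ x y, |G x y| ≤ B) :
    |∫ z, G z z ∂ν - ∫ x, ∫ y, G x y ∂ν ∂ν| ≤ 3 * (K * ρ ^ g * B) := by
  have key := hν.two_sided hK hρ hab hg (G := fun x y => (G x y : ℂ)) (N := N)
    (fun y x x' h => congrArg _ (hG₁ y h)) (fun x y y' h => congrArg _ (hG₂ x h))
    (B := B) fun x y => by simpa using hB x y
  simp only [integral_complex_ofReal] at key
  rwa [← Complex.ofReal_sub, Complex.norm_real, Real.norm_eq_abs] at key

omit [DiscreteMeasurableSpace A] [Fintype A] [IsProbabilityMeasure ν] in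
lemma IsPsiMixing.one_sided_real (hν : IsPsiMixing ν K ρ) {a g N : ℕ}
    {G : (ℕ → A) → (ℕ → A) → ℝ}
    (hG₁ : ∀ y, DependsOn (fun x => G x y) (Set.Iic a))
    (hG₂ : ∀ x, DependsOn (G x) (Set.Icc (a + g) N)) :
    |∫ z, G z z ∂ν - ∫ x, ∫ y, G x y ∂ν ∂ν| ≤ K * ρ ^ g * ∫ x, ∫ y, |G x y| ∂ν ∂ν := by
  have key := hν a g N (fun x y => (G x y : ℂ))
    (fun y x x' h => congrArg _ (hG₁ y h)) (fun x y y' h => congrArg _ (hG₂ x h))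
  simp only [integral_complex_ofReal, Complex.norm_real, Real.norm_eq_abs] at key
  rwa [← Complex.ofReal_sub, Complex.norm_real, Real.norm_eq_abs] at key

end TwoSided

/-! ### A bound on characteristic functions by the Stein–Tikhomirov method -/

section Tikhomirov

/-- The character `x ↦ exp (i x)` of the real line. -/
noncomputable def expI (x : ℝ) : ℂ := Complex.exp (x * Complex.I)

lemma norm_expI (x : ℝ) : ‖expI x‖ = 1 := Complex.norm_exp_ofReal_mul_I x

lemma expI_add (x y : ℝ) : expI (x + y) = expI x * expI y := by
  simp only [expI, Complex.ofReal_add, add_mul, Complex.exp_add]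

lemma expI_zero : expI 0 = 1 := by simp [expI]

lemma hasDerivAt_expI (x : ℝ) : HasDerivAt expI (Complex.I * expI x) x := by
  have h : HasDerivAt (fun y : ℝ => (y : ℂ) * Complex.I) (1 * Complex.I) x :=
    (Complex.ofRealCLM.hasDerivAt (x := x)).mul_const Complex.I
  have := h.cexp
  rw [one_mul, mul_comm] at this
  exact this

@[fun_prop]
lemma continuous_expI : Continuous expI := by
  unfold expI
  fun_prop

lemma norm_expI_sub_one_le (x : ℝ) : ‖expI x - 1‖ ≤ |x| := by
  have := Real.norm_exp_I_mul_ofReal_sub_one_le (x := x)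
  rwa [mul_comm] at this

lemma norm_expI_sub_expI_le (x y : ℝ) : ‖expI x - expI y‖ ≤ |x - y| := by
  have : expI x - expI y = expI y * (expI (x - y) - 1) := by
    rw [mul_sub, ← expI_add, mul_one]
    congr 2
    ring
  rw [this, norm_mul, norm_expI, one_mul]
  exact norm_expI_sub_one_le _

lemma norm_expI_sub_one_sub_le (x : ℝ) : ‖expI x - 1 - x * Complex.I‖ ≤ x ^ 2 := by
  have hder : ∀ y ∈ Set.Icc (-|x|) |x|, HasDerivWithinAt
      (fun y : ℝ => expI y - 1 - y * Complex.I) (Complex.I * (expI y - 1)) (Set.Icc (-|x|) |x|)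
      y := by
    intro y _
    have h : HasDerivAt (fun y : ℝ => (y : ℂ) * Complex.I) (1 * Complex.I) y :=
      (Complex.ofRealCLM.hasDerivAt (x := y)).mul_const Complex.I
    exact ((((hasDerivAt_expI y).sub_const 1).sub h).congr_deriv (by ring)).hasDerivWithinAt
  have key := Convex.norm_image_sub_le_of_norm_hasDerivWithin_le (C := |x|) hder
    (fun y hy => ?_) (convex_Icc _ _) (x := 0) (y := x) (by simp)
    ⟨neg_abs_le x, le_abs_self x⟩
  · simpa [expI_zero, ← sq] using key
  · rw [norm_mul, Complex.norm_I, one_mul]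
    exact (norm_expI_sub_one_le y).trans (abs_le.2 hy)

/-- The differential equation `φ' = -v t φ` characterises the centred Gaussian characteristic
function, and an approximate solution is close to it. -/
lemma norm_sub_exp_le_of_hasDerivAt {φ φ' : ℝ → ℂ} (hφ : ∀ s, HasDerivAt φ (φ' s) s)
    (h0 : φ 0 = 1) {v ε t : ℝ} (hv : 0 ≤ v)
    (hε : ∀ s, |s| ≤ |t| → ‖φ' s + v * s * φ s‖ ≤ ε) :
    ‖φ t - Complex.exp (-(v * t ^ 2 / 2 : ℝ))‖ ≤ ε * |t| := by
  let w : ℝ → ℝ := fun s => Real.exp (v * s ^ 2 / 2)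
  have hw : ∀ s, HasDerivAt w (w s * (v * s)) s := by
    intro s
    have h : HasDerivAt (fun s : ℝ => v * s ^ 2 / 2) (v * s) s := by
      refine (((hasDerivAt_pow 2 s).const_mul v).div_const 2).congr_deriv ?_
      norm_num
      ring
    exact h.exp
  have hder : ∀ s ∈ Set.Icc (-|t|) |t|, HasDerivWithinAt (fun s => φ s * (w s : ℂ))
      ((φ' s + v * s * φ s) * (w s : ℂ)) (Set.Icc (-|t|) |t|) s := by
    intro s _
    refine (((hφ s).mul (hw s).ofReal_comp).congr_deriv ?_).hasDerivWithinAt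
    push_cast
    ring
  have hε0 : 0 ≤ ε := (norm_nonneg _).trans (hε 0 (by simp))
  have key := Convex.norm_image_sub_le_of_norm_hasDerivWithin_le (C := ε * w t) hder
    (fun s hs => ?_) (convex_Icc _ _) (x := 0) (y := t) (by simp)
    ⟨neg_abs_le t, le_abs_self t⟩
  · have hwt : w t * Real.exp (-(v * t ^ 2 / 2)) = 1 := by
      rw [← Real.exp_add, add_neg_cancel, Real.exp_zero]
    have hw0 : w 0 = 1 := by simp [w]
    have e : φ t - Complex.exp (-(v * t ^ 2 / 2 : ℝ)) =
        (φ t * (w t : ℂ) - φ 0 * (w 0 : ℂ)) * (Real.exp (-(v * t ^ 2 / 2)) : ℂ) := by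
      rw [sub_mul, mul_assoc, ← Complex.ofReal_mul, hwt, h0, hw0]
      push_cast
      ring
    rw [e, norm_mul, Complex.norm_real, Real.norm_eq_abs, abs_of_pos (Real.exp_pos _)]
    calc _ ≤ ε * w t * ‖t - 0‖ * Real.exp (-(v * t ^ 2 / 2)) := by gcongr
      _ = ε * |t| * (w t * Real.exp (-(v * t ^ 2 / 2))) := by
        rw [sub_zero, Real.norm_eq_abs]
        ring
      _ = ε * |t| := by rw [hwt, mul_one]
  · rw [norm_mul, Complex.norm_real, Real.norm_eq_abs, abs_of_pos (Real.exp_pos _)]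
    have hs' := abs_le.2 hs
    have : w s ≤ w t := Real.exp_le_exp.2 (by
      have := sq_le_sq.2 hs'
      gcongr)
    exact mul_le_mul (hε s hs') this (Real.exp_pos _).le hε0

variable {Ω ι : Type*} [MeasurableSpace Ω] {P : Measure Ω} [IsProbabilityMeasure P]

lemma integrable_mul_expI {f g : Ω → ℝ} (hf : Measurable f) (hg : Measurable g) {c : ℝ}
    (hc : ∀ ω, |f ω| ≤ c) : Integrable (fun ω => (f ω : ℂ) * expI (g ω)) P := by
  refine Integrable.of_bound (Measurable.aestronglyMeasurable ?_) c (.of_forall fun ω => ?_)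
  · exact (Complex.measurable_ofReal.comp hf).mul (continuous_expI.measurable.comp hg)
  · simpa [norm_expI] using hc ω

/-- Replacing `exp (i u S)` by its first order expansion around `exp (i u (S - T))`, in the
presence of a factor `X`, where `T` collects the summands of `S` that are not almost independent
of `X`, and `T'` those that are not almost independent of `X T`. -/
lemma norm_integral_mul_expI_sub_le {X S T T' : Ω → ℝ} (hX : Measurable X) (hS : Measurable S)
    (hT : Measurable T) (hT' : Measurable T') {B D δ₁ δ₂ u : ℝ} (hXB : ∀ ω, |X ω| ≤ B)
    (hTD : ∀ ω, |T ω| ≤ D) (hT'D : ∀ ω, |T' ω| ≤ D) (hTT' : ∀ ω, |T' ω - T ω| ≤ D)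
    (h₁ : ‖∫ ω, (X ω : ℂ) * expI (u * (S ω - T ω)) ∂P‖ ≤ δ₁)
    (h₂ : ‖∫ ω, ((X ω * T ω : ℝ) : ℂ) * expI (u * (S ω - T' ω)) ∂P -
      (∫ ω, X ω * T ω ∂P : ℝ) * ∫ ω, expI (u * (S ω - T' ω)) ∂P‖ ≤ δ₂) :
    ‖∫ ω, (X ω : ℂ) * expI (u * S ω) ∂P -
      Complex.I * u * (∫ ω, X ω * T ω ∂P : ℝ) * ∫ ω, expI (u * S ω) ∂P‖ ≤
      δ₁ + |u| * δ₂ + 3 * u ^ 2 * D ^ 2 * B := by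
  obtain ⟨ω₀⟩ := P.nonempty_of_neZero
  have hB0 : 0 ≤ B := (abs_nonneg _).trans (hXB ω₀)
  have hD0 : 0 ≤ D := (abs_nonneg _).trans (hTD ω₀)
  have hXT : ∀ ω, |X ω * T ω| ≤ B * D := fun ω => by
    rw [abs_mul]
    exact mul_le_mul (hXB ω) (hTD ω) (abs_nonneg _) hB0
  have hone : ∀ g : Ω → ℝ, Measurable g → Integrable (fun ω => expI (g ω)) P := fun g hg => by
    simpa using integrable_mul_expI (P := P) (f := fun _ => 1) measurable_const hg
      (c := 1) (fun _ => by simp)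
  set a₀ := ∫ ω, (X ω : ℂ) * expI (u * S ω) ∂P with ha₀
  set a₁ := ∫ ω, (X ω : ℂ) * expI (u * (S ω - T ω)) ∂P with ha₁
  set a₂ := ∫ ω, ((X ω * T ω : ℝ) : ℂ) * expI (u * (S ω - T ω)) ∂P with ha₂
  set a₃ := ∫ ω, ((X ω * T ω : ℝ) : ℂ) * expI (u * (S ω - T' ω)) ∂P with ha₃
  set c := ∫ ω, X ω * T ω ∂P with hc
  set b' := ∫ ω, expI (u * (S ω - T' ω)) ∂P with hb'
  set b := ∫ ω, expI (u * S ω) ∂P with hb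
  have i₀ : Integrable (fun ω => (X ω : ℂ) * expI (u * S ω)) P :=
    integrable_mul_expI hX (by fun_prop) hXB
  have i₁ : Integrable (fun ω => (X ω : ℂ) * expI (u * (S ω - T ω))) P :=
    integrable_mul_expI hX (by fun_prop) hXB
  have i₂ : Integrable (fun ω => ((X ω * T ω : ℝ) : ℂ) * expI (u * (S ω - T ω))) P :=
    integrable_mul_expI (by fun_prop) (by fun_prop) hXT
  have i₃ : Integrable (fun ω => ((X ω * T ω : ℝ) : ℂ) * expI (u * (S ω - T' ω))) P :=
    integrable_mul_expI (by fun_prop) (by fun_prop) hXT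
  have i₀₁ : Integrable (fun ω => (X ω : ℂ) * expI (u * S ω) -
      (X ω : ℂ) * expI (u * (S ω - T ω))) P := i₀.sub i₁
  have e₁ : ‖a₀ - a₁ - Complex.I * u * a₂‖ ≤ u ^ 2 * D ^ 2 * B := by
    rw [ha₀, ha₁, ha₂, ← integral_sub i₀ i₁, ← integral_const_mul,
      ← integral_sub i₀₁ (i₂.const_mul _)]
    refine norm_integral_le_of_bound fun ω => ?_
    have e : (X ω : ℂ) * expI (u * S ω) - (X ω : ℂ) * expI (u * (S ω - T ω)) -
        Complex.I * u * (((X ω * T ω : ℝ) : ℂ) * expI (u * (S ω - T ω))) =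
        (X ω : ℂ) * expI (u * (S ω - T ω)) *
          (expI (u * T ω) - 1 - (u * T ω : ℝ) * Complex.I) := by
      have : expI (u * S ω) = expI (u * (S ω - T ω)) * expI (u * T ω) := by
        rw [← expI_add]
        congr 1
        ring
      rw [this]
      push_cast
      ring
    rw [e, norm_mul, norm_mul, norm_expI, Complex.norm_real, Real.norm_eq_abs, mul_one]
    have h₃ : (u * T ω) ^ 2 ≤ u ^ 2 * D ^ 2 := by
      rw [mul_pow]
      exact mul_le_mul_of_nonneg_left (sq_le_sq.2 ((hTD ω).trans (le_abs_self D))) (sq_nonneg u)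
    calc _ ≤ B * (u ^ 2 * D ^ 2) :=
          mul_le_mul (hXB ω) ((norm_expI_sub_one_sub_le _).trans h₃) (norm_nonneg _) hB0
      _ = _ := by ring
  have e₂ : ‖a₂ - a₃‖ ≤ |u| * D ^ 2 * B := by
    rw [ha₂, ha₃, ← integral_sub i₂ i₃]
    refine norm_integral_le_of_bound fun ω => ?_
    rw [← mul_sub, norm_mul, Complex.norm_real, Real.norm_eq_abs]
    have h₃ : |u * (S ω - T ω) - u * (S ω - T' ω)| ≤ |u| * D := by
      rw [← mul_sub, abs_mul]
      gcongr
      have := hTT' ω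
      rwa [show S ω - T ω - (S ω - T' ω) = T' ω - T ω by ring]
    calc _ ≤ (B * D) * (|u| * D) :=
          mul_le_mul (hXT ω) ((norm_expI_sub_expI_le _ _).trans h₃) (norm_nonneg _) (by positivity)
      _ = _ := by ring
  have hcB : ‖c‖ ≤ B * D := norm_integral_le_of_bound hXT
  have e₃ : ‖(c : ℂ) * b' - c * b‖ ≤ |u| * D ^ 2 * B := by
    rw [← mul_sub, norm_mul, Complex.norm_real, Real.norm_eq_abs]
    have h₃ : ‖b' - b‖ ≤ |u| * D := by
      rw [hb', hb, ← integral_sub (hone _ (by fun_prop)) (hone _ (by fun_prop))]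
      refine norm_integral_le_of_bound fun ω => (norm_expI_sub_expI_le _ _).trans ?_
      rw [← mul_sub, abs_mul]
      gcongr
      rw [show S ω - T' ω - S ω = -T' ω by ring, abs_neg]
      exact hT'D ω
    calc _ ≤ (B * D) * (|u| * D) := mul_le_mul hcB h₃ (norm_nonneg _) (by positivity)
      _ = _ := by ring
  have hu : ‖Complex.I * (u : ℂ)‖ = |u| := by simp
  have e : a₀ - Complex.I * u * c * b = (a₀ - a₁ - Complex.I * u * a₂) + a₁ +
      Complex.I * u * ((a₂ - a₃) + (a₃ - c * b') + (c * b' - c * b)) := by ring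
  rw [e]
  calc _ ≤ u ^ 2 * D ^ 2 * B + δ₁ + |u| * (|u| * D ^ 2 * B + δ₂ + |u| * D ^ 2 * B) := by
        refine (norm_add_le _ _).trans (add_le_add ((norm_add_le _ _).trans (add_le_add e₁ h₁)) ?_)
        rw [norm_mul, hu]
        refine mul_le_mul_of_nonneg_left ?_ (abs_nonneg u)
        exact (norm_add_le _ _).trans (add_le_add ((norm_add_le _ _).trans (add_le_add e₂ h₂)) e₃)
    _ = δ₁ + |u| * δ₂ + (u ^ 2 + 2 * |u| ^ 2) * D ^ 2 * B := by ring
    _ = _ := by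
        rw [sq_abs]
        ring

/-- A quantitative central limit theorem for sums of bounded random variables with local
dependence neighbourhoods `N₁ j ⊆ N₂ j`: outside `N₁ j` the sum is almost independent of `X j`, and
outside `N₂ j` of `X j` times the sum over `N₁ j`. The characteristic function of the normalized
sum then almost solves `φ' = -v t φ`. -/
lemma norm_charFun_sum_sub_exp_le [DecidableEq ι] {s : Finset ι} {X : ι → Ω → ℝ}
    (hX : ∀ i, Measurable (X i))
    {N₁ N₂ : ι → Finset ι} (hN : ∀ j, N₁ j ⊆ N₂ j) {M : ℕ}
    (hM : ∀ j, (N₂ j).card ≤ M)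
    {B δ₁ δ₂ δ₃ v : ℝ} (hXB : ∀ i ω, |X i ω| ≤ B) (hB0 : 0 ≤ B) (hv : 0 ≤ v)
    (hδ₁ : 0 ≤ δ₁) (hδ₂ : 0 ≤ δ₂)
    (h₁ : ∀ j ∈ s, ∀ u : ℝ, ‖∫ ω, (X j ω : ℂ) *
      expI (u * (∑ i ∈ s, X i ω - ∑ i ∈ N₁ j, X i ω)) ∂P‖ ≤ δ₁)
    (h₂ : ∀ j ∈ s, ∀ u : ℝ, ‖∫ ω, ((X j ω * ∑ i ∈ N₁ j, X i ω : ℝ) : ℂ) *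
        expI (u * (∑ i ∈ s, X i ω - ∑ i ∈ N₂ j, X i ω)) ∂P -
      (∫ ω, X j ω * ∑ i ∈ N₁ j, X i ω ∂P : ℝ) *
        ∫ ω, expI (u * (∑ i ∈ s, X i ω - ∑ i ∈ N₂ j, X i ω)) ∂P‖ ≤ δ₂)
    {n : ℝ} (hn : 0 < n) (hcard : (s.card : ℝ) ≤ n)
    (h₃ : |1 / n * ∑ j ∈ s, ∫ ω, X j ω * ∑ i ∈ N₁ j, X i ω ∂P - v| ≤ δ₃) (t : ℝ) :
    ‖∫ ω, expI (t * (1 / √n * ∑ i ∈ s, X i ω)) ∂P - Complex.exp (-(v * t ^ 2 / 2 : ℝ))‖ ≤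
      (√n * δ₁ + |t| * δ₂ + 3 * t ^ 2 * (M * B) ^ 2 * B / √n + |t| * δ₃) * |t| := by
  have hBM : ∀ (j : ι) (N : Finset ι), N ⊆ N₂ j → ∀ ω, |∑ i ∈ N, X i ω| ≤ M * B := by
    intro j N hN ω
    calc |∑ i ∈ N, X i ω| ≤ ∑ i ∈ N, |X i ω| := Finset.abs_sum_le_sum_abs _ _
      _ ≤ ∑ i ∈ N, B := Finset.sum_le_sum fun i _ => hXB i ω
      _ = N.card * B := by simp
      _ ≤ M * B := by
        gcongr
        exact (Finset.card_le_card hN).trans (hM j)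
  have hmeas : ∀ N : Finset ι, Measurable fun ω => ∑ i ∈ N, X i ω := fun N =>
    Finset.measurable_sum N fun i _ => hX i
  have hSm := hmeas s
  have hsn : 0 < √n := Real.sqrt_pos.2 hn
  let S : Ω → ℝ := fun ω => ∑ i ∈ s, X i ω
  let φ : ℝ → ℂ := fun r => ∫ ω, expI (r * (1 / √n * S ω)) ∂P
  let φ' : ℝ → ℂ := fun r =>
    ∫ ω, ((1 / √n * S ω : ℝ) : ℂ) * (Complex.I * expI (r * (1 / √n * S ω))) ∂P
  have hSB : ∃ c, 0 ≤ c ∧ ∀ ω, |1 / √n * S ω| ≤ c := by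
    refine ⟨1 / √n * ∑ i ∈ s, |B|, by positivity, fun ω => ?_⟩
    rw [abs_mul, abs_of_pos (by positivity : 0 < 1 / √n)]
    gcongr
    exact (Finset.abs_sum_le_sum_abs _ _).trans
      (Finset.sum_le_sum fun i _ => (hXB i ω).trans (le_abs_self B))
  obtain ⟨c, hc0, hc⟩ := hSB
  have hφ : ∀ r, HasDerivAt φ (φ' r) r := by
    intro r
    refine (hasDerivAt_integral_of_dominated_loc_of_deriv_le (μ := P) (s := Set.univ)
      (F := fun r ω => expI (r * (1 / √n * S ω)))
      (F' := fun r ω => ((1 / √n * S ω : ℝ) : ℂ) * (Complex.I * expI (r * (1 / √n * S ω))))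
      (bound := fun _ => c) Filter.univ_mem ?_ ?_ ?_ ?_ (integrable_const c) ?_).2
    · refine .of_forall fun r => (continuous_expI.measurable.comp ?_).aestronglyMeasurable
      fun_prop
    · refine Integrable.of_bound (continuous_expI.measurable.comp ?_).aestronglyMeasurable 1
        (.of_forall fun ω => (norm_expI _).le)
      fun_prop
    · refine Measurable.aestronglyMeasurable ?_
      exact (Complex.measurable_ofReal.comp (by fun_prop)).mul
        ((continuous_expI.measurable.comp (by fun_prop)).const_mul _)
    · refine .of_forall fun ω r _ => ?_
      rw [norm_mul, norm_mul, norm_expI, Complex.norm_I, Complex.norm_real, mul_one, mul_one]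
      exact hc ω
    · refine .of_forall fun ω r _ => ?_
      have h := (hasDerivAt_id r).mul_const (1 / √n * S ω)
      have := HasDerivAt.scomp r (hasDerivAt_expI (r * (1 / √n * S ω))) h
      rw [one_mul, Complex.real_smul] at this
      exact this
  have h0 : φ 0 = 1 := by simp [φ, expI_zero]
  refine norm_sub_exp_le_of_hasDerivAt hφ h0 hv fun r hr => ?_
  have hφr : ‖φ r‖ ≤ 1 := norm_integral_le_of_bound fun ω => (norm_expI _).le
  set u : ℝ := r * (1 / √n) with hu
  have hφu : φ r = ∫ ω, expI (u * S ω) ∂P := by simp only [φ, hu, mul_assoc]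
  set V : ι → ℝ := fun j => ∫ ω, X j ω * ∑ i ∈ N₁ j, X i ω ∂P with hV
  have hterm : ∀ j ∈ s, ‖∫ ω, (X j ω : ℂ) * expI (u * S ω) ∂P -
      Complex.I * u * (V j : ℝ) * φ r‖ ≤ δ₁ + |u| * δ₂ + 3 * u ^ 2 * (M * B) ^ 2 * B := by
    intro j hj
    rw [hφu]
    refine norm_integral_mul_expI_sub_le (hX j) hSm (hmeas (N₁ j)) (hmeas (N₂ j)) (hXB j)
      (hBM j _ (hN j)) (hBM j _ subset_rfl) (fun ω => ?_) (h₁ j hj u) (h₂ j hj u)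
    rw [← Finset.sum_sdiff (hN j), add_sub_cancel_right]
    exact hBM j _ Finset.sdiff_subset ω
  have hsum : φ' r = Complex.I * (1 / √n : ℝ) *
      ∑ j ∈ s, ∫ ω, (X j ω : ℂ) * expI (u * S ω) ∂P := by
    rw [← integral_finsetSum _ fun j _ => integrable_mul_expI (hX j) (by fun_prop) (hXB j),
      ← integral_const_mul]
    refine integral_congr_ae (.of_forall fun ω => ?_)
    simp only [← Finset.sum_mul, S, hu, mul_assoc]
    push_cast
    ring
  have e : φ' r + v * r * φ r = Complex.I * (1 / √n : ℝ) *
      (∑ j ∈ s, (∫ ω, (X j ω : ℂ) * expI (u * S ω) ∂P - Complex.I * u * (V j : ℝ) * φ r)) -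
      r * ((1 / n * ∑ j ∈ s, V j - v : ℝ) : ℂ) * φ r := by
    have hn' : ((1 / √n : ℝ) : ℂ) * ((1 / √n : ℝ) : ℂ) = ((1 / n : ℝ) : ℂ) := by
      rw [← Complex.ofReal_mul, div_mul_div_comm, one_mul, Real.mul_self_sqrt hn.le]
    rw [hsum, Finset.sum_sub_distrib, ← Finset.sum_mul, ← Finset.mul_sum]
    have hu' : (u : ℂ) = r * ((1 / √n : ℝ) : ℂ) := by rw [hu, Complex.ofReal_mul]
    rw [hu']
    have hI := Complex.I_mul_I
    push_cast at hn' ⊢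
    linear_combination (-(r : ℂ) * (∑ j ∈ s, (V j : ℂ)) * φ r) * hn' +
      (r : ℂ) * (∑ j ∈ s, (V j : ℂ)) * φ r * (1 / (√n : ℂ)) * (1 / (√n : ℂ)) * hI
  rw [e]
  have hsum_le : ‖∑ j ∈ s, (∫ ω, (X j ω : ℂ) * expI (u * S ω) ∂P -
      Complex.I * u * (V j : ℝ) * φ r)‖ ≤ n * (δ₁ + |u| * δ₂ + 3 * u ^ 2 * (M * B) ^ 2 * B) := by
    refine (norm_sum_le _ _).trans ((Finset.sum_le_sum hterm).trans ?_)
    rw [Finset.sum_const, nsmul_eq_mul]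
    exact mul_le_mul_of_nonneg_right hcard (by positivity)
  have hu1 : |u| = |r| * (1 / √n) := by rw [hu, abs_mul, abs_of_pos (by positivity : 0 < 1 / √n)]
  have hnn : n = √n * √n := (Real.mul_self_sqrt hn.le).symm
  have hδ₃ : 0 ≤ δ₃ := (abs_nonneg _).trans h₃
  calc _ ≤ 1 / √n * (n * (δ₁ + |u| * δ₂ + 3 * u ^ 2 * (M * B) ^ 2 * B)) + |r| * δ₃ := by
        refine (norm_sub_le _ _).trans (add_le_add ?_ ?_)
        · rw [norm_mul, norm_mul, Complex.norm_I, one_mul, Complex.norm_real, Real.norm_eq_abs,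
            abs_of_pos (by positivity : 0 < 1 / √n)]
          gcongr
        · rw [norm_mul, norm_mul, Complex.norm_real, Complex.norm_real]
          calc _ ≤ |r| * δ₃ * 1 := by
                gcongr
                · exact le_rfl
                · exact h₃
            _ = _ := mul_one _
    _ = √n * δ₁ + |r| * δ₂ + 3 * |r| ^ 2 * (M * B) ^ 2 * B / √n + |r| * δ₃ := by
        rw [← sq_abs u, hu1]
        nth_rewrite 2 [hnn]
        field_simp
    _ ≤ _ := by
        rw [← sq_abs t]
        gcongr

end Tikhomirov

/-! ### Central limit bound for functions of finitely many coordinates -/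

section LocalCLT

variable {A : Type*}

lemma dependsOn_comp_shift {E : Type*} {f : (ℕ → A) → E} {L : ℕ} (hf : DependsOn f (Set.Iio L))
    (i : ℕ) : DependsOn (fun z => f (shift i z)) (Set.Ico i (i + L)) := by
  intro x y h
  refine hf fun j hj => ?_
  have hj' : j < L := hj
  exact h (i + j) ⟨by omega, by omega⟩

lemma dependsOn_sum_shift {f : (ℕ → A) → ℝ} {L : ℕ} (hf : DependsOn f (Set.Iio L))
    {N : Finset ℕ} {U : Set ℕ} (hU : ∀ i ∈ N, ∀ c, i ≤ c → c < i + L → c ∈ U) :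
    DependsOn (fun z => ∑ i ∈ N, f (shift i z)) U := by
  intro x y h
  exact Finset.sum_congr rfl fun i hi =>
    (dependsOn_comp_shift hf i) fun c hc => h c (hU i hi c hc.1 hc.2)

lemma abs_sum_le_card_mul {ι : Type*} {N : Finset ι} {f : ι → ℝ} {B : ℝ} (hf : ∀ i, |f i| ≤ B) :
    |∑ i ∈ N, f i| ≤ N.card * B := by
  calc |∑ i ∈ N, f i| ≤ ∑ i ∈ N, |f i| := Finset.abs_sum_le_sum_abs _ _
    _ ≤ ∑ i ∈ N, B := Finset.sum_le_sum fun i _ => hf i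
    _ = _ := by simp

variable [MeasurableSpace A] [DiscreteMeasurableSpace A] [Fintype A]
variable {ν : Measure (ℕ → A)} [IsProbabilityMeasure ν] {K ρ : ℝ}

omit [DiscreteMeasurableSpace A] [Fintype A] [IsProbabilityMeasure ν] in
lemma integral_comp_shift (hst : ∀ i, MeasurePreserving (shift i) ν ν) (i : ℕ)
    {f : (ℕ → A) → ℝ} (hf : AEStronglyMeasurable f ν) :
    ∫ z, f (shift i z) ∂ν = ∫ z, f z ∂ν := by
  have hf' : AEStronglyMeasurable f (ν.map (shift i)) := by rwa [(hst i).map_eq]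
  rw [← integral_map (measurable_shift i).aemeasurable hf', (hst i).map_eq]

/-- The times in `[1, n]` at distance less than `r` from `j`. -/
def timesNear (n r j : ℕ) : Finset ℕ := (Finset.Icc 1 n).filter fun i => i < j + r ∧ j < i + r

lemma mem_timesNear {n r j i : ℕ} :
    i ∈ timesNear n r j ↔ (1 ≤ i ∧ i ≤ n) ∧ i < j + r ∧ j < i + r := by
  simp [timesNear]

lemma card_timesNear_le (n r j : ℕ) : (timesNear n r j).card ≤ 2 * r := by
  have : timesNear n r j ⊆ Finset.Ico (j - r) (j + r) := fun i hi => by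
    rw [mem_timesNear] at hi
    rw [Finset.mem_Ico]
    omega
  refine (Finset.card_le_card this).trans ?_
  rw [Nat.card_Ico]
  omega

/-- The central limit bound for a centred function of `L` entries along the process: times at
distance `2 L` are almost uncorrelated because a gap of length `L` is left between the entries
they use, and the second neighbourhoods have to reach as far as `4 L`. -/
lemma norm_charFun_local_sum_sub_exp_le (hst : ∀ i, MeasurePreserving (shift i) ν ν)
    (hν : IsPsiMixing ν K ρ) (hK : 0 ≤ K) (hρ : 0 ≤ ρ)
    {f : (ℕ → A) → ℝ} {L : ℕ} (hL : 1 ≤ L) (hf : DependsOn f (Set.Iio L)) {B : ℝ}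
    (hB : ∀ z, |f z| ≤ B) (hf0 : ∫ z, f z ∂ν = 0) {v : ℝ} (hv : 0 ≤ v) {n : ℕ} (hn : 1 ≤ n)
    (t : ℝ) :
    ‖∫ z, expI (t * (1 / √n * ∑ i ∈ Finset.Icc 1 n, f (shift i z))) ∂ν -
      Complex.exp (-(v * t ^ 2 / 2 : ℝ))‖ ≤
      (√n * (3 * (K * ρ ^ L * B)) + |t| * (3 * (K * ρ ^ L * (B * ((8 * L : ℕ) * B)))) +
        3 * t ^ 2 * ((8 * L : ℕ) * B) ^ 2 * B / √n +
        |t| * (|1 / n * ∫ z, (∑ i ∈ Finset.Icc 1 n, f (shift i z)) ^ 2 ∂ν - v| +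
          3 * (K * ρ ^ L * (B * (n * B))))) * |t| := by
  obtain ⟨z₀⟩ := ν.nonempty_of_neZero
  have hB0 : 0 ≤ B := (abs_nonneg _).trans (hB z₀)
  have hfm : Measurable f := measurable_of_dependsOn (hf.mono Set.Iio_subset_Iic_self)
  have hX : ∀ i, Measurable fun z => f (shift i z) := fun i => hfm.comp (measurable_shift i)
  have hX0 : ∀ i, ∫ z, f (shift i z) ∂ν = 0 := fun i => by
    rw [integral_comp_shift hst i hfm.aestronglyMeasurable, hf0]
  have hXd := fun i => dependsOn_comp_shift hf i
  have hsdiff : ∀ (r j : ℕ) (z : ℕ → A), ∑ i ∈ Finset.Icc 1 n, f (shift i z) -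
      ∑ i ∈ timesNear n r j, f (shift i z) =
      ∑ i ∈ Finset.Icc 1 n \ timesNear n r j, f (shift i z) := fun r j z => by
    rw [Finset.sum_sdiff_eq_sub
      (show timesNear n r j ⊆ Finset.Icc 1 n from Finset.filter_subset _ _)]
  have hfar : ∀ {r i j : ℕ}, i ∈ Finset.Icc 1 n \ timesNear n r j →
      1 ≤ i ∧ i ≤ n ∧ (j + r ≤ i ∨ i + r ≤ j) := fun {r i j} hi => by
    rw [Finset.mem_sdiff, mem_timesNear, Finset.mem_Icc] at hi
    omega
  -- sums over times far from `j` leave a gap of length `L` around the entries near `j`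
  have hfar₁ : ∀ j, DependsOn (fun z => ∑ i ∈ Finset.Icc 1 n \ timesNear n (2 * L) j,
      f (shift i z)) {c | c + L ≤ j ∨ j + L + L ≤ c ∧ c ≤ n + L} := fun j =>
    dependsOn_sum_shift hf fun i hi c h₁ h₂ => by
      have := hfar hi
      change c + L ≤ j ∨ j + L + L ≤ c ∧ c ≤ n + L
      omega
  have hfar₂ : ∀ j, DependsOn (fun z => ∑ i ∈ Finset.Icc 1 n \ timesNear n (4 * L) j,
      f (shift i z)) {c | c + L ≤ j - 2 * L ∨ j + 3 * L + L ≤ c ∧ c ≤ n + L} := fun j =>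
    dependsOn_sum_shift hf fun i hi c h₁ h₂ => by
      have := hfar hi
      change c + L ≤ j - 2 * L ∨ j + 3 * L + L ≤ c ∧ c ≤ n + L
      omega
  have hnear : ∀ j, DependsOn (fun z => f (shift j z) * ∑ i ∈ timesNear n (2 * L) j, f (shift i z))
      (Set.Ico (j - 2 * L) (j + 3 * L)) := by
    intro j x y h
    refine congrArg₂ (· * ·) (hXd j fun c hc => h c ?_)
      (dependsOn_sum_shift hf (fun i hi c h₁ h₂ => ?_) h)
    · have := hc.1
      have := hc.2
      exact ⟨by omega, by omega⟩
    · rw [mem_timesNear] at hi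
      exact ⟨by omega, by omega⟩
  have hnearB : ∀ j z, |∑ i ∈ timesNear n (2 * L) j, f (shift i z)| ≤ (8 * L : ℕ) * B := by
    intro j z
    refine (abs_sum_le_card_mul fun i => hB _).trans ?_
    have := card_timesNear_le n (2 * L) j
    gcongr
    omega
  have h₃ : |1 / (n : ℝ) * ∑ j ∈ Finset.Icc 1 n,
      ∫ z, f (shift j z) * ∑ i ∈ timesNear n (2 * L) j, f (shift i z) ∂ν - v| ≤
      |1 / n * ∫ z, (∑ i ∈ Finset.Icc 1 n, f (shift i z)) ^ 2 ∂ν - v| +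
        3 * (K * ρ ^ L * (B * (n * B))) := by
    have hint : ∀ (j : ℕ) (N : Finset ℕ), Integrable
        (fun z => f (shift j z) * ∑ i ∈ N, f (shift i z)) ν := fun j N => by
      refine Integrable.of_bound ((hX j).mul
        (Finset.measurable_sum N fun i _ => hX i)).aestronglyMeasurable (B * (N.card * B))
        (.of_forall fun z => ?_)
      rw [norm_mul]
      exact mul_le_mul (hB _) (abs_sum_le_card_mul fun i => hB _) (norm_nonneg _) hB0
    have hfarsmall : ∀ j, |∫ z, f (shift j z) *
        ∑ i ∈ Finset.Icc 1 n \ timesNear n (2 * L) j, f (shift i z) ∂ν| ≤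
        3 * (K * ρ ^ L * (B * (n * B))) := by
      intro j
      have key := hν.two_sided_real hK hρ (a := j) (b := j + L) (g := L) (N := n + L)
        (G := fun x y => f (shift j x) *
          ∑ i ∈ Finset.Icc 1 n \ timesNear n (2 * L) j, f (shift i y)) (B := B * (n * B))
        (by omega) hL (fun y x x' h => by simp only [hXd j h]) (fun x y y' h => by
          simp only [hfar₁ j h]) fun x y => by
          rw [abs_mul]
          refine mul_le_mul (hB _) ((abs_sum_le_card_mul fun i => hB _).trans ?_) (abs_nonneg _) hB0
          gcongr
          exact (Finset.card_le_card Finset.sdiff_subset).trans (by simp)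
      simpa only [integral_mul_const, integral_const_mul, hX0, zero_mul, sub_zero] using key
    have hdecomp : ∫ z, (∑ i ∈ Finset.Icc 1 n, f (shift i z)) ^ 2 ∂ν =
        ∑ j ∈ Finset.Icc 1 n, (∫ z, f (shift j z) * ∑ i ∈ timesNear n (2 * L) j, f (shift i z) ∂ν +
          ∫ z, f (shift j z) *
            ∑ i ∈ Finset.Icc 1 n \ timesNear n (2 * L) j, f (shift i z) ∂ν) := by
      rw [Finset.sum_congr rfl fun j _ => (integral_add (hint j _) (hint j _)).symm]
      simp_rw [← mul_add, ← hsdiff, add_sub_cancel]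
      rw [← integral_finsetSum _ fun j _ => hint j (Finset.Icc 1 n)]
      simp only [sq, Finset.sum_mul]
    rw [hdecomp, Finset.sum_add_distrib, mul_add]
    set V := 1 / (n : ℝ) * ∑ j ∈ Finset.Icc 1 n,
      ∫ z, f (shift j z) * ∑ i ∈ timesNear n (2 * L) j, f (shift i z) ∂ν
    have hR : |1 / (n : ℝ) * ∑ j ∈ Finset.Icc 1 n, ∫ z, f (shift j z) *
        ∑ i ∈ Finset.Icc 1 n \ timesNear n (2 * L) j, f (shift i z) ∂ν| ≤
        3 * (K * ρ ^ L * (B * (n * B))) := by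
      have hn0 : (0 : ℝ) < n := by exact_mod_cast hn
      rw [abs_mul, abs_of_pos (by positivity : (0 : ℝ) < 1 / n), one_div, inv_mul_le_iff₀ hn0]
      refine (abs_sum_le_card_mul hfarsmall).trans ?_
      simp
    rw [abs_le] at hR
    rcases abs_cases (V - v) with h | h <;> rw [h.1] <;>
      [have := le_abs_self (V + 1 / (n : ℝ) * ∑ j ∈ Finset.Icc 1 n, ∫ z, f (shift j z) *
        ∑ i ∈ Finset.Icc 1 n \ timesNear n (2 * L) j, f (shift i z) ∂ν - v);
       have := neg_abs_le (V + 1 / (n : ℝ) * ∑ j ∈ Finset.Icc 1 n, ∫ z, f (shift j z) *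
        ∑ i ∈ Finset.Icc 1 n \ timesNear n (2 * L) j, f (shift i z) ∂ν - v)] <;>
      linarith [hR.1, hR.2]
  refine norm_charFun_sum_sub_exp_le (s := Finset.Icc 1 n) hX
    (N₁ := timesNear n (2 * L)) (N₂ := timesNear n (4 * L)) (fun j i hi => ?_) (fun j => ?_)
    (fun i z => hB _) hB0 hv (by positivity) (by positivity) (fun j _ u => ?_) (fun j _ u => ?_)
    (by exact_mod_cast hn) (by simp) h₃ t
  · rw [mem_timesNear] at hi ⊢
    omega
  · refine (card_timesNear_le _ _ _).trans (by omega)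
  · have key := hν.two_sided hK hρ (a := j) (b := j + L) (g := L) (N := n + L)
      (G := fun x y => (f (shift j x) : ℂ) *
        expI (u * ∑ i ∈ Finset.Icc 1 n \ timesNear n (2 * L) j, f (shift i y))) (B := B)
      (by omega) hL (fun y x x' h => by simp only [hXd j h]) (fun x y y' h => by
        simp only [hfar₁ j h]) fun x y => by
        simpa [norm_expI] using hB _
    simp only [hsdiff]
    simpa only [integral_mul_const, integral_const_mul, integral_complex_ofReal, hX0,
      Complex.ofReal_zero, zero_mul, sub_zero] using key
  · have key := hν.two_sided hK hρ (a := j - 2 * L) (b := j + 3 * L) (g := L) (N := n + L)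
      (G := fun x y => ((f (shift j x) * ∑ i ∈ timesNear n (2 * L) j, f (shift i x) : ℝ) : ℂ) *
        expI (u * ∑ i ∈ Finset.Icc 1 n \ timesNear n (4 * L) j, f (shift i y)))
      (B := B * ((8 * L : ℕ) * B))
      (by omega) hL (fun y x x' h => by
        have := hnear j h
        simp only at this
        simp only [this]) (fun x y y' h => by
        simp only [hfar₂ j h]) fun x y => by
        rw [norm_mul, norm_expI, mul_one, Complex.norm_real, norm_mul]
        exact mul_le_mul (hB _) (hnearB j x) (abs_nonneg _) hB0
    simp only [hsdiff]
    simpa only [integral_mul_const, integral_const_mul, integral_complex_ofReal] using key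

end LocalCLT

/-! ### Second moment of a degenerate `U`-statistic -/

section Degenerate

/-- The pairs `i < j` of times in `[1, n]`. -/
def timePairs (n : ℕ) : Finset (ℕ × ℕ) :=
  (Finset.Icc 1 n ×ˢ Finset.Icc 1 n).filter fun q => q.1 < q.2

lemma sum_timePairs (n : ℕ) (f : ℕ → ℕ → ℝ) :
    ∑ q ∈ timePairs n, f q.1 q.2 = ∑ i ∈ Finset.Icc 1 n, ∑ j ∈ Finset.Icc (i + 1) n, f i j := by
  rw [timePairs, Finset.sum_filter, Finset.sum_product]
  refine Finset.sum_congr rfl fun i hi => ?_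
  rw [← Finset.sum_filter]
  refine Finset.sum_congr ?_ fun _ _ => rfl
  ext j
  have := Finset.mem_Icc.1 hi
  simp only [Finset.mem_filter, Finset.mem_Icc]
  omega

/-- The indicator of two times being at distance less than `r`. -/
def nearInd (r i j : ℕ) : ℝ := if i < j + r ∧ j < i + r then 1 else 0

lemma nearInd_nonneg (r i j : ℕ) : 0 ≤ nearInd r i j := by
  unfold nearInd
  split_ifs <;> norm_num

lemma sum_nearInd_le (n r j : ℕ) : ∑ i ∈ Finset.Icc 1 n, nearInd r j i ≤ 2 * r := by
  simp only [nearInd]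
  rw [Finset.sum_boole]
  have : Finset.filter (fun i => j < i + r ∧ i < j + r) (Finset.Icc 1 n) = timesNear n r j := by
    ext i
    simp only [timesNear, Finset.mem_filter]
    tauto
  rw [this]
  exact_mod_cast card_timesNear_le n r j

/-- The number of quadruples of times that split into two pairs of nearby times: each of the three
ways to split contributes at most the square of the number of nearby pairs. -/
lemma sum_nearInd_pairs_le (n r : ℕ) :
    ∑ q ∈ Finset.Icc 1 n ×ˢ Finset.Icc 1 n, ∑ q' ∈ Finset.Icc 1 n ×ˢ Finset.Icc 1 n,
      (nearInd r q.1 q.2 * nearInd r q'.1 q'.2 + nearInd r q.1 q'.1 * nearInd r q.2 q'.2 +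
        nearInd r q.1 q'.2 * nearInd r q.2 q'.1) ≤ 3 * ((n : ℝ) * (2 * r)) ^ 2 := by
  have hS : ∀ j, ∑ i ∈ Finset.Icc 1 n, nearInd r j i ≤ 2 * r := sum_nearInd_le n r
  have hS0 : ∀ j, 0 ≤ ∑ i ∈ Finset.Icc 1 n, nearInd r j i := fun j =>
    Finset.sum_nonneg fun i _ => nearInd_nonneg r j i
  have hn : ∑ _i ∈ Finset.Icc 1 n, (2 * r : ℝ) = n * (2 * r) := by simp
  have hD : ∑ q ∈ Finset.Icc 1 n ×ˢ Finset.Icc 1 n, nearInd r q.1 q.2 ≤ n * (2 * r) := by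
    rw [Finset.sum_product, ← hn]
    exact Finset.sum_le_sum fun i _ => hS i
  have hD0 : 0 ≤ ∑ q ∈ Finset.Icc 1 n ×ˢ Finset.Icc 1 n, nearInd r q.1 q.2 :=
    Finset.sum_nonneg fun q _ => nearInd_nonneg r _ _
  have hcross : ∑ q ∈ Finset.Icc 1 n ×ˢ Finset.Icc 1 n,
      (∑ k ∈ Finset.Icc 1 n, nearInd r q.1 k) * ∑ k ∈ Finset.Icc 1 n, nearInd r q.2 k ≤
      ((n : ℝ) * (2 * r)) ^ 2 := by
    calc _ ≤ ∑ q ∈ Finset.Icc 1 n ×ˢ Finset.Icc 1 n, (2 * r : ℝ) * (2 * r) :=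
          Finset.sum_le_sum fun q _ => mul_le_mul (hS _) (hS _) (hS0 _) (by positivity)
      _ = _ := by
        simp only [Finset.sum_const, Finset.card_product, Nat.card_Icc, nsmul_eq_mul]
        push_cast
        ring
  simp only [Finset.sum_add_distrib]
  have e₁ : ∑ q ∈ Finset.Icc 1 n ×ˢ Finset.Icc 1 n, ∑ q' ∈ Finset.Icc 1 n ×ˢ Finset.Icc 1 n,
      nearInd r q.1 q.2 * nearInd r q'.1 q'.2 ≤ ((n : ℝ) * (2 * r)) ^ 2 := by
    rw [← Finset.sum_mul_sum, sq]
    exact mul_le_mul hD hD hD0 (by positivity)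
  have e₂ : ∑ q ∈ Finset.Icc 1 n ×ˢ Finset.Icc 1 n, ∑ q' ∈ Finset.Icc 1 n ×ˢ Finset.Icc 1 n,
      nearInd r q.1 q'.1 * nearInd r q.2 q'.2 ≤ ((n : ℝ) * (2 * r)) ^ 2 := by
    refine le_trans (le_of_eq ?_) hcross
    refine Finset.sum_congr rfl fun q _ => ?_
    rw [Finset.sum_product, Finset.sum_mul_sum]
  have e₃ : ∑ q ∈ Finset.Icc 1 n ×ˢ Finset.Icc 1 n, ∑ q' ∈ Finset.Icc 1 n ×ˢ Finset.Icc 1 n,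
      nearInd r q.1 q'.2 * nearInd r q.2 q'.1 ≤ ((n : ℝ) * (2 * r)) ^ 2 := by
    refine le_trans (le_of_eq ?_) hcross
    refine Finset.sum_congr rfl fun q _ => ?_
    rw [Finset.sum_product, Finset.sum_comm, Finset.sum_mul_sum]
  linarith

variable {A : Type*} [MeasurableSpace A] [DiscreteMeasurableSpace A] [Fintype A]
variable {ν : Measure (ℕ → A)} [IsProbabilityMeasure ν] {K ρ : ℝ}

section Covariance

variable {g : (ℕ → A) → (ℕ → A) → ℝ} {L : ℕ} {B : ℝ}

/-- If one of the four times is at distance at least `2 L` from the other three, the covariance of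
two values of a degenerate kernel is exponentially small. -/
lemma abs_integral_kernel_mul_le_of_isolated (hν : IsPsiMixing ν K ρ) (hK : 0 ≤ K) (hρ : 0 ≤ ρ)
    (hL : 1 ≤ L) (hg₁ : ∀ y, DependsOn (fun x => g x y) (Set.Iio L))
    (hg₂ : ∀ x, DependsOn (g x) (Set.Iio L)) (hB : ∀ x y, |g x y| ≤ B)
    (hst : ∀ i, MeasurePreserving (shift i) ν ν)
    (hdeg : ∀ y, ∫ x, g x y ∂ν = 0) {i j k l : ℕ} (hj : i + 2 * L ≤ j ∨ j + 2 * L ≤ i)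
    (hk : i + 2 * L ≤ k ∨ k + 2 * L ≤ i) (hl : i + 2 * L ≤ l ∨ l + 2 * L ≤ i) :
    |∫ z, g (shift i z) (shift j z) * g (shift k z) (shift l z) ∂ν| ≤
      3 * (K * ρ ^ L * (B * B)) := by
  obtain ⟨z₀⟩ := ν.nonempty_of_neZero
  have hB0 : 0 ≤ B := (abs_nonneg _).trans (hB z₀ z₀)
  have hdeg' : ∀ y, ∫ x, g (shift i x) y ∂ν = 0 := fun y => by
    rw [integral_comp_shift hst i (f := fun x => g x y)
      (measurable_of_dependsOn ((hg₁ y).mono Set.Iio_subset_Iic_self)).aestronglyMeasurable, hdeg]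
  have key := hν.two_sided_real hK hρ (a := i) (b := i + L) (g := L) (N := j + k + l + L)
    (G := fun x y => g (shift i x) (shift j y) * g (shift k y) (shift l y)) (B := B * B)
    (by omega) hL
    (fun y x x' h => by
      have := dependsOn_comp_shift (hg₁ (shift j y)) i h
      simp only at this ⊢
      rw [this])
    (fun x y y' h => by
      have h' : ∀ m ∈ ({j, k, l} : Set ℕ), ∀ c < L, shift m y c = shift m y' c := by
        intro m hm c hc
        refine h (m + c) ?_
        change m + c + L ≤ i ∨ i + L + L ≤ m + c ∧ m + c ≤ j + k + l + L
        rcases hm with rfl | rfl | rfl <;> omega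
      have e₁ : g (shift i x) (shift j y) = g (shift i x) (shift j y') :=
        hg₂ _ fun c hc => h' j (by simp) c hc
      have e₂ : g (shift k y) (shift l y) = g (shift k y') (shift l y) :=
        hg₁ _ fun c hc => h' k (by simp) c hc
      have e₃ : g (shift k y') (shift l y) = g (shift k y') (shift l y') :=
        hg₂ _ fun c hc => h' l (by simp) c hc
      simp only [e₁, e₂, e₃])
    fun x y => by
      rw [abs_mul]
      exact mul_le_mul (hB _ _) (hB _ _) (abs_nonneg _) hB0
  have h0 : ∫ x, ∫ y, g (shift i x) (shift j y) * g (shift k y) (shift l y) ∂ν ∂ν = 0 := by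
    rw [integral_integral_swap]
    · simp only [integral_mul_const, hdeg', zero_mul, integral_zero]
    · refine Integrable.of_bound (Measurable.aestronglyMeasurable ?_) (B * B)
        (.of_forall fun q => ?_)
      · have hgm : Measurable (Function.uncurry g) :=
          measurable_uncurry_of_dependsOn (a := L) (b := L)
            (fun y => (hg₁ y).mono Set.Iio_subset_Iic_self)
            (fun x => (hg₂ x).mono Set.Iio_subset_Iic_self)
        have h₁ : Measurable fun q : (ℕ → A) × (ℕ → A) => g (shift i q.1) (shift j q.2) :=
          hgm.comp (((measurable_shift i).comp measurable_fst).prodMk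
            ((measurable_shift j).comp measurable_snd))
        have h₂ : Measurable fun q : (ℕ → A) × (ℕ → A) => g (shift k q.2) (shift l q.2) :=
          hgm.comp (((measurable_shift k).comp measurable_snd).prodMk
            ((measurable_shift l).comp measurable_snd))
        exact h₁.mul h₂
      · rw [Function.uncurry, norm_mul]
        exact mul_le_mul (hB _ _) (hB _ _) (norm_nonneg _) hB0
  rwa [h0, sub_zero] at key

/-- The bound on the covariance of two values of a degenerate kernel: it is exponentially small
unless the four times split into two pairs of nearby times. -/
lemma abs_integral_kernel_mul_le (hν : IsPsiMixing ν K ρ) (hK : 0 ≤ K) (hρ : 0 ≤ ρ)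
    (hL : 1 ≤ L) (hg₁ : ∀ y, DependsOn (fun x => g x y) (Set.Iio L))
    (hsymm : ∀ x y, g x y = g y x) (hB : ∀ x y, |g x y| ≤ B)
    (hst : ∀ i, MeasurePreserving (shift i) ν ν)
    (hdeg : ∀ y, ∫ x, g x y ∂ν = 0) (i j k l : ℕ) :
    |∫ z, g (shift i z) (shift j z) * g (shift k z) (shift l z) ∂ν| ≤
      B * B * (3 * K * ρ ^ L + (nearInd (4 * L) i j * nearInd (4 * L) k l +
        nearInd (4 * L) i k * nearInd (4 * L) j l + nearInd (4 * L) i l * nearInd (4 * L) j k)) := by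
  obtain ⟨z₀⟩ := ν.nonempty_of_neZero
  have hB0 : 0 ≤ B := (abs_nonneg _).trans (hB z₀ z₀)
  have hg₂ : ∀ x, DependsOn (g x) (Set.Iio L) := fun x y y' h => by
    rw [hsymm x y, hsymm x y']
    exact hg₁ x h
  have hnn := nearInd_nonneg (4 * L)
  have hsmall : ∀ {c : ℝ}, c ≤ 3 * (K * ρ ^ L * (B * B)) →
      c ≤ B * B * (3 * K * ρ ^ L + (nearInd (4 * L) i j * nearInd (4 * L) k l +
        nearInd (4 * L) i k * nearInd (4 * L) j l + nearInd (4 * L) i l * nearInd (4 * L) j k)) := by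
    intro c hc
    have h₁ := mul_nonneg (hnn i j) (hnn k l)
    have h₂ := mul_nonneg (hnn i k) (hnn j l)
    have h₃ := mul_nonneg (hnn i l) (hnn j k)
    have h₄ : 0 ≤ B * B * (nearInd (4 * L) i j * nearInd (4 * L) k l +
        nearInd (4 * L) i k * nearInd (4 * L) j l + nearInd (4 * L) i l * nearInd (4 * L) j k) := by
      positivity
    linarith
  have hiso := fun {i j k l : ℕ} =>
    abs_integral_kernel_mul_le_of_isolated hν hK hρ hL hg₁ hg₂ hB hst hdeg (i := i) (j := j)
      (k := k) (l := l)
  by_cases hi : (i + 2 * L ≤ j ∨ j + 2 * L ≤ i) ∧ (i + 2 * L ≤ k ∨ k + 2 * L ≤ i) ∧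
      (i + 2 * L ≤ l ∨ l + 2 * L ≤ i)
  · exact hsmall (hiso hi.1 hi.2.1 hi.2.2)
  by_cases hj : (j + 2 * L ≤ i ∨ i + 2 * L ≤ j) ∧ (j + 2 * L ≤ k ∨ k + 2 * L ≤ j) ∧
      (j + 2 * L ≤ l ∨ l + 2 * L ≤ j)
  · have := hiso hj.1 hj.2.1 hj.2.2
    simp only [hsymm (shift j _) (shift i _)] at this
    exact hsmall this
  by_cases hk : (k + 2 * L ≤ l ∨ l + 2 * L ≤ k) ∧ (k + 2 * L ≤ i ∨ i + 2 * L ≤ k) ∧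
      (k + 2 * L ≤ j ∨ j + 2 * L ≤ k)
  · have := hiso hk.1 hk.2.1 hk.2.2
    simp only [mul_comm (g (shift k _) _)] at this
    exact hsmall this
  by_cases hl : (l + 2 * L ≤ k ∨ k + 2 * L ≤ l) ∧ (l + 2 * L ≤ i ∨ i + 2 * L ≤ l) ∧
      (l + 2 * L ≤ j ∨ j + 2 * L ≤ l)
  · have := hiso hl.1 hl.2.1 hl.2.2
    simp only [hsymm (shift l _) (shift k _), mul_comm (g (shift k _) _)] at this
    exact hsmall this
  -- no time is isolated, so that two disjoint pairs of times are close
  have htriv : |∫ z, g (shift i z) (shift j z) * g (shift k z) (shift l z) ∂ν| ≤ B * B := by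
    refine abs_integral_le_of_bound fun z => ?_
    rw [abs_mul]
    exact mul_le_mul (hB _ _) (hB _ _) (abs_nonneg _) hB0
  refine htriv.trans (le_mul_of_one_le_right (by positivity) ?_)
  have hcase : (i < j + 4 * L ∧ j < i + 4 * L) ∧ (k < l + 4 * L ∧ l < k + 4 * L) ∨
      (i < k + 4 * L ∧ k < i + 4 * L) ∧ (j < l + 4 * L ∧ l < j + 4 * L) ∨
      (i < l + 4 * L ∧ l < i + 4 * L) ∧ (j < k + 4 * L ∧ k < j + 4 * L) := by
    omega
  have h₁ := mul_nonneg (hnn i j) (hnn k l)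
  have h₂ := mul_nonneg (hnn i k) (hnn j l)
  have h₃ := mul_nonneg (hnn i l) (hnn j k)
  have h₄ : 0 ≤ 3 * K * ρ ^ L := by positivity
  rcases hcase with ⟨h, h'⟩ | ⟨h, h'⟩ | ⟨h, h'⟩
  · have e : nearInd (4 * L) i j * nearInd (4 * L) k l = 1 := by simp [nearInd, h, h']
    linarith
  · have e : nearInd (4 * L) i k * nearInd (4 * L) j l = 1 := by simp [nearInd, h, h']
    linarith
  · have e : nearInd (4 * L) i l * nearInd (4 * L) j k = 1 := by simp [nearInd, h, h']
    linarith

end Covariance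

/-- The `L²` norm of a degenerate `U`-statistic is of order `n B L`, instead of the order
`n ^ (3 / 2)` of the projection part: only the quadruples of times without an isolated time contribute. -/
lemma integral_uStatistic_sq_le {g : (ℕ → A) → (ℕ → A) → ℝ} {L : ℕ} {B : ℝ}
    (hν : IsPsiMixing ν K ρ) (hK : 0 ≤ K) (hρ : 0 ≤ ρ)
    (hL : 1 ≤ L) (hg₁ : ∀ y, DependsOn (fun x => g x y) (Set.Iio L))
    (hsymm : ∀ x y, g x y = g y x) (hB : ∀ x y, |g x y| ≤ B)
    (hst : ∀ i, MeasurePreserving (shift i) ν ν)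
    (hdeg : ∀ y, ∫ x, g x y ∂ν = 0) (n : ℕ) :
    ∫ z, (uStatistic g n z) ^ 2 ∂ν ≤
      B ^ 2 * (3 * K * ρ ^ L * n ^ 4 + 3 * ((n : ℝ) * (8 * L)) ^ 2) := by
  obtain ⟨z₀⟩ := ν.nonempty_of_neZero
  have hB0 : 0 ≤ B := (abs_nonneg _).trans (hB z₀ z₀)
  have hg₂ : ∀ x, DependsOn (g x) (Set.Iio L) := fun x y y' h => by
    rw [hsymm x y, hsymm x y']
    exact hg₁ x h
  have hgm : Measurable (Function.uncurry g) :=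
    measurable_uncurry_of_dependsOn (a := L) (b := L)
      (fun y => (hg₁ y).mono Set.Iio_subset_Iic_self)
      (fun x => (hg₂ x).mono Set.Iio_subset_Iic_self)
  have hm : ∀ i j, Measurable fun z : ℕ → A => g (shift i z) (shift j z) := fun i j =>
    hgm.comp ((measurable_shift i).prodMk (measurable_shift j))
  have hint : ∀ q q' : ℕ × ℕ, Integrable (fun z =>
      g (shift q.1 z) (shift q.2 z) * g (shift q'.1 z) (shift q'.2 z)) ν := fun q q' => by
    refine Integrable.of_bound ((hm _ _).mul (hm _ _)).aestronglyMeasurable (B * B)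
      (.of_forall fun z => ?_)
    rw [norm_mul]
    exact mul_le_mul (hB _ _) (hB _ _) (norm_nonneg _) hB0
  have hexp : ∫ z, (uStatistic g n z) ^ 2 ∂ν = ∑ q ∈ timePairs n, ∑ q' ∈ timePairs n,
      ∫ z, g (shift q.1 z) (shift q.2 z) * g (shift q'.1 z) (shift q'.2 z) ∂ν := by
    rw [Finset.sum_congr rfl fun q _ => (integral_finsetSum _ fun q' _ => hint q q').symm,
      ← integral_finsetSum _ fun q _ => integrable_finsetSum _ fun q' _ => hint q q']
    refine integral_congr_ae (.of_forall fun z => ?_)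
    simp only [uStatistic]
    rw [← sum_timePairs n fun i j => g (shift i z) (shift j z), sq, Finset.sum_mul_sum]
  have hsub : timePairs n ⊆ Finset.Icc 1 n ×ˢ Finset.Icc 1 n := Finset.filter_subset _ _
  let b : ℕ × ℕ → ℕ × ℕ → ℝ := fun q q' => B * B * (3 * K * ρ ^ L +
    (nearInd (4 * L) q.1 q.2 * nearInd (4 * L) q'.1 q'.2 +
      nearInd (4 * L) q.1 q'.1 * nearInd (4 * L) q.2 q'.2 +
      nearInd (4 * L) q.1 q'.2 * nearInd (4 * L) q.2 q'.1))
  have hb : ∀ q q', |∫ z, g (shift q.1 z) (shift q.2 z) * g (shift q'.1 z) (shift q'.2 z) ∂ν| ≤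
      b q q' := fun q q' => abs_integral_kernel_mul_le hν hK hρ hL hg₁ hsymm hB hst hdeg _ _ _ _
  have hb0 : ∀ q q', 0 ≤ b q q' := fun q q' => (abs_nonneg _).trans (hb q q')
  rw [hexp]
  calc _ ≤ ∑ q ∈ timePairs n, ∑ q' ∈ timePairs n, b q q' :=
        Finset.sum_le_sum fun q _ => Finset.sum_le_sum fun q' _ => (le_abs_self _).trans (hb q q')
    _ ≤ ∑ q ∈ timePairs n, ∑ q' ∈ Finset.Icc 1 n ×ˢ Finset.Icc 1 n, b q q' :=
        Finset.sum_le_sum fun q _ =>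
          Finset.sum_le_sum_of_subset_of_nonneg hsub fun q' _ _ => hb0 q q'
    _ ≤ ∑ q ∈ Finset.Icc 1 n ×ˢ Finset.Icc 1 n, ∑ q' ∈ Finset.Icc 1 n ×ˢ Finset.Icc 1 n, b q q' :=
        Finset.sum_le_sum_of_subset_of_nonneg hsub fun q _ _ =>
          Finset.sum_nonneg fun q' _ => hb0 q q'
    _ ≤ B * B * (3 * K * ρ ^ L * n ^ 4 + 3 * ((n : ℝ) * (2 * (4 * L : ℕ))) ^ 2) := by
        simp only [b, ← Finset.mul_sum]
        refine mul_le_mul_of_nonneg_left ?_ (by positivity)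
        simp_rw [Finset.sum_add_distrib (f := fun _ => 3 * K * ρ ^ L)]
        rw [Finset.sum_add_distrib]
        refine add_le_add (le_of_eq ?_) (sum_nearInd_pairs_le n (4 * L))
        simp only [Finset.sum_const, Finset.card_product, Nat.card_Icc, nsmul_eq_mul]
        push_cast
        ring
    _ = _ := by
        push_cast
        ring

end Degenerate

/-! ### Series of random variables with summable first moments -/

section Series

variable {Ω : Type*} [MeasurableSpace Ω] {P : Measure Ω} {F : ℕ → Ω → ℝ}

omit [MeasurableSpace Ω] in
lemma tsum_abs_eq_toReal (ω : Ω) : ∑' k, |F k ω| = (∑' k, ‖F k ω‖ₑ).toReal := by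
  rw [ENNReal.tsum_toReal_eq fun k => enorm_ne_top]
  simp

lemma lintegral_tsum_enorm_ne_top (hF : ∀ k, Integrable (F k) P)
    (hs : Summable fun k => ∫ ω, |F k ω| ∂P) : ∫⁻ ω, ∑' k, ‖F k ω‖ₑ ∂P ≠ ⊤ := by
  rw [lintegral_tsum fun k => (hF k).1.enorm]
  have : ∀ k, ∫⁻ ω, ‖F k ω‖ₑ ∂P = ENNReal.ofReal (∫ ω, |F k ω| ∂P) := fun k => by
    rw [← ofReal_integral_norm_eq_lintegral_enorm (hF k)]
    rfl
  simp_rw [this]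
  rw [← ENNReal.ofReal_tsum_of_nonneg (fun k => integral_nonneg fun ω => abs_nonneg _) hs]
  exact ENNReal.ofReal_ne_top

lemma ae_summable_abs (hF : ∀ k, Integrable (F k) P)
    (hs : Summable fun k => ∫ ω, |F k ω| ∂P) : ∀ᵐ ω ∂P, Summable fun k => |F k ω| := by
  filter_upwards [ae_lt_top' (AEMeasurable.tsum fun k => (hF k).1.enorm)
    (lintegral_tsum_enorm_ne_top hF hs)] with ω hω
  have := ENNReal.summable_toReal hω.ne
  simpa using this

lemma integrable_tsum_abs (hF : ∀ k, Integrable (F k) P)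
    (hs : Summable fun k => ∫ ω, |F k ω| ∂P) : Integrable (fun ω => ∑' k, |F k ω|) P := by
  simp_rw [tsum_abs_eq_toReal]
  exact integrable_toReal_of_lintegral_ne_top
    (AEMeasurable.tsum fun k => (hF k).1.enorm) (lintegral_tsum_enorm_ne_top hF hs)

end Series

/-! ### Kernels with geometrically small first moments -/

section Kernels

variable {A : Type*} [MeasurableSpace A] [DiscreteMeasurableSpace A] [Fintype A]

omit [MeasurableSpace A] [DiscreteMeasurableSpace A] [Fintype A] in
lemma shift_zero (z : ℕ → A) : shift 0 z = z := by
  ext j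
  simp [shift]

/-- A family of symmetric uniformly bounded kernels on a stationary geometrically `ψ`-mixing
process, the `k`-th kernel depending on the entries up to `k` of both arguments, whose first
moments along the process are geometrically small. -/
structure MixingKernelFamily (ν : Measure (ℕ → A)) (g : ℕ → (ℕ → A) → (ℕ → A) → ℝ)
    (C D β K ρ : ℝ) : Prop where
  shift_preserving : ∀ i, MeasurePreserving (shift i) ν ν
  mixing : IsPsiMixing ν K ρ
  K_nonneg : 0 ≤ K
  ρ_pos : 0 < ρ
  ρ_lt_one : ρ < 1
  symm : ∀ k x y, g k x y = g k y x
  bdd : ∀ k x y, |g k x y| ≤ C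
  dependsOn : ∀ k y, DependsOn (fun x => g k x y) (Set.Iic k)
  β_pos : 0 < β
  β_lt_one : β < 1
  decay : ∀ k i, 1 ≤ i → ∫ z, |g k z (shift i z)| ∂ν ≤ D * β ^ k

namespace MixingKernelFamily

variable {ν : Measure (ℕ → A)} [IsProbabilityMeasure ν] {g : ℕ → (ℕ → A) → (ℕ → A) → ℝ}
  {C D β K ρ : ℝ}

section
omit [DiscreteMeasurableSpace A] [Fintype A]

omit [IsProbabilityMeasure ν] in
lemma dependsOn' (hg : MixingKernelFamily ν g C D β K ρ) (k : ℕ) (x : ℕ → A) :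
    DependsOn (g k x) (Set.Iic k) := fun y y' h => by
  rw [hg.symm k x y, hg.symm k x y']
  exact hg.dependsOn k x h

lemma C_nonneg (hg : MixingKernelFamily ν g C D β K ρ) : 0 ≤ C := by
  obtain ⟨z⟩ := ν.nonempty_of_neZero
  exact (abs_nonneg _).trans (hg.bdd 0 z z)

omit [IsProbabilityMeasure ν] in
lemma D_nonneg (hg : MixingKernelFamily ν g C D β K ρ) : 0 ≤ D := by
  have h := hg.decay 0 1 le_rfl
  rw [pow_zero, mul_one] at h
  exact (integral_nonneg fun z => abs_nonneg _).trans h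

end

omit [IsProbabilityMeasure ν] in
lemma measurable_kernel (hg : MixingKernelFamily ν g C D β K ρ) (k : ℕ) :
    Measurable (Function.uncurry (g k)) :=
  measurable_uncurry_of_dependsOn (hg.dependsOn k) (hg.dependsOn' k)

lemma integrable_kernel_shift (hg : MixingKernelFamily ν g C D β K ρ) (k i j : ℕ) :
    Integrable (fun z => g k (shift i z) (shift j z)) ν :=
  Integrable.of_bound ((hg.measurable_kernel k).comp
    ((measurable_shift i).prodMk (measurable_shift j))).aestronglyMeasurable C
    (.of_forall fun _ => hg.bdd _ _ _)

lemma integrable_kernel_right (hg : MixingKernelFamily ν g C D β K ρ) (k : ℕ) (x : ℕ → A) :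
    Integrable (g k x) ν :=
  integrable_of_dependsOn (hg.dependsOn' k x) fun y => hg.bdd k x y

lemma integral_abs_kernel_shift_le (hg : MixingKernelFamily ν g C D β K ρ) (k : ℕ) {i j : ℕ}
    (hij : i < j) : ∫ z, |g k (shift i z) (shift j z)| ∂ν ≤ D * β ^ k := by
  have h := integral_comp_shift hg.shift_preserving i
    (f := fun z => |g k z (shift (j - i) z)|) (by
      have := (hg.integrable_kernel_shift k 0 (j - i)).abs.aestronglyMeasurable
      simpa only [shift_zero] using this)
  have e : ∀ z : ℕ → A, shift (j - i) (shift i z) = shift j z := fun z => by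
    ext m
    simp only [shift]
    congr 1
    omega
  simp only [e] at h
  rw [h]
  exact hg.decay k (j - i) (by omega)

/-- The moment bound along the process passes to independent copies of the process, by letting the
distance of the two times tend to infinity. -/
lemma integral_integral_abs_le (hg : MixingKernelFamily ν g C D β K ρ) (k : ℕ) :
    ∫ x, ∫ y, |g k x y| ∂ν ∂ν ≤ D * β ^ k := by
  have hC := hg.C_nonneg
  have hbound : ∀ m : ℕ, ∫ x, ∫ y, |g k x y| ∂ν ∂ν ≤ D * β ^ k + K * ρ ^ (m + 1) * C := by
    intro m
    have hsh : ∀ x, ∫ y, |g k x (shift (k + (m + 1)) y)| ∂ν = ∫ y, |g k x y| ∂ν := fun x =>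
      integral_comp_shift hg.shift_preserving _ (f := fun y => |g k x y|)
        (hg.integrable_kernel_right k x).abs.aestronglyMeasurable
    have key := hg.mixing.one_sided_real (a := k) (g := m + 1) (N := k + (m + 1) + k)
      (G := fun x y => |g k x (shift (k + (m + 1)) y)|)
      (fun y x x' h => congrArg _ (hg.dependsOn k _ h))
      (fun x y y' h => congrArg _ (hg.dependsOn' k x fun j hj => h _ ⟨by omega, by
        have : j ≤ k := hj
        omega⟩))
    simp only [abs_abs, hsh] at key
    have h₁ : ∫ x, ∫ y, |g k x y| ∂ν ∂ν ≤ C := by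
      refine (Real.le_norm_self _).trans (norm_integral_le_of_bound fun x => ?_)
      exact norm_integral_le_of_bound fun y => by simpa using hg.bdd k x y
    have h₂ := hg.decay k (k + (m + 1)) (by omega)
    have h₃ : K * ρ ^ (m + 1) * ∫ x, ∫ y, |g k x y| ∂ν ∂ν ≤ K * ρ ^ (m + 1) * C :=
      mul_le_mul_of_nonneg_left h₁ (mul_nonneg hg.K_nonneg (pow_nonneg hg.ρ_pos.le _))
    have h₄ := (abs_le.1 key).1
    linarith
  have hlim : Tendsto (fun m : ℕ => D * β ^ k + K * ρ ^ (m + 1) * C) atTop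
      (𝓝 (D * β ^ k + K * 0 * C)) :=
    tendsto_const_nhds.add ((((tendsto_pow_atTop_nhds_zero_of_lt_one hg.ρ_pos.le
      hg.ρ_lt_one).comp (tendsto_add_atTop_nat 1)).const_mul K).mul_const C)
  have := ge_of_tendsto' hlim hbound
  simpa using this

omit [DiscreteMeasurableSpace A] [Fintype A] [IsProbabilityMeasure ν] in
lemma dependsOn_hoeffding (hg : MixingKernelFamily ν g C D β K ρ) (k : ℕ) :
    DependsOn (hoeffding ν id (g k)) (Set.Iic k) := fun x x' h => by
  simp only [hoeffding]
  exact integral_congr_ae (.of_forall fun y => hg.dependsOn k _ h)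

omit [DiscreteMeasurableSpace A] [Fintype A] in
lemma abs_hoeffding_le (hg : MixingKernelFamily ν g C D β K ρ) (k : ℕ) (z : ℕ → A) :
    |hoeffding ν id (g k) z| ≤ C :=
  abs_integral_le_of_bound fun _ => hg.bdd k z _

lemma integrable_hoeffding (hg : MixingKernelFamily ν g C D β K ρ) (k : ℕ) :
    Integrable (hoeffding ν id (g k)) ν :=
  integrable_of_dependsOn (hg.dependsOn_hoeffding k) (hg.abs_hoeffding_le k)

lemma integral_abs_hoeffding_le (hg : MixingKernelFamily ν g C D β K ρ) (k : ℕ) :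
    ∫ z, |hoeffding ν id (g k) z| ∂ν ≤ D * β ^ k := by
  refine le_trans (integral_mono (hg.integrable_hoeffding k).abs ?_ fun z => ?_)
    (hg.integral_integral_abs_le k)
  · refine integrable_of_dependsOn (a := k) (c := C) (fun x x' h => ?_) fun x => ?_
    · exact integral_congr_ae (.of_forall fun y => congrArg _ (hg.dependsOn k _ h))
    · exact norm_integral_le_of_bound fun y => by simpa using hg.bdd k x y
  · exact abs_integral_le_integral_abs

lemma abs_integral_hoeffding_le (hg : MixingKernelFamily ν g C D β K ρ) (k : ℕ) :
    |∫ z, hoeffding ν id (g k) z ∂ν| ≤ D * β ^ k :=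
  abs_integral_le_integral_abs.trans (hg.integral_abs_hoeffding_le k)

omit [Fintype A] [DiscreteMeasurableSpace A] [IsProbabilityMeasure ν] in
lemma summable_geometric (hg : MixingKernelFamily ν g C D β K ρ) :
    Summable fun k : ℕ => D * β ^ k :=
  (summable_geometric_of_lt_one hg.β_pos.le hg.β_lt_one).mul_left D

lemma summable_integral_hoeffding (hg : MixingKernelFamily ν g C D β K ρ) :
    Summable fun k => ∫ z, hoeffding ν id (g k) z ∂ν :=
  Summable.of_norm_bounded hg.summable_geometric hg.abs_integral_hoeffding_le

lemma ae_summable_kernel (hg : MixingKernelFamily ν g C D β K ρ) {i j : ℕ} (hij : i < j) :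
    ∀ᵐ z ∂ν, Summable fun k => |g k (shift i z) (shift j z)| :=
  ae_summable_abs (fun k => hg.integrable_kernel_shift k i j)
    (Summable.of_nonneg_of_le (fun _ => integral_nonneg fun _ => abs_nonneg _)
      (fun k => hg.integral_abs_kernel_shift_le k hij) hg.summable_geometric)

lemma ae_summable_hoeffding (hg : MixingKernelFamily ν g C D β K ρ) :
    ∀ᵐ z ∂ν, Summable fun k => |hoeffding ν id (g k) z| :=
  ae_summable_abs hg.integrable_hoeffding
    (Summable.of_nonneg_of_le (fun _ => integral_nonneg fun _ => abs_nonneg _)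
      hg.integral_abs_hoeffding_le hg.summable_geometric)

end MixingKernelFamily

/-- The centred Hoeffding projection of a kernel. -/
noncomputable def centeredProj (ν : Measure (ℕ → A)) (g : (ℕ → A) → (ℕ → A) → ℝ)
    (z : ℕ → A) : ℝ :=
  hoeffding ν id g z - ∫ x, hoeffding ν id g x ∂ν

/-- A function `F` of the whole sequence that is approximated by centred functions `f L` of the
first `L` entries, with an error at most `Ψ η ^ L` for a square integrable `Ψ`. -/
structure IsGeometricApprox (ν : Measure (ℕ → A)) (F : (ℕ → A) → ℝ) (f : ℕ → (ℕ → A) → ℝ)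
    (B η : ℝ) (Ψ : (ℕ → A) → ℝ) : Prop where
  η_pos : 0 < η
  η_lt_one : η < 1
  measurable : Measurable F
  dependsOn : ∀ L, DependsOn (f L) (Set.Iio L)
  bound : ∀ L z, |f L z| ≤ B * L
  integral_eq_zero : ∀ L, ∫ z, f L z ∂ν = 0
  integral_abs_le : ∀ L, ∫ z, |f L z| ∂ν ≤ B
  memLp : MemLp Ψ 2 ν
  abs_le : ∀ᵐ z ∂ν, |F z| ≤ Ψ z
  approx_abs_le : ∀ᵐ z ∂ν, ∀ L, |f L z| ≤ Ψ z
  abs_sub_le : ∀ᵐ z ∂ν, ∀ L, |F z - f L z| ≤ Ψ z * η ^ L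

namespace MixingKernelFamily

variable {ν : Measure (ℕ → A)} [IsProbabilityMeasure ν] {g : ℕ → (ℕ → A) → (ℕ → A) → ℝ}
  {C D β K ρ : ℝ}

/-- The sum of the centred projections is approximated by its partial sums. Since the projections
are bounded, their size is controlled by the square root of their size in mean; the majorant comes
from the series `∑ η⁻²ᵏ |H_k - E H_k|` with `η⁴ = β`, whose terms are dominated by its sum. -/
lemma exists_isGeometricApprox (hg : MixingKernelFamily ν g C D β K ρ) :
    ∃ B η Ψ, IsGeometricApprox ν (fun z => ∑' k, centeredProj ν (g k) z)
      (fun L z => ∑ k ∈ Finset.range L, centeredProj ν (g k) z) B η Ψ := by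
  have hC := hg.C_nonneg
  have hD := hg.D_nonneg
  set η : ℝ := √√β with hη
  have hη0 : 0 < η := Real.sqrt_pos.2 (Real.sqrt_pos.2 hg.β_pos)
  have hη1 : η < 1 := by
    rw [hη, Real.sqrt_lt' one_pos, Real.sqrt_lt' (by norm_num)]
    simpa using hg.β_lt_one
  have hη4 : η ^ 4 = β := by
    rw [show (4 : ℕ) = 2 * 2 from rfl, pow_mul, hη, Real.sq_sqrt (Real.sqrt_nonneg _),
      Real.sq_sqrt hg.β_pos.le]
  let c : ℕ → (ℕ → A) → ℝ := fun k => centeredProj ν (g k)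
  have hcdef : ∀ k z, c k z = hoeffding ν id (g k) z - ∫ x, hoeffding ν id (g k) x ∂ν :=
    fun k z => rfl
  have hcdep : ∀ k, DependsOn (c k) (Set.Iic k) := fun k x y h => by
    rw [hcdef, hcdef, hg.dependsOn_hoeffding k h]
  have hcB : ∀ k z, |c k z| ≤ 2 * C := fun k z => by
    have h₁ := hg.abs_hoeffding_le k z
    have h₂ : |∫ x, hoeffding ν id (g k) x ∂ν| ≤ C :=
      abs_integral_le_of_bound (hg.abs_hoeffding_le k)
    rw [hcdef]
    exact (abs_sub _ _).trans (by linarith)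
  have hcint : ∀ k, Integrable (c k) ν := fun k => integrable_of_dependsOn (hcdep k) (hcB k)
  have hc1 : ∀ k, ∫ z, |c k z| ∂ν ≤ 2 * D * β ^ k := fun k => by
    have h₁ := hg.integral_abs_hoeffding_le k
    have h₂ := hg.abs_integral_hoeffding_le k
    calc ∫ z, |c k z| ∂ν ≤ ∫ z, (|hoeffding ν id (g k) z| + D * β ^ k) ∂ν := by
          refine integral_mono (hcint k).abs
            ((hg.integrable_hoeffding k).abs.add (integrable_const _)) fun z => ?_
          change |c k z| ≤ |hoeffding ν id (g k) z| + D * β ^ k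
          rw [hcdef]
          exact (abs_sub _ _).trans (by linarith)
      _ ≤ _ := by
          rw [integral_add (hg.integrable_hoeffding k).abs (integrable_const _)]
          simp only [integral_const, probReal_univ, one_smul]
          linarith
  have hc0 : ∀ k, ∫ z, c k z ∂ν = 0 := fun k => by
    simp only [hcdef]
    rw [integral_sub (hg.integrable_hoeffding k) (integrable_const _)]
    simp
  -- the weighted series
  let Fw : ℕ → (ℕ → A) → ℝ := fun k z => (η ^ 2)⁻¹ ^ k * c k z
  have hFwabs : ∀ k z, |Fw k z| = (η ^ 2)⁻¹ ^ k * |c k z| := fun k z => by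
    rw [abs_mul, abs_of_pos (by positivity)]
  have hFwint : ∀ k, Integrable (Fw k) ν := fun k => (hcint k).const_mul _
  have hFwsum : Summable fun k => ∫ z, |Fw k z| ∂ν := by
    refine Summable.of_nonneg_of_le (fun k => integral_nonneg fun z => abs_nonneg _) (fun k => ?_)
      ((summable_geometric_of_lt_one (sq_nonneg η) (by nlinarith : η ^ 2 < 1)).mul_left (2 * D))
    simp only [hFwabs, integral_const_mul]
    calc (η ^ 2)⁻¹ ^ k * ∫ z, |c k z| ∂ν ≤ (η ^ 2)⁻¹ ^ k * (2 * D * β ^ k) := by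
          gcongr
          exact hc1 k
      _ = 2 * D * ((η ^ 2)⁻¹ * β) ^ k := by rw [mul_pow]; ring
      _ = 2 * D * (η ^ 2) ^ k := by
          congr 2
          rw [← hη4]
          field_simp
  let Φ : (ℕ → A) → ℝ := fun z => ∑' k, |Fw k z|
  have hΦint : Integrable Φ ν := integrable_tsum_abs hFwint hFwsum
  have hΦ0 : ∀ z, 0 ≤ Φ z := fun z => tsum_nonneg fun k => abs_nonneg _
  let Ψ : (ℕ → A) → ℝ := fun z => √(2 * C * Φ z) * (1 - η)⁻¹
  have hΨ0 : ∀ z, 0 ≤ Ψ z := fun z => mul_nonneg (Real.sqrt_nonneg _) (by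
    rw [inv_nonneg]; linarith)
  have hΨ : MemLp Ψ 2 ν := by
    have hm : AEStronglyMeasurable Ψ ν :=
      ((hΦint.aemeasurable.const_mul _).sqrt.mul_const _).aestronglyMeasurable
    rw [memLp_two_iff_integrable_sq hm]
    have e : (fun z => Ψ z ^ 2) = fun z => 2 * C * (1 - η)⁻¹ ^ 2 * Φ z := by
      ext z
      simp only [Ψ]
      rw [mul_pow, Real.sq_sqrt (mul_nonneg (by positivity) (hΦ0 z))]
      ring
    rw [e]
    exact hΦint.const_mul _
  have hgood := ae_summable_abs hFwint hFwsum
  have hterm : ∀ᵐ z ∂ν, ∀ k, |c k z| ≤ √(2 * C * Φ z) * η ^ k := by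
    filter_upwards [hgood] with z hz k
    have h₁ : |Fw k z| ≤ Φ z := hz.le_tsum k fun j _ => abs_nonneg _
    rw [hFwabs, inv_pow, inv_mul_le_iff₀ (by positivity)] at h₁
    refine abs_le_of_sq_le_sq ?_ (by positivity)
    rw [mul_pow, Real.sq_sqrt (mul_nonneg (by positivity) (hΦ0 z)), ← sq_abs, sq]
    calc |c k z| * |c k z| ≤ (2 * C) * ((η ^ 2) ^ k * Φ z) :=
          mul_le_mul (hcB k z) h₁ (abs_nonneg _) (by positivity)
      _ = _ := by rw [← pow_mul, ← pow_mul, mul_comm 2 k]; ring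
  have hgeo := summable_geometric_of_lt_one hη0.le hη1
  have hsummable : ∀ᵐ z ∂ν, Summable fun k => c k z := by
    filter_upwards [hterm] with z hz
    exact Summable.of_norm_bounded (hgeo.mul_left _) hz
  refine ⟨2 * C + ∑' k, 2 * D * β ^ k, η, Ψ, ⟨hη0, hη1, ?_, ?_, ?_, ?_, ?_, hΨ, ?_, ?_, ?_⟩⟩
  · exact Measurable.tsum fun k => measurable_of_dependsOn (hcdep k)
  · intro L x y h
    refine Finset.sum_congr rfl fun k hk => hcdep k fun j hj => h j ?_
    have h₁ : j ≤ k := hj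
    have h₂ := Finset.mem_range.1 hk
    change j < L
    omega
  · intro L z
    refine (Finset.abs_sum_le_sum_abs _ _).trans
      ((Finset.sum_le_sum fun k _ => hcB k z).trans ?_)
    rw [Finset.sum_const, Finset.card_range, nsmul_eq_mul, mul_comm]
    gcongr
    have : 0 ≤ ∑' k, 2 * D * β ^ k := tsum_nonneg fun k => by have := hg.β_pos; positivity
    linarith
  · intro L
    rw [integral_finsetSum _ fun k _ => hcint k]
    exact Finset.sum_eq_zero fun k _ => hc0 k
  · intro L
    have hs2 : Summable fun k => 2 * D * β ^ k :=
      (summable_geometric_of_lt_one hg.β_pos.le hg.β_lt_one).mul_left _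
    calc ∫ z, |∑ k ∈ Finset.range L, c k z| ∂ν
        ≤ ∫ z, ∑ k ∈ Finset.range L, |c k z| ∂ν :=
          integral_mono (integrable_finsetSum _ fun k _ => hcint k).abs
            (integrable_finsetSum _ fun k _ => (hcint k).abs)
            fun z => Finset.abs_sum_le_sum_abs _ _
      _ = ∑ k ∈ Finset.range L, ∫ z, |c k z| ∂ν := integral_finsetSum _ fun k _ => (hcint k).abs
      _ ≤ ∑ k ∈ Finset.range L, 2 * D * β ^ k := Finset.sum_le_sum fun k _ => hc1 k
      _ ≤ ∑' k, 2 * D * β ^ k := hs2.sum_le_tsum _ fun k _ => by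
          have := hg.β_pos
          positivity
      _ ≤ _ := by linarith
  · filter_upwards [hterm] with z hz
    have := tsum_of_norm_bounded (f := fun k => c k z)
      ((hasSum_geometric_of_lt_one hη0.le hη1).mul_left _) hz
    exact this
  · filter_upwards [hterm] with z hz L
    calc |∑ k ∈ Finset.range L, c k z| ≤ ∑ k ∈ Finset.range L, √(2 * C * Φ z) * η ^ k :=
          (Finset.abs_sum_le_sum_abs _ _).trans (Finset.sum_le_sum fun k _ => hz k)
      _ ≤ ∑' k, √(2 * C * Φ z) * η ^ k :=
          (hgeo.mul_left _).sum_le_tsum _ fun k _ => by positivity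
      _ = Ψ z := by rw [tsum_mul_left, tsum_geometric_of_lt_one hη0.le hη1]
  · filter_upwards [hterm, hsummable] with z hz hs L
    have e : ∑' k, c k z - ∑ k ∈ Finset.range L, c k z = ∑' k, c (k + L) z := by
      rw [← hs.sum_add_tsum_nat_add L]
      ring
    change |∑' k, c k z - ∑ k ∈ Finset.range L, c k z| ≤ _
    rw [e]
    have := tsum_of_norm_bounded (f := fun k => c (k + L) z)
      ((hasSum_geometric_of_lt_one hη0.le hη1).mul_left (√(2 * C * Φ z) * η ^ L))
      fun k => (hz (k + L)).trans (le_of_eq (by rw [pow_add]; ring))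
    calc _ ≤ _ := this
      _ = _ := by simp only [Ψ]; ring

end MixingKernelFamily

end Kernels

/-! ### The asymptotic variance -/

lemma summable_pow_half {r : ℝ} (hr0 : 0 < r) (hr1 : r < 1) :
    Summable fun d : ℕ => r ^ (d / 2) := by
  have hs0 : 0 < √r := Real.sqrt_pos.2 hr0
  have hs1 : √r < 1 := by
    rw [Real.sqrt_lt' one_pos]
    simpa using hr1
  refine Summable.of_nonneg_of_le (fun d => (pow_pos hr0 _).le) (fun d => ?_)
    ((summable_geometric_of_lt_one hs0.le hs1).mul_left (√r)⁻¹)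
  have h₁ : r ^ (d / 2) = √r ^ (2 * (d / 2)) := by
    rw [pow_mul, Real.sq_sqrt hr0.le]
  rw [h₁, ← div_eq_inv_mul, le_div_iff₀ hs0, ← pow_succ]
  exact pow_le_pow_of_le_one hs0.le hs1.le (by omega)

section Shift

variable {A : Type*} [MeasurableSpace A] {ν : Measure (ℕ → A)}

lemma memLp_shift {G : (ℕ → A) → ℝ} (hG : MemLp G 2 ν)
    (hst : ∀ i, MeasurePreserving (shift i) ν ν) (i : ℕ) :
    MemLp (fun z => G (shift i z)) 2 ν :=
  hG.comp_measurePreserving (hst i)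

lemma ae_shift {q : (ℕ → A) → Prop} (hq : ∀ᵐ z ∂ν, q z)
    (hst : ∀ i, MeasurePreserving (shift i) ν ν) : ∀ᵐ z ∂ν, ∀ i, q (shift i z) :=
  ae_all_iff.2 fun i => (hst i).quasiMeasurePreserving.ae hq

end Shift

namespace IsGeometricApprox

variable {A : Type*} [MeasurableSpace A] [DiscreteMeasurableSpace A] [Fintype A]
variable {ν : Measure (ℕ → A)} [IsProbabilityMeasure ν] {K ρ : ℝ}
  {F : (ℕ → A) → ℝ} {f : ℕ → (ℕ → A) → ℝ} {B η : ℝ} {Ψ : (ℕ → A) → ℝ}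

omit [DiscreteMeasurableSpace A] [Fintype A] [IsProbabilityMeasure ν] in
lemma memLp_limit (happ : IsGeometricApprox ν F f B η Ψ) : MemLp F 2 ν :=
  happ.memLp.mono happ.measurable.aestronglyMeasurable
    (happ.abs_le.mono fun _ hz => hz.trans (le_abs_self _))

omit [IsProbabilityMeasure ν] in
lemma measurable_approx (happ : IsGeometricApprox ν F f B η Ψ) (L : ℕ) : Measurable (f L) :=
  measurable_of_dependsOn ((happ.dependsOn L).mono Set.Iio_subset_Iic_self)

lemma memLp_approx (happ : IsGeometricApprox ν F f B η Ψ) (L : ℕ) : MemLp (f L) 2 ν :=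
  MemLp.of_bound (happ.measurable_approx L).aestronglyMeasurable (B * L)
    (.of_forall (happ.bound L))

/-- The autocovariances decay geometrically: `F` is replaced by its approximation depending on the
first `d / 2` entries, so that a gap of length `d / 2` remains for the mixing condition. -/
lemma abs_integral_mul_shift_le (happ : IsGeometricApprox ν F f B η Ψ)
    (hst : ∀ i, MeasurePreserving (shift i) ν ν) (hν : IsPsiMixing ν K ρ) (hK : 0 ≤ K)
    (hρ : 0 ≤ ρ) (hρ1 : ρ < 1) (d : ℕ) :
    |∫ z, F z * F (shift d z) ∂ν| ≤
      (K * B ^ 2 + 2 * ∫ z, Ψ z ^ 2 ∂ν) * (max η ρ) ^ (d / 2) := by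
  set L := d / 2 with hL
  have hη := happ.η_pos
  have hint : Integrable (fun z => F z * F (shift d z)) ν :=
    happ.memLp_limit.integrable_mul (memLp_shift happ.memLp_limit hst d)
  have hint' : Integrable (fun z => f L z * f L (shift d z)) ν :=
    (happ.memLp_approx L).integrable_mul (memLp_shift (happ.memLp_approx L) hst d)
  have hΨ := happ.memLp.integrable_sq
  have hΨd := (memLp_shift happ.memLp hst d).integrable_sq
  have hsh : ∫ z, Ψ (shift d z) ^ 2 ∂ν = ∫ z, Ψ z ^ 2 ∂ν :=
    integral_comp_shift hst d (f := fun z => Ψ z ^ 2) hΨ.aestronglyMeasurable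
  have hdiff : |∫ z, F z * F (shift d z) ∂ν - ∫ z, f L z * f L (shift d z) ∂ν| ≤
      2 * (∫ z, Ψ z ^ 2 ∂ν) * η ^ L := by
    rw [← integral_sub hint hint']
    calc |∫ z, (F z * F (shift d z) - f L z * f L (shift d z)) ∂ν|
        ≤ ∫ z, |F z * F (shift d z) - f L z * f L (shift d z)| ∂ν := abs_integral_le_integral_abs
      _ ≤ ∫ z, η ^ L * (Ψ z ^ 2 + Ψ (shift d z) ^ 2) ∂ν := by
          refine integral_mono_ae (hint.sub hint').abs ((hΨ.add hΨd).const_mul _) ?_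
          filter_upwards [ae_shift happ.abs_le hst, ae_shift happ.approx_abs_le hst,
            ae_shift happ.abs_sub_le hst] with z h₁ h₂ h₃
          have a₁ := h₁ d
          have a₂ := h₂ 0 L
          have a₃ := h₃ 0 L
          have a₄ := h₃ d L
          rw [shift_zero] at a₂ a₃
          have hΨ0 : 0 ≤ Ψ z := (abs_nonneg _).trans a₂
          have hΨd0 : 0 ≤ Ψ (shift d z) := (abs_nonneg _).trans a₁
          have e : F z * F (shift d z) - f L z * f L (shift d z) =
              (F z - f L z) * F (shift d z) + f L z * (F (shift d z) - f L (shift d z)) := by ring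
          change |F z * F (shift d z) - f L z * f L (shift d z)| ≤ _
          rw [e]
          calc _ ≤ Ψ z * η ^ L * Ψ (shift d z) + Ψ z * (Ψ (shift d z) * η ^ L) := by
                refine (abs_add_le _ _).trans (add_le_add ?_ ?_)
                · rw [abs_mul]
                  exact mul_le_mul a₃ a₁ (abs_nonneg _) (by positivity)
                · rw [abs_mul]
                  exact mul_le_mul a₂ a₄ (abs_nonneg _) hΨ0
            _ = η ^ L * (2 * Ψ z * Ψ (shift d z)) := by ring
            _ ≤ _ := by
                gcongr
                exact two_mul_le_add_sq _ _
      _ = _ := by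
          rw [integral_const_mul, integral_add hΨ hΨd, hsh]
          ring
  have hmix : |∫ z, f L z * f L (shift d z) ∂ν| ≤ K * ρ ^ (d - L) * B ^ 2 := by
    have key := hν.one_sided_real (a := L) (g := d - L) (N := d + L)
      (G := fun x y => f L x * f L (shift d y))
      (fun y x x' h => by
        have := happ.dependsOn L (x := x) (y := x') fun j hj =>
          h j (Set.mem_Iic.2 (Set.mem_Iio.1 hj).le)
        simp only [this])
      (fun x y y' h => by
        have := dependsOn_comp_shift (happ.dependsOn L) d (x := y) (y := y')
          fun j hj => h j ⟨by have := hj.1; omega, hj.2.le⟩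
        simp only at this
        simp only [this])
    have h0 : ∫ y, f L (shift d y) ∂ν = 0 := by
      rw [integral_comp_shift hst d (happ.measurable_approx L).aestronglyMeasurable,
        happ.integral_eq_zero]
    have h1 : ∫ y, |f L (shift d y)| ∂ν = ∫ y, |f L y| ∂ν :=
      integral_comp_shift hst d (f := fun z => |f L z|)
        (happ.memLp_approx L).aestronglyMeasurable.norm
    simp only [abs_mul, integral_const_mul, integral_mul_const, h0, h1, mul_zero,
      integral_zero, sub_zero] at key
    refine key.trans (mul_le_mul_of_nonneg_left ?_ (by positivity))
    rw [sq]
    exact mul_le_mul (happ.integral_abs_le L) (happ.integral_abs_le L)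
      (integral_nonneg fun z => abs_nonneg _)
      ((integral_nonneg fun z => abs_nonneg _).trans (happ.integral_abs_le L))
  have hM : 0 ≤ ∫ z, Ψ z ^ 2 ∂ν := integral_nonneg fun z => sq_nonneg _
  have h₁ : ρ ^ (d - L) ≤ max η ρ ^ L :=
    (pow_le_pow_of_le_one hρ hρ1.le (by omega)).trans
      (pow_le_pow_left₀ hρ (le_max_right _ _) _)
  have h₂ : η ^ L ≤ max η ρ ^ L := pow_le_pow_left₀ hη.le (le_max_left _ _) _
  calc |∫ z, F z * F (shift d z) ∂ν|
      ≤ |∫ z, F z * F (shift d z) ∂ν - ∫ z, f L z * f L (shift d z) ∂ν| +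
        |∫ z, f L z * f L (shift d z) ∂ν| := by
        have := abs_add_le (∫ z, F z * F (shift d z) ∂ν - ∫ z, f L z * f L (shift d z) ∂ν)
          (∫ z, f L z * f L (shift d z) ∂ν)
        rwa [sub_add_cancel] at this
    _ ≤ 2 * (∫ z, Ψ z ^ 2 ∂ν) * max η ρ ^ L + K * max η ρ ^ L * B ^ 2 := by
        refine add_le_add (hdiff.trans ?_) (hmix.trans ?_) <;> gcongr
    _ = _ := by ring

lemma summable_integral_mul_shift (happ : IsGeometricApprox ν F f B η Ψ)
    (hst : ∀ i, MeasurePreserving (shift i) ν ν) (hν : IsPsiMixing ν K ρ) (hK : 0 ≤ K)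
    (hρ : 0 ≤ ρ) (hρ1 : ρ < 1) : Summable fun d => ∫ z, F z * F (shift d z) ∂ν := by
  have hr0 : 0 < max η ρ := lt_max_of_lt_left happ.η_pos
  have hr1 : max η ρ < 1 := max_lt happ.η_lt_one hρ1
  exact Summable.of_norm_bounded ((summable_pow_half hr0 hr1).mul_left _)
    (happ.abs_integral_mul_shift_le hst hν hK hρ hρ1)

/-- The variances of the partial sums grow linearly: their increments are partial sums of the
series of autocovariances. -/
lemma exists_tendsto_variance (happ : IsGeometricApprox ν F f B η Ψ)
    (hst : ∀ i, MeasurePreserving (shift i) ν ν) (hν : IsPsiMixing ν K ρ) (hK : 0 ≤ K)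
    (hρ : 0 ≤ ρ) (hρ1 : ρ < 1) : ∃ σsq : NNReal, Tendsto (fun n : ℕ => 1 / (n : ℝ) *
      ∫ z, (∑ i ∈ Finset.Icc 1 n, F (shift i z)) ^ 2 ∂ν) atTop (𝓝 (σsq : ℝ)) := by
  let c : ℕ → ℝ := fun d => ∫ z, F z * F (shift d z) ∂ν
  let S : ℕ → (ℕ → A) → ℝ := fun n z => ∑ i ∈ Finset.Icc 1 n, F (shift i z)
  let V : ℕ → ℝ := fun n => ∫ z, S n z ^ 2 ∂ν
  have hint : ∀ i j, Integrable (fun z => F (shift i z) * F (shift j z)) ν := fun i j =>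
    (memLp_shift happ.memLp_limit hst i).integrable_mul (memLp_shift happ.memLp_limit hst j)
  have hcov : ∀ i d, ∫ z, F (shift i z) * F (shift (i + d) z) ∂ν = c d := by
    intro i d
    have h := integral_comp_shift hst i (f := fun z => F z * F (shift d z)) (by
      have := (hint 0 d).aestronglyMeasurable
      simpa only [shift_zero] using this)
    rw [show c d = ∫ z, F z * F (shift d z) ∂ν from rfl, ← h]
    refine integral_congr_ae (.of_forall fun z => ?_)
    have e : shift d (shift i z) = shift (i + d) z := by
      ext m
      simp only [shift, add_assoc]
    simp only [e]
  have hSL : ∀ n, MemLp (S n) 2 ν := fun n =>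
    memLp_finsetSum _ fun i _ => memLp_shift happ.memLp_limit hst i
  have hinc : ∀ n, V (n + 1) - V n = c 0 + 2 * ∑ d ∈ Finset.range n, c (d + 1) := by
    intro n
    have hS : ∀ z, S (n + 1) z = S n z + F (shift (n + 1) z) := fun z =>
      Finset.sum_Icc_succ_top (by omega) _
    have e₁ : ∫ z, S n z * F (shift (n + 1) z) ∂ν = ∑ d ∈ Finset.range n, c (d + 1) := by
      have : ∀ z, S n z * F (shift (n + 1) z) =
          ∑ i ∈ Finset.Icc 1 n, F (shift i z) * F (shift (n + 1) z) := fun z =>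
        Finset.sum_mul _ _ _
      simp_rw [this]
      rw [integral_finsetSum _ fun i _ => hint i (n + 1)]
      have hsum : ∀ i ∈ Finset.Icc 1 n, ∫ z, F (shift i z) * F (shift (n + 1) z) ∂ν =
          c (n + 1 - i) := fun i hi => by
        rw [← hcov i (n + 1 - i)]
        congr! 5
        have := Finset.mem_Icc.1 hi
        omega
      rw [Finset.sum_congr rfl hsum]
      refine Finset.sum_bij' (fun i _ => n - i) (fun d _ => n - d) ?_ ?_ ?_ ?_ ?_ <;>
        simp only [Finset.mem_Icc, Finset.mem_range] <;> intro i hi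
      · omega
      · omega
      · omega
      · omega
      · congr 1
        omega
    have e₂ : ∫ z, F (shift (n + 1) z) ^ 2 ∂ν = c 0 := by
      rw [← hcov (n + 1) 0]
      simp only [add_zero, sq]
    have hi₁ : Integrable (fun z => S n z * F (shift (n + 1) z)) ν :=
      (hSL n).integrable_mul (memLp_shift happ.memLp_limit hst (n + 1))
    have hi₂ := (memLp_shift happ.memLp_limit hst (n + 1)).integrable_sq
    have : ∀ z, S (n + 1) z ^ 2 =
        S n z ^ 2 + (2 * (S n z * F (shift (n + 1) z)) + F (shift (n + 1) z) ^ 2) := fun z => by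
      rw [hS]
      ring
    simp only [V]
    simp_rw [this]
    have hi₃ : Integrable (fun z => 2 * (S n z * F (shift (n + 1) z)) +
      F (shift (n + 1) z) ^ 2) ν := (hi₁.const_mul 2).add hi₂
    rw [integral_add (hSL n).integrable_sq hi₃, integral_add (hi₁.const_mul 2) hi₂,
      integral_const_mul, e₁, e₂]
    ring
  have hsum := happ.summable_integral_mul_shift hst hν hK hρ hρ1
  have hlim : Tendsto (fun n => V (n + 1) - V n) atTop (𝓝 (c 0 + 2 * ∑' d, c (d + 1))) := by
    simp_rw [hinc]
    exact (((summable_nat_add_iff 1).2 hsum).hasSum.tendsto_sum_nat.const_mul 2).const_add _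
  -- the averages of the increments are the variances divided by `n`
  have hces := hlim.cesaro
  simp_rw [Finset.sum_range_sub] at hces
  have hV0 : V 0 = 0 := by simp [V, S]
  simp_rw [hV0, sub_zero, ← one_div] at hces
  have hnn : 0 ≤ c 0 + 2 * ∑' d, c (d + 1) :=
    ge_of_tendsto' hces fun n => mul_nonneg (by positivity) (integral_nonneg fun z => sq_nonneg _)
  exact ⟨⟨_, hnn⟩, hces⟩

/-- Replacing `F` by its approximation changes the variance of the partial sums by an exponentially
small relative amount. -/
lemma abs_integral_sum_sq_sub_le (happ : IsGeometricApprox ν F f B η Ψ)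
    (hst : ∀ i, MeasurePreserving (shift i) ν ν) (n L : ℕ) :
    |∫ z, (∑ i ∈ Finset.Icc 1 n, F (shift i z)) ^ 2 ∂ν -
      ∫ z, (∑ i ∈ Finset.Icc 1 n, f L (shift i z)) ^ 2 ∂ν| ≤
      2 * η ^ L * n ^ 2 * ∫ z, Ψ z ^ 2 ∂ν := by
  have hη := happ.η_pos
  have h₁ : MemLp (fun z => ∑ i ∈ Finset.Icc 1 n, F (shift i z)) 2 ν :=
    memLp_finsetSum _ fun i _ => memLp_shift happ.memLp_limit hst i
  have h₂ : MemLp (fun z => ∑ i ∈ Finset.Icc 1 n, f L (shift i z)) 2 ν :=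
    memLp_finsetSum _ fun i _ => memLp_shift (happ.memLp_approx L) hst i
  have hΨ : ∀ i, Integrable (fun z => Ψ (shift i z) ^ 2) ν := fun i =>
    (memLp_shift happ.memLp hst i).integrable_sq
  have hsh : ∀ i, ∫ z, Ψ (shift i z) ^ 2 ∂ν = ∫ z, Ψ z ^ 2 ∂ν := fun i =>
    integral_comp_shift hst i (f := fun z => Ψ z ^ 2) happ.memLp.integrable_sq.aestronglyMeasurable
  rw [← integral_sub h₁.integrable_sq h₂.integrable_sq]
  calc _ ≤ ∫ z, |(∑ i ∈ Finset.Icc 1 n, F (shift i z)) ^ 2 -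
        (∑ i ∈ Finset.Icc 1 n, f L (shift i z)) ^ 2| ∂ν := abs_integral_le_integral_abs
    _ ≤ ∫ z, 2 * η ^ L * n * ∑ i ∈ Finset.Icc 1 n, Ψ (shift i z) ^ 2 ∂ν := by
        refine integral_mono_ae (h₁.integrable_sq.sub h₂.integrable_sq).abs
          ((integrable_finsetSum _ fun i _ => hΨ i).const_mul _) ?_
        filter_upwards [ae_shift happ.abs_le hst, ae_shift happ.approx_abs_le hst,
          ae_shift happ.abs_sub_le hst] with z a₁ a₂ a₃
        set T := ∑ i ∈ Finset.Icc 1 n, Ψ (shift i z) with hT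
        have hT0 : 0 ≤ T := Finset.sum_nonneg fun i _ => (abs_nonneg _).trans (a₁ i)
        have b₁ : |∑ i ∈ Finset.Icc 1 n, F (shift i z)| ≤ T :=
          (Finset.abs_sum_le_sum_abs _ _).trans (Finset.sum_le_sum fun i _ => a₁ i)
        have b₂ : |∑ i ∈ Finset.Icc 1 n, f L (shift i z)| ≤ T :=
          (Finset.abs_sum_le_sum_abs _ _).trans (Finset.sum_le_sum fun i _ => a₂ i L)
        have b₃ : |∑ i ∈ Finset.Icc 1 n, F (shift i z) - ∑ i ∈ Finset.Icc 1 n, f L (shift i z)| ≤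
            T * η ^ L := by
          rw [← Finset.sum_sub_distrib, hT, Finset.sum_mul]
          exact (Finset.abs_sum_le_sum_abs _ _).trans (Finset.sum_le_sum fun i _ => a₃ i L)
        have b₄ : T ^ 2 ≤ n * ∑ i ∈ Finset.Icc 1 n, Ψ (shift i z) ^ 2 := by
          have := sq_sum_le_card_mul_sum_sq (s := Finset.Icc 1 n) (f := fun i => Ψ (shift i z))
          simpa using this
        change |(∑ i ∈ Finset.Icc 1 n, F (shift i z)) ^ 2 -
          (∑ i ∈ Finset.Icc 1 n, f L (shift i z)) ^ 2| ≤ _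
        rw [sq_sub_sq, abs_mul]
        calc _ ≤ (T + T) * (T * η ^ L) :=
              mul_le_mul ((abs_add_le _ _).trans (add_le_add b₁ b₂)) b₃ (abs_nonneg _)
                (by positivity)
          _ = 2 * η ^ L * T ^ 2 := by ring
          _ ≤ 2 * η ^ L * (n * ∑ i ∈ Finset.Icc 1 n, Ψ (shift i z) ^ 2) := by gcongr
          _ = _ := by ring
    _ = _ := by
        rw [integral_const_mul, integral_finsetSum _ fun i _ => hΨ i,
          Finset.sum_congr rfl fun i _ => hsh i]
        simp
        ring

end IsGeometricApprox

/-! ### The truncation level and the central limit theorem for the projections -/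

/-- The number of coordinates retained at sample size `n`. It grows so slowly that its powers are
negligible against `√n`, and so fast that geometric errors beat all powers of `n`. -/
noncomputable def truncLevel (n : ℕ) : ℕ := ⌊(n : ℝ) ^ (1 / 16 : ℝ)⌋₊ + 1

lemma one_le_truncLevel (n : ℕ) : 1 ≤ truncLevel n := Nat.le_add_left _ _

lemma rpow_pow_sixteen (n : ℕ) : ((n : ℝ) ^ (1 / 16 : ℝ)) ^ 16 = n := by
  rw [← Real.rpow_natCast, ← Real.rpow_mul (Nat.cast_nonneg n)]
  norm_num

lemma le_truncLevel_pow (n : ℕ) : (n : ℝ) ≤ (truncLevel n : ℝ) ^ 16 := by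
  have h : (n : ℝ) ^ (1 / 16 : ℝ) ≤ truncLevel n := by
    rw [truncLevel, Nat.cast_add, Nat.cast_one]
    exact (Nat.lt_floor_add_one _).le
  calc (n : ℝ) = ((n : ℝ) ^ (1 / 16 : ℝ)) ^ 16 := (rpow_pow_sixteen n).symm
    _ ≤ _ := pow_le_pow_left₀ (Real.rpow_nonneg (Nat.cast_nonneg n) _) h 16

lemma truncLevel_pow_le {n : ℕ} (hn : 1 ≤ n) : (truncLevel n : ℝ) ^ 16 ≤ 2 ^ 16 * n := by
  have h0 : (0 : ℝ) ≤ (n : ℝ) ^ (1 / 16 : ℝ) := Real.rpow_nonneg (Nat.cast_nonneg n) _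
  have h1 : (1 : ℝ) ≤ (n : ℝ) ^ (1 / 16 : ℝ) :=
    Real.one_le_rpow (by exact_mod_cast hn) (by norm_num)
  have h : (truncLevel n : ℝ) ≤ 2 * (n : ℝ) ^ (1 / 16 : ℝ) := by
    rw [truncLevel, Nat.cast_add, Nat.cast_one]
    linarith [Nat.floor_le h0]
  calc (truncLevel n : ℝ) ^ 16 ≤ (2 * (n : ℝ) ^ (1 / 16 : ℝ)) ^ 16 :=
        pow_le_pow_left₀ (Nat.cast_nonneg _) h 16
    _ = _ := by rw [mul_pow, rpow_pow_sixteen]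

lemma sqrt_le_truncLevel_pow (n : ℕ) : √(n : ℝ) ≤ (truncLevel n : ℝ) ^ 8 := by
  rw [Real.sqrt_le_left (by positivity), ← pow_mul]
  exact le_truncLevel_pow n

lemma truncLevel_pow_le_sqrt {n : ℕ} (hn : 1 ≤ n) : (truncLevel n : ℝ) ^ 8 ≤ 2 ^ 8 * √n := by
  refine le_of_sq_le_sq ?_ (by positivity)
  rw [mul_pow, Real.sq_sqrt (Nat.cast_nonneg n), ← pow_mul, ← pow_mul]
  exact truncLevel_pow_le hn

lemma tendsto_truncLevel : Tendsto truncLevel atTop atTop := by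
  refine tendsto_atTop_mono (fun n => Nat.le_succ _) (tendsto_nat_floor_atTop.comp ?_)
  exact (tendsto_rpow_atTop (by norm_num)).comp tendsto_natCast_atTop_atTop

lemma tendsto_truncLevel_pow_mul_pow (a : ℕ) {r : ℝ} (hr0 : 0 ≤ r) (hr1 : r < 1) :
    Tendsto (fun n => (truncLevel n : ℝ) ^ a * r ^ truncLevel n) atTop (𝓝 0) :=
  (tendsto_pow_const_mul_const_pow_of_abs_lt_one a (by rwa [abs_of_nonneg hr0])).comp
    tendsto_truncLevel

lemma tendsto_inv_truncLevel : Tendsto (fun n => (truncLevel n : ℝ)⁻¹) atTop (𝓝 0) :=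
  tendsto_inv_atTop_zero.comp (tendsto_natCast_atTop_atTop.comp tendsto_truncLevel)

lemma truncLevel_pow_five_div_sqrt_le {n : ℕ} (hn : 1 ≤ n) :
    (truncLevel n : ℝ) ^ 5 / √n ≤ 2 ^ 8 * (truncLevel n : ℝ)⁻¹ ^ 3 := by
  have hL : (0 : ℝ) < truncLevel n := by exact_mod_cast one_le_truncLevel n
  have hn0 : (0 : ℝ) < √n := Real.sqrt_pos.2 (by exact_mod_cast hn)
  rw [div_le_iff₀ hn0]
  calc (truncLevel n : ℝ) ^ 5 = (truncLevel n : ℝ)⁻¹ ^ 3 * (truncLevel n : ℝ) ^ 8 := by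
        field_simp
    _ ≤ (truncLevel n : ℝ)⁻¹ ^ 3 * (2 ^ 8 * √n) := by
        gcongr
        exact truncLevel_pow_le_sqrt hn
    _ = _ := by ring

namespace IsGeometricApprox

variable {A : Type*} [MeasurableSpace A] [DiscreteMeasurableSpace A] [Fintype A]
variable {ν : Measure (ℕ → A)} [IsProbabilityMeasure ν] {K ρ : ℝ}
  {F : (ℕ → A) → ℝ} {f : ℕ → (ℕ → A) → ℝ} {B η : ℝ} {Ψ : (ℕ → A) → ℝ}

/-- The central limit theorem for the projections in terms of characteristic functions. At sample
size `n` the function `F` is replaced by its approximation by `truncLevel n` entries, and the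
variance of that approximation tends to the variance of `F`. -/
lemma tendsto_integral_expI (happ : IsGeometricApprox ν F f B η Ψ)
    (hst : ∀ i, MeasurePreserving (shift i) ν ν) (hν : IsPsiMixing ν K ρ) (hK : 0 ≤ K)
    (hρ : 0 ≤ ρ) (hρ1 : ρ < 1) {σsq : NNReal} (hσ : Tendsto (fun n : ℕ => 1 / (n : ℝ) *
      ∫ z, (∑ i ∈ Finset.Icc 1 n, F (shift i z)) ^ 2 ∂ν) atTop (𝓝 (σsq : ℝ))) (t : ℝ) :
    Tendsto (fun n : ℕ => ∫ z, expI (t * (1 / √n * ∑ i ∈ Finset.Icc 1 n,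
      f (truncLevel n) (shift i z))) ∂ν) atTop
      (𝓝 (Complex.exp (-(σsq * t ^ 2 / 2 : ℝ)))) := by
  obtain ⟨z₀⟩ := ν.nonempty_of_neZero
  have hB0 : 0 ≤ B := by
    have := (abs_nonneg _).trans (happ.bound 1 z₀)
    simpa using this
  set M := ∫ z, Ψ z ^ 2 ∂ν with hM
  have hM0 : 0 ≤ M := integral_nonneg fun z => sq_nonneg _
  have hη := happ.η_pos
  let v : ℕ → ℝ := fun n => 1 / (n : ℝ) * ∫ z, (∑ i ∈ Finset.Icc 1 n, F (shift i z)) ^ 2 ∂ν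
  let err : ℕ → ℝ := fun n =>
    (3 * K * B * ((truncLevel n : ℝ) ^ 9 * ρ ^ truncLevel n) +
      |t| * (24 * K * B ^ 2 * ((truncLevel n : ℝ) ^ 3 * ρ ^ truncLevel n)) +
      192 * t ^ 2 * B ^ 3 * (2 ^ 8 * (truncLevel n : ℝ)⁻¹ ^ 3) +
      |t| * (|v n - σsq| + 2 * M * ((truncLevel n : ℝ) ^ 16 * η ^ truncLevel n) +
        3 * K * B ^ 2 * ((truncLevel n : ℝ) ^ 18 * ρ ^ truncLevel n))) * |t|
  have herr : Tendsto err atTop (𝓝 0) := by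
    have h₁ := (tendsto_truncLevel_pow_mul_pow 9 hρ hρ1).const_mul (3 * K * B)
    have h₂ := ((tendsto_truncLevel_pow_mul_pow 3 hρ hρ1).const_mul (24 * K * B ^ 2)).const_mul |t|
    have h₃ := ((tendsto_inv_truncLevel.pow 3).const_mul (2 ^ 8)).const_mul (192 * t ^ 2 * B ^ 3)
    have h₄ : Tendsto (fun n => |v n - σsq|) atTop (𝓝 0) := by
      have := (hσ.sub_const (σsq : ℝ)).abs
      rwa [sub_self, abs_zero] at this
    have h₅ := (tendsto_truncLevel_pow_mul_pow 16 hη.le happ.η_lt_one).const_mul (2 * M)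
    have h₆ := (tendsto_truncLevel_pow_mul_pow 18 hρ hρ1).const_mul (3 * K * B ^ 2)
    have := (((h₁.add h₂).add h₃).add (((h₄.add h₅).add h₆).const_mul |t|)).mul_const |t|
    refine this.trans_eq ?_
    simp
  rw [tendsto_iff_norm_sub_tendsto_zero]
  refine squeeze_zero' (.of_forall fun n => norm_nonneg _) ?_ herr
  filter_upwards [eventually_ge_atTop 1] with n hn
  set L := truncLevel n with hL
  have hL1 : 1 ≤ L := one_le_truncLevel n
  have hn0 : (0 : ℝ) < n := by exact_mod_cast hn
  refine (norm_charFun_local_sum_sub_exp_le hst hν hK hρ hL1 (happ.dependsOn L) (happ.bound L)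
    (happ.integral_eq_zero L) σsq.2 hn t).trans ?_
  have hnL : (n : ℝ) ≤ (L : ℝ) ^ 16 := le_truncLevel_pow n
  have hsL : √(n : ℝ) ≤ (L : ℝ) ^ 8 := sqrt_le_truncLevel_pow n
  have e₁ : √(n : ℝ) * (3 * (K * ρ ^ L * (B * L))) ≤ 3 * K * B * ((L : ℝ) ^ 9 * ρ ^ L) := by
    calc _ ≤ (L : ℝ) ^ 8 * (3 * (K * ρ ^ L * (B * L))) := by gcongr
      _ = _ := by ring
  have e₂ : 3 * (K * ρ ^ L * (B * L * ((8 * L : ℕ) * (B * L)))) =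
      24 * K * B ^ 2 * ((L : ℝ) ^ 3 * ρ ^ L) := by
    push_cast
    ring
  have e₃ : 3 * t ^ 2 * ((8 * L : ℕ) * (B * L)) ^ 2 * (B * L) / √n ≤
      192 * t ^ 2 * B ^ 3 * (2 ^ 8 * (L : ℝ)⁻¹ ^ 3) := by
    calc _ = 192 * t ^ 2 * B ^ 3 * ((L : ℝ) ^ 5 / √n) := by
          push_cast
          ring
      _ ≤ _ := by
          gcongr
          exact truncLevel_pow_five_div_sqrt_le hn
  have e₄ : |1 / (n : ℝ) * ∫ z, (∑ i ∈ Finset.Icc 1 n, f L (shift i z)) ^ 2 ∂ν - σsq| ≤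
      |v n - σsq| + 2 * M * ((L : ℝ) ^ 16 * η ^ L) := by
    have h := happ.abs_integral_sum_sq_sub_le hst n L
    have h' : |1 / (n : ℝ) * ∫ z, (∑ i ∈ Finset.Icc 1 n, f L (shift i z)) ^ 2 ∂ν - v n| ≤
        2 * M * ((L : ℝ) ^ 16 * η ^ L) := by
      simp only [v]
      rw [← mul_sub, abs_mul, abs_of_pos (by positivity : (0 : ℝ) < 1 / n), abs_sub_comm]
      calc _ ≤ 1 / (n : ℝ) * (2 * η ^ L * n ^ 2 * M) := by gcongr
        _ = 2 * M * (n * η ^ L) := by field_simp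
        _ ≤ _ := by gcongr
    calc _ = |(v n - σsq) + (1 / (n : ℝ) * ∫ z, (∑ i ∈ Finset.Icc 1 n, f L (shift i z)) ^ 2 ∂ν -
          v n)| := by
          congr 1
          ring
      _ ≤ _ := (abs_add_le _ _).trans (add_le_add le_rfl h')
  have e₅ : 3 * (K * ρ ^ L * (B * L * (n * (B * L)))) ≤
      3 * K * B ^ 2 * ((L : ℝ) ^ 18 * ρ ^ L) := by
    calc _ ≤ 3 * (K * ρ ^ L * (B * L * ((L : ℝ) ^ 16 * (B * L)))) := by gcongr
      _ = _ := by ring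
  refine mul_le_mul_of_nonneg_right ?_ (abs_nonneg t)
  refine add_le_add (add_le_add (add_le_add e₁ ?_) e₃) ?_
  · exact mul_le_mul_of_nonneg_left e₂.le (abs_nonneg t)
  · exact mul_le_mul_of_nonneg_left (add_le_add e₄ e₅) (abs_nonneg t)

end IsGeometricApprox

/-! ### The Hoeffding decomposition and the size of the remainder -/

section Series

variable {Ω : Type*} [MeasurableSpace Ω] {P : Measure Ω} {F : ℕ → Ω → ℝ}

lemma integrable_tsum_of_summable (hF : ∀ k, Integrable (F k) P)
    (hs : Summable fun k => ∫ ω, |F k ω| ∂P) : Integrable (fun ω => ∑' k, F k ω) P := by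
  refine (integrable_tsum_abs hF hs).mono'
    (AEMeasurable.tsum fun k => (hF k).aemeasurable).aestronglyMeasurable ?_
  filter_upwards [ae_summable_abs hF hs] with ω hω
  exact norm_tsum_le_tsum_norm hω

lemma integral_abs_tsum_sub_sum_le (hF : ∀ k, Integrable (F k) P)
    (hs : Summable fun k => ∫ ω, |F k ω| ∂P) (L : ℕ) :
    ∫ ω, |∑' k, F k ω - ∑ k ∈ Finset.range L, F k ω| ∂P ≤ ∑' k, ∫ ω, |F (k + L) ω| ∂P := by
  have hs' : Summable fun k => ∫ ω, |F (k + L) ω| ∂P := (summable_nat_add_iff L).2 hs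
  have h := hasSum_integral_of_summable_integral_norm (F := fun k ω => |F (k + L) ω|)
    (fun k => (hF (k + L)).abs) (by simpa using hs')
  rw [h.tsum_eq]
  refine integral_mono_ae ((integrable_tsum_of_summable hF hs).sub
    (integrable_finsetSum _ fun k _ => hF k)).abs
    (integrable_tsum_abs (fun k => hF (k + L)) hs') ?_
  filter_upwards [ae_summable_abs hF hs] with ω hω
  have e : ∑' k, F k ω - ∑ k ∈ Finset.range L, F k ω = ∑' k, F (k + L) ω := by
    rw [← hω.of_abs.sum_add_tsum_nat_add L]
    ring
  have h' : Summable fun k => ‖F (k + L) ω‖ := (summable_nat_add_iff L).2 hω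
  rw [e]
  exact norm_tsum_le_tsum_norm h'

/-- The first moment is at most the root of the second moment. -/
lemma integral_abs_le_sqrt [IsProbabilityMeasure P] {X : Ω → ℝ} (hX : MemLp X 2 P) :
    ∫ ω, |X ω| ∂P ≤ √(∫ ω, X ω ^ 2 ∂P) := by
  have h := variance_nonneg (fun ω => |X ω|) P
  rw [variance_eq_sub (X := fun ω => |X ω|) hX.abs] at h
  refine Real.le_sqrt_of_sq_le ?_
  simpa using h

end Series

lemma sum_pairs_add (a : ℕ → ℝ) (n : ℕ) :
    ∑ i ∈ Finset.Icc 1 n, ∑ j ∈ Finset.Icc (i + 1) n, (a i + a j) =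
      ((n : ℝ) - 1) * ∑ i ∈ Finset.Icc 1 n, a i := by
  induction n with
  | zero => simp
  | succ n ih =>
    have h : ∀ i ∈ Finset.Icc 1 n, ∑ j ∈ Finset.Icc (i + 1) (n + 1), (a i + a j) =
        ∑ j ∈ Finset.Icc (i + 1) n, (a i + a j) + (a i + a (n + 1)) := fun i hi =>
      Finset.sum_Icc_succ_top (by have := Finset.mem_Icc.1 hi; omega) _
    have hn : 1 ≤ n + 1 := Nat.le_add_left 1 n
    rw [Finset.sum_Icc_succ_top hn, Finset.sum_congr rfl h, Finset.sum_add_distrib, ih,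
      Finset.sum_Icc_succ_top hn, Finset.sum_add_distrib,
      Finset.Icc_eq_empty_of_lt (Nat.lt_succ_self (n + 1)), Finset.sum_empty]
    simp only [Finset.sum_const, Nat.card_Icc, nsmul_eq_mul]
    push_cast
    ring

lemma card_timePairs_le (n : ℕ) : ((timePairs n).card : ℝ) ≤ (n : ℝ) ^ 2 := by
  have h : (timePairs n).card ≤ n ^ 2 := by
    refine (Finset.card_filter_le _ _).trans ?_
    simp [Finset.card_product, sq]
  exact_mod_cast h

lemma lt_of_mem_timePairs {n : ℕ} {q : ℕ × ℕ} (hq : q ∈ timePairs n) : q.1 < q.2 :=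
  (Finset.mem_filter.1 hq).2

lemma uStatistic_eq_sum_timePairs {A : Type*} (g : (ℕ → A) → (ℕ → A) → ℝ) (n : ℕ) (z : ℕ → A) :
    uStatistic g n z = ∑ q ∈ timePairs n, g (shift q.1 z) (shift q.2 z) :=
  (sum_timePairs n fun i j => g (shift i z) (shift j z)).symm

namespace MixingKernelFamily

variable {A : Type*} [MeasurableSpace A] [DiscreteMeasurableSpace A] [Fintype A]
variable {ν : Measure (ℕ → A)} [IsProbabilityMeasure ν] {g : ℕ → (ℕ → A) → (ℕ → A) → ℝ}
  {C D β K ρ : ℝ}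

/-- The degenerate part `∑_{k < L} (g_k (x, y) - H_k (x) - H_k (y) + E H_k)` of a truncated family
of kernels. -/
noncomputable def degenerateKernel (ν : Measure (ℕ → A)) (g : ℕ → (ℕ → A) → (ℕ → A) → ℝ) (L : ℕ)
    (x y : ℕ → A) : ℝ :=
  ∑ k ∈ Finset.range L, (g k x y - centeredProj ν (g k) x - centeredProj ν (g k) y -
    ∫ z, hoeffding ν id (g k) z ∂ν)

omit [DiscreteMeasurableSpace A] [Fintype A] in
lemma abs_degenerateKernel_le (hg : MixingKernelFamily ν g C D β K ρ) (L : ℕ) (x y : ℕ → A) :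
    |degenerateKernel ν g L x y| ≤ 4 * C * L := by
  refine (Finset.abs_sum_le_sum_abs _ _).trans
    ((Finset.sum_le_sum (g := fun _ => 4 * C) fun k _ => ?_).trans (le_of_eq ?_))
  · have h₁ := abs_le.1 (hg.bdd k x y)
    have h₂ := abs_le.1 (hg.abs_hoeffding_le k x)
    have h₃ := abs_le.1 (hg.abs_hoeffding_le k y)
    have h₄ := abs_le.1 (abs_integral_le_of_bound (ν := ν) (hg.abs_hoeffding_le k))
    rw [centeredProj, centeredProj, abs_le]
    constructor <;> linarith [h₁.1, h₁.2, h₂.1, h₂.2, h₃.1, h₃.2, h₄.1, h₄.2]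
  · rw [Finset.sum_const, Finset.card_range, nsmul_eq_mul, mul_comm]

omit [DiscreteMeasurableSpace A] [Fintype A] [IsProbabilityMeasure ν] in
lemma degenerateKernel_symm (hg : MixingKernelFamily ν g C D β K ρ) (L : ℕ) (x y : ℕ → A) :
    degenerateKernel ν g L x y = degenerateKernel ν g L y x :=
  Finset.sum_congr rfl fun k _ => by
    rw [hg.symm k x y]
    ring

omit [DiscreteMeasurableSpace A] [Fintype A] [IsProbabilityMeasure ν] in
lemma dependsOn_degenerateKernel (hg : MixingKernelFamily ν g C D β K ρ) (L : ℕ) (y : ℕ → A) :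
    DependsOn (fun x => degenerateKernel ν g L x y) (Set.Iio L) := fun x x' h => by
  refine Finset.sum_congr rfl fun k hk => ?_
  have h' : ∀ i ∈ Set.Iic k, x i = x' i := fun i hi =>
    h i (lt_of_le_of_lt hi (Finset.mem_range.1 hk))
  have h₁ : g k x y = g k x' y := hg.dependsOn k y h'
  have h₂ : hoeffding ν id (g k) x = hoeffding ν id (g k) x' := hg.dependsOn_hoeffding k h'
  simp only [centeredProj, h₁, h₂]

lemma integral_degenerateKernel (hg : MixingKernelFamily ν g C D β K ρ) (L : ℕ) (y : ℕ → A) :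
    ∫ x, degenerateKernel ν g L x y ∂ν = 0 := by
  have h₁ : ∀ k, Integrable (fun x => g k x y) ν := fun k => by
    simpa only [hg.symm k _ y] using hg.integrable_kernel_right k y
  have h₂ : ∀ k, Integrable (centeredProj ν (g k)) ν := fun k =>
    (hg.integrable_hoeffding k).sub (integrable_const _)
  have h₃ : ∀ k, ∫ x, centeredProj ν (g k) x ∂ν = 0 := fun k => by
    simp only [centeredProj]
    rw [integral_sub (hg.integrable_hoeffding k) (integrable_const _)]
    simp
  have h₄ : ∀ k, ∫ x, g k x y ∂ν = hoeffding ν id (g k) y := fun k => by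
    simp only [hg.symm k _ y]
    rfl
  simp only [degenerateKernel]
  have h₅ : ∀ k, Integrable (fun x => g k x y - centeredProj ν (g k) x) ν := fun k =>
    (h₁ k).sub (h₂ k)
  have h₆ : ∀ k, Integrable (fun x => g k x y - centeredProj ν (g k) x -
      centeredProj ν (g k) y) ν := fun k => (h₅ k).sub (integrable_const _)
  have h₇ : ∀ k, Integrable (fun x => g k x y - centeredProj ν (g k) x -
      centeredProj ν (g k) y - ∫ z, hoeffding ν id (g k) z ∂ν) ν := fun k =>
    (h₆ k).sub (integrable_const _)
  rw [integral_finsetSum _ fun k _ => h₇ k]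
  refine Finset.sum_eq_zero fun k _ => ?_
  rw [integral_sub (h₆ k) (integrable_const _), integral_sub (h₅ k) (integrable_const _),
    integral_sub (h₁ k) (h₂ k), h₃, h₄]
  simp [centeredProj]

omit [DiscreteMeasurableSpace A] [Fintype A] [IsProbabilityMeasure ν] in
/-- The Hoeffding decomposition of the truncated statistic. -/
lemma uStatistic_truncated_eq (L n : ℕ) (z : ℕ → A) :
    uStatistic (fun x y => ∑ k ∈ Finset.range L, g k x y) n z =
      ((n : ℝ) - 1) * ∑ i ∈ Finset.Icc 1 n,
        (∑ k ∈ Finset.range L, centeredProj ν (g k) (shift i z)) +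
      ((n : ℝ) - 1) * n / 2 * ∑ k ∈ Finset.range L, ∫ x, hoeffding ν id (g k) x ∂ν +
      uStatistic (degenerateKernel ν g L) n z := by
  set c := ∑ k ∈ Finset.range L, ∫ x, hoeffding ν id (g k) x ∂ν with hc
  have hpt : ∀ x y, ∑ k ∈ Finset.range L, g k x y =
      ((∑ k ∈ Finset.range L, centeredProj ν (g k) x + c / 2) +
        (∑ k ∈ Finset.range L, centeredProj ν (g k) y + c / 2)) + degenerateKernel ν g L x y := by
    intro x y
    simp only [degenerateKernel, Finset.sum_sub_distrib]
    rw [← hc]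
    ring
  simp only [uStatistic, hpt, Finset.sum_add_distrib (g := fun j => degenerateKernel ν g L _ _)]
  rw [Finset.sum_add_distrib, sum_pairs_add fun i =>
    ∑ k ∈ Finset.range L, centeredProj ν (g k) (shift i z) + c / 2, Finset.sum_add_distrib]
  simp only [Finset.sum_const, Nat.card_Icc, nsmul_eq_mul]
  push_cast
  ring

lemma integral_abs_uStatistic_sub_le (hg : MixingKernelFamily ν g C D β K ρ) (L n : ℕ) :
    ∫ z, |uStatistic (fun x y => ∑' k, g k x y) n z -
      uStatistic (fun x y => ∑ k ∈ Finset.range L, g k x y) n z| ∂ν ≤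
      (n : ℝ) ^ 2 * (D * β ^ L * (1 - β)⁻¹) := by
  have hs : ∀ {i j : ℕ}, i < j →
      Summable fun k => ∫ z, |g k (shift i z) (shift j z)| ∂ν := fun hij =>
    Summable.of_nonneg_of_le (fun _ => integral_nonneg fun _ => abs_nonneg _)
      (fun k => hg.integral_abs_kernel_shift_le k hij) hg.summable_geometric
  have hint : ∀ q ∈ timePairs n, Integrable (fun z => ∑' k, g k (shift q.1 z) (shift q.2 z) -
      ∑ k ∈ Finset.range L, g k (shift q.1 z) (shift q.2 z)) ν := fun q hq =>
    (integrable_tsum_of_summable (fun k => hg.integrable_kernel_shift k q.1 q.2)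
      (hs (lt_of_mem_timePairs hq))).sub
      (integrable_finsetSum _ fun k _ => hg.integrable_kernel_shift k q.1 q.2)
  have hterm : ∀ q ∈ timePairs n, ∫ z, |∑' k, g k (shift q.1 z) (shift q.2 z) -
      ∑ k ∈ Finset.range L, g k (shift q.1 z) (shift q.2 z)| ∂ν ≤ D * β ^ L * (1 - β)⁻¹ := by
    intro q hq
    have hij := lt_of_mem_timePairs hq
    refine (integral_abs_tsum_sub_sum_le (fun k => hg.integrable_kernel_shift k q.1 q.2)
      (hs hij) L).trans ?_
    have hgeo := (hasSum_geometric_of_lt_one hg.β_pos.le hg.β_lt_one).mul_left (D * β ^ L)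
    rw [← hgeo.tsum_eq]
    refine ((summable_nat_add_iff L).2 (hs hij)).tsum_le_tsum (fun k => ?_) hgeo.summable
    refine (hg.integral_abs_kernel_shift_le (k + L) hij).trans (le_of_eq ?_)
    ring
  simp only [uStatistic_eq_sum_timePairs, ← Finset.sum_sub_distrib]
  calc _ ≤ ∫ z, ∑ q ∈ timePairs n, |∑' k, g k (shift q.1 z) (shift q.2 z) -
        ∑ k ∈ Finset.range L, g k (shift q.1 z) (shift q.2 z)| ∂ν :=
        integral_mono (integrable_finsetSum _ hint).abs
          (integrable_finsetSum _ fun q hq => (hint q hq).abs)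
          fun z => Finset.abs_sum_le_sum_abs _ _
    _ = ∑ q ∈ timePairs n, ∫ z, |∑' k, g k (shift q.1 z) (shift q.2 z) -
        ∑ k ∈ Finset.range L, g k (shift q.1 z) (shift q.2 z)| ∂ν :=
        integral_finsetSum _ fun q hq => (hint q hq).abs
    _ ≤ ∑ _q ∈ timePairs n, D * β ^ L * (1 - β)⁻¹ := Finset.sum_le_sum hterm
    _ ≤ _ := by
        rw [Finset.sum_const, nsmul_eq_mul]
        have h₁ := hg.D_nonneg
        have h₂ := hg.β_pos
        have h₃ : 0 < 1 - β := by linarith [hg.β_lt_one]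
        gcongr
        exact card_timePairs_le n

lemma abs_sum_integral_hoeffding_sub_le (hg : MixingKernelFamily ν g C D β K ρ) (L : ℕ) :
    |∑' k, ∫ z, hoeffding ν id (g k) z ∂ν -
      ∑ k ∈ Finset.range L, ∫ z, hoeffding ν id (g k) z ∂ν| ≤ D * β ^ L * (1 - β)⁻¹ := by
  have e : ∑' k, ∫ z, hoeffding ν id (g k) z ∂ν -
      ∑ k ∈ Finset.range L, ∫ z, hoeffding ν id (g k) z ∂ν =
      ∑' k, ∫ z, hoeffding ν id (g (k + L)) z ∂ν := by
    rw [← hg.summable_integral_hoeffding.sum_add_tsum_nat_add L]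
    ring
  rw [e]
  rw [← Real.norm_eq_abs]
  refine tsum_of_norm_bounded
    ((hasSum_geometric_of_lt_one hg.β_pos.le hg.β_lt_one).mul_left (D * β ^ L)) fun k => ?_
  refine (hg.abs_integral_hoeffding_le (k + L)).trans (le_of_eq ?_)
  ring

omit [IsProbabilityMeasure ν] in
lemma measurable_degenerateKernel (hg : MixingKernelFamily ν g C D β K ρ) (L : ℕ) :
    Measurable (Function.uncurry (degenerateKernel ν g L)) := by
  have h := fun y => (hg.dependsOn_degenerateKernel L y).mono Set.Iio_subset_Iic_self
  refine measurable_uncurry_of_dependsOn h (b := L) fun x => ?_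
  have e : degenerateKernel ν g L x = fun y => degenerateKernel ν g L y x :=
    funext fun y => hg.degenerateKernel_symm L x y
  rw [e]
  exact h x

lemma memLp_uStatistic_degenerateKernel (hg : MixingKernelFamily ν g C D β K ρ) (L n : ℕ) :
    MemLp (uStatistic (degenerateKernel ν g L) n) 2 ν := by
  have e : uStatistic (degenerateKernel ν g L) n =
      fun z => ∑ q ∈ timePairs n, degenerateKernel ν g L (shift q.1 z) (shift q.2 z) :=
    funext fun z => uStatistic_eq_sum_timePairs _ n z
  rw [e]
  refine memLp_finsetSum _ fun q _ => MemLp.of_bound ((hg.measurable_degenerateKernel L).comp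
    ((measurable_shift q.1).prodMk (measurable_shift q.2))).aestronglyMeasurable (4 * C * L)
    (.of_forall fun z => hg.abs_degenerateKernel_le L _ _)

end MixingKernelFamily

/-! ### The central limit theorem for the `U`-statistic -/

namespace MixingKernelFamily

variable {A : Type*} [MeasurableSpace A] [DiscreteMeasurableSpace A] [Fintype A]
variable {ν : Measure (ℕ → A)} [IsProbabilityMeasure ν] {g : ℕ → (ℕ → A) → (ℕ → A) → ℝ}
  {C D β K ρ : ℝ} {F : (ℕ → A) → ℝ} {B η : ℝ} {Ψ : (ℕ → A) → ℝ}

omit [IsProbabilityMeasure ν] in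
lemma measurable_uStatistic_tsum (hg : MixingKernelFamily ν g C D β K ρ) (n : ℕ) :
    Measurable (uStatistic (fun x y => ∑' k, g k x y) n) := by
  refine Finset.measurable_fun_sum _ fun i _ => Finset.measurable_fun_sum _ fun j _ => ?_
  exact Measurable.tsum fun k => (hg.measurable_kernel k).comp
    ((measurable_shift i).prodMk (measurable_shift j))

lemma integrable_uStatistic_tsum (hg : MixingKernelFamily ν g C D β K ρ) (n : ℕ) :
    Integrable (uStatistic (fun x y => ∑' k, g k x y) n) ν := by
  have e : uStatistic (fun x y => ∑' k, g k x y) n =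
      fun z => ∑ q ∈ timePairs n, ∑' k, g k (shift q.1 z) (shift q.2 z) :=
    funext fun z => uStatistic_eq_sum_timePairs _ n z
  rw [e]
  exact integrable_finsetSum _ fun q hq =>
    integrable_tsum_of_summable (fun k => hg.integrable_kernel_shift k q.1 q.2)
      (Summable.of_nonneg_of_le (fun _ => integral_nonneg fun _ => abs_nonneg _)
        (fun k => hg.integral_abs_kernel_shift_le k (lt_of_mem_timePairs hq))
        hg.summable_geometric)

lemma integrable_uStatistic_truncated (hg : MixingKernelFamily ν g C D β K ρ) (L n : ℕ) :
    Integrable (uStatistic (fun x y => ∑ k ∈ Finset.range L, g k x y) n) ν :=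
  integrable_finsetSum _ fun i _ => integrable_finsetSum _ fun j _ =>
    integrable_finsetSum _ fun k _ => hg.integrable_kernel_shift k i j

lemma integral_abs_uStatistic_degenerateKernel_le (hg : MixingKernelFamily ν g C D β K ρ)
    {L : ℕ} (hL : 1 ≤ L) (n : ℕ) :
    ∫ z, |uStatistic (degenerateKernel ν g L) n z| ∂ν ≤
      √((4 * C * L) ^ 2 * (3 * K * ρ ^ L * n ^ 4 + 3 * ((n : ℝ) * (8 * L)) ^ 2)) :=
  (integral_abs_le_sqrt (hg.memLp_uStatistic_degenerateKernel L n)).trans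
    (Real.sqrt_le_sqrt (integral_uStatistic_sq_le hg.mixing hg.K_nonneg hg.ρ_pos.le hL
      (hg.dependsOn_degenerateKernel L) (hg.degenerateKernel_symm L)
      (hg.abs_degenerateKernel_le L) hg.shift_preserving (hg.integral_degenerateKernel L) n))

/-- The distance in mean between the centred statistic and `n` times the sum of the truncated
centred projections. -/
lemma integral_abs_uStatistic_sub_projection_le (hg : MixingKernelFamily ν g C D β K ρ)
    (happ : IsGeometricApprox ν F
      (fun L z => ∑ k ∈ Finset.range L, centeredProj ν (g k) z) B η Ψ)
    {L : ℕ} (hL : 1 ≤ L) {n : ℕ} (hn : 1 ≤ n) :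
    ∫ z, |uStatistic (fun x y => ∑' k, g k x y) n z -
        (n : ℝ) ^ 2 * (∑' k, ∫ x, hoeffding ν id (g k) x ∂ν) / 2 -
        n * ∑ i ∈ Finset.Icc 1 n, ∑ k ∈ Finset.range L, centeredProj ν (g k) (shift i z)| ∂ν ≤
      2 * (D * (1 - β)⁻¹) * (n ^ 2 * β ^ L) + (B + D * (1 - β)⁻¹) * n +
      √((4 * C * L) ^ 2 * (3 * K * ρ ^ L * n ^ 4 + 3 * ((n : ℝ) * (8 * L)) ^ 2)) := by
  set κ := ∑' k, ∫ x, hoeffding ν id (g k) x ∂ν with hκ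
  set κL := ∑ k ∈ Finset.range L, ∫ x, hoeffding ν id (g k) x ∂ν with hκL
  set c := D * (1 - β)⁻¹ with hc
  let f : (ℕ → A) → ℝ := fun z => ∑ k ∈ Finset.range L, centeredProj ν (g k) z
  let U : (ℕ → A) → ℝ := uStatistic (fun x y => ∑' k, g k x y) n
  let UL : (ℕ → A) → ℝ := uStatistic (fun x y => ∑ k ∈ Finset.range L, g k x y) n
  let R : (ℕ → A) → ℝ := uStatistic (degenerateKernel ν g L) n
  have hn1 : (1 : ℝ) ≤ n := by exact_mod_cast hn
  have hfi : ∀ i, Integrable (fun z => f (shift i z)) ν := fun i =>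
    (memLp_shift (happ.memLp_approx L) hg.shift_preserving i).integrable
      (by norm_num)
  have hfi1 : ∀ i, ∫ z, |f (shift i z)| ∂ν ≤ B := fun i => by
    rw [integral_comp_shift hg.shift_preserving i (f := fun z => |f z|)
      (happ.memLp_approx L).aestronglyMeasurable.norm]
    exact happ.integral_abs_le L
  have hU : Integrable U ν := hg.integrable_uStatistic_tsum n
  have hUL : Integrable UL ν := hg.integrable_uStatistic_truncated L n
  have hR : Integrable R ν := (hg.memLp_uStatistic_degenerateKernel L n).integrable (by norm_num)
  have hκ0 : |κ| ≤ c := by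
    have := hg.abs_sum_integral_hoeffding_sub_le 0
    simpa [hκ, hc] using this
  have hκ1 : |κ - κL| ≤ c * β ^ L := by
    have := hg.abs_sum_integral_hoeffding_sub_le L
    rw [hc]
    linarith [this]
  have hconst : |((n : ℝ) - 1) * n / 2 * κL - (n : ℝ) ^ 2 * κ / 2| ≤
      n ^ 2 * (c * β ^ L) + n * c := by
    have e : ((n : ℝ) - 1) * n / 2 * κL - (n : ℝ) ^ 2 * κ / 2 =
        -(((n : ℝ) - 1) * n / 2 * (κ - κL)) - n / 2 * κ := by ring
    rw [e]
    refine (abs_sub _ _).trans (add_le_add ?_ ?_)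
    · rw [abs_neg, abs_mul, abs_of_nonneg (by
        have : 0 ≤ (n : ℝ) - 1 := by linarith
        positivity)]
      exact mul_le_mul (by nlinarith) hκ1 (abs_nonneg _) (by positivity)
    · rw [abs_mul, abs_of_nonneg (by positivity)]
      exact mul_le_mul (by linarith) hκ0 (abs_nonneg _) (by positivity)
  have hpt : ∀ z, |U z - (n : ℝ) ^ 2 * κ / 2 - n * ∑ i ∈ Finset.Icc 1 n, f (shift i z)| ≤
      |U z - UL z| + ∑ i ∈ Finset.Icc 1 n, |f (shift i z)| + |R z| +
        (n ^ 2 * (c * β ^ L) + n * c) := by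
    intro z
    have e : U z - (n : ℝ) ^ 2 * κ / 2 - n * ∑ i ∈ Finset.Icc 1 n, f (shift i z) =
        (U z - UL z) + -(∑ i ∈ Finset.Icc 1 n, f (shift i z)) + R z +
          (((n : ℝ) - 1) * n / 2 * κL - (n : ℝ) ^ 2 * κ / 2) := by
      have : UL z = ((n : ℝ) - 1) * ∑ i ∈ Finset.Icc 1 n, f (shift i z) +
          ((n : ℝ) - 1) * n / 2 * κL + R z := uStatistic_truncated_eq L n z
      rw [this]
      ring
    rw [e]
    refine (abs_add_le _ _).trans (add_le_add ((abs_add_le _ _).trans (add_le_add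
      ((abs_add_le _ _).trans (add_le_add le_rfl ?_)) le_rfl)) hconst)
    rw [abs_neg]
    exact Finset.abs_sum_le_sum_abs _ _
  have hsum : Integrable (fun z => ∑ i ∈ Finset.Icc 1 n, |f (shift i z)|) ν :=
    integrable_finsetSum _ fun i _ => (hfi i).abs
  have hsum1 : ∫ z, ∑ i ∈ Finset.Icc 1 n, |f (shift i z)| ∂ν ≤ n * B := by
    rw [integral_finsetSum _ fun i _ => (hfi i).abs]
    refine (Finset.sum_le_sum fun i _ => hfi1 i).trans (le_of_eq ?_)
    simp
  have h₁ : Integrable (fun z => |U z - UL z|) ν := (hU.sub hUL).abs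
  have h₂ : Integrable (fun z => |U z - UL z| + ∑ i ∈ Finset.Icc 1 n, |f (shift i z)|) ν :=
    h₁.add hsum
  have h₃ : Integrable (fun z => |U z - UL z| + ∑ i ∈ Finset.Icc 1 n, |f (shift i z)| +
      |R z|) ν := h₂.add hR.abs
  have hmain : ∫ z, |U z - (n : ℝ) ^ 2 * κ / 2 -
      n * ∑ i ∈ Finset.Icc 1 n, f (shift i z)| ∂ν ≤
      ∫ z, |U z - UL z| ∂ν + ∫ z, ∑ i ∈ Finset.Icc 1 n, |f (shift i z)| ∂ν + ∫ z, |R z| ∂ν +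
        (n ^ 2 * (c * β ^ L) + n * c) := by
    refine (integral_mono ((hU.sub (integrable_const _)).sub
      ((integrable_finsetSum _ fun i _ => hfi i).const_mul _)).abs
      (h₃.add (integrable_const _)) hpt).trans (le_of_eq ?_)
    rw [integral_add' h₃ (integrable_const _), integral_add h₂ hR.abs, integral_add h₁ hsum]
    simp
  have hUUL := hg.integral_abs_uStatistic_sub_le L n
  have hRR := hg.integral_abs_uStatistic_degenerateKernel_le hL n
  refine hmain.trans ?_
  have hUUL' : ∫ z, |U z - UL z| ∂ν ≤ n ^ 2 * (c * β ^ L) := hUUL.trans (le_of_eq (by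
    rw [hc]
    ring))
  calc _ ≤ (n : ℝ) ^ 2 * (c * β ^ L) + n * B + _ + (n ^ 2 * (c * β ^ L) + n * c) :=
        add_le_add (add_le_add (add_le_add hUUL' hsum1) hRR) le_rfl
    _ = _ := by ring

/-- After normalization, the statistic and the sum of the truncated projections have the same
limit. -/
lemma tendsto_integral_abs_remainder (hg : MixingKernelFamily ν g C D β K ρ)
    (happ : IsGeometricApprox ν F
      (fun L z => ∑ k ∈ Finset.range L, centeredProj ν (g k) z) B η Ψ) :
    Tendsto (fun n : ℕ => ∫ z, |(uStatistic (fun x y => ∑' k, g k x y) n z -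
        (n : ℝ) ^ 2 * (∑' k, ∫ x, hoeffding ν id (g k) x ∂ν) / 2) / (n : ℝ) ^ (3 / 2 : ℝ) -
        1 / √n * ∑ i ∈ Finset.Icc 1 n,
          ∑ k ∈ Finset.range (truncLevel n), centeredProj ν (g k) (shift i z)| ∂ν)
      atTop (𝓝 0) := by
  set c := D * (1 - β)⁻¹ with hc
  have hK := hg.K_nonneg
  have hρ := hg.ρ_pos
  have hβ := hg.β_pos
  have hc0 : 0 ≤ c := mul_nonneg hg.D_nonneg (inv_nonneg.2 (by linarith [hg.β_lt_one]))
  let err : ℕ → ℝ := fun n => 2 * c * ((truncLevel n : ℝ) ^ 8 * β ^ truncLevel n) +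
    (B + c) * (1 / √n) +
    √(48 * C ^ 2 * K * ((truncLevel n : ℝ) ^ 18 * ρ ^ truncLevel n) +
      3072 * C ^ 2 * (2 ^ 16 * (truncLevel n : ℝ)⁻¹ ^ 12))
  have herr : Tendsto err atTop (𝓝 0) := by
    have h₁ := (tendsto_truncLevel_pow_mul_pow 8 hβ.le hg.β_lt_one).const_mul (2 * c)
    have h₂ : Tendsto (fun n : ℕ => 1 / √(n : ℝ)) atTop (𝓝 0) := by
      simp only [one_div]
      exact tendsto_inv_atTop_zero.comp
        (Real.tendsto_sqrt_atTop.comp tendsto_natCast_atTop_atTop)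
    have h₃ := (tendsto_truncLevel_pow_mul_pow 18 hρ.le hg.ρ_lt_one).const_mul (48 * C ^ 2 * K)
    have h₄ := ((tendsto_inv_truncLevel.pow 12).const_mul (2 ^ 16)).const_mul (3072 * C ^ 2)
    refine ((h₁.add (h₂.const_mul (B + c))).add (h₃.add h₄).sqrt).trans_eq ?_
    simp
  refine squeeze_zero' (.of_forall fun n => integral_nonneg fun z => abs_nonneg _) ?_ herr
  filter_upwards [eventually_ge_atTop 1] with n hn
  set L := truncLevel n with hL
  have hL1 : 1 ≤ L := one_le_truncLevel n
  have hL0 : (0 : ℝ) < L := by exact_mod_cast hL1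
  have hn0 : (0 : ℝ) < n := by exact_mod_cast hn
  have hs0 : 0 < √(n : ℝ) := Real.sqrt_pos.2 hn0
  have hss : √(n : ℝ) ^ 2 = n := Real.sq_sqrt hn0.le
  have hpow : (n : ℝ) ^ (3 / 2 : ℝ) = n * √n := by
    rw [show (3 / 2 : ℝ) = 1 + 1 / 2 by norm_num, Real.rpow_add hn0, Real.rpow_one,
      Real.sqrt_eq_rpow]
  have hbd := hg.integral_abs_uStatistic_sub_projection_le happ hL1 hn
  rw [← hc] at hbd
  have e : ∀ z, |(uStatistic (fun x y => ∑' k, g k x y) n z -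
      (n : ℝ) ^ 2 * (∑' k, ∫ x, hoeffding ν id (g k) x ∂ν) / 2) / (n : ℝ) ^ (3 / 2 : ℝ) -
      1 / √n * ∑ i ∈ Finset.Icc 1 n, ∑ k ∈ Finset.range L, centeredProj ν (g k) (shift i z)| =
      (n * √n)⁻¹ * |uStatistic (fun x y => ∑' k, g k x y) n z -
      (n : ℝ) ^ 2 * (∑' k, ∫ x, hoeffding ν id (g k) x ∂ν) / 2 -
      n * ∑ i ∈ Finset.Icc 1 n, ∑ k ∈ Finset.range L, centeredProj ν (g k) (shift i z)| := by
    intro z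
    rw [hpow, ← abs_of_pos (by positivity : 0 < (n * √(n : ℝ))⁻¹), ← abs_mul]
    congr 1
    field_simp
  simp only [e, integral_const_mul]
  refine (mul_le_mul_of_nonneg_left hbd (by positivity)).trans ?_
  rw [mul_add, mul_add]
  refine add_le_add (add_le_add ?_ (le_of_eq ?_)) ?_
  · calc (n * √(n : ℝ))⁻¹ * (2 * c * (n ^ 2 * β ^ L)) = 2 * c * (√n * β ^ L) := by
          field_simp
          rw [hss]
      _ ≤ _ := by
          gcongr
          exact sqrt_le_truncLevel_pow n
  · field_simp
  · rw [← Real.sqrt_sq (by positivity : 0 ≤ (n * √(n : ℝ))⁻¹), ← Real.sqrt_mul (sq_nonneg _)]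
    refine Real.sqrt_le_sqrt ?_
    have hLn : (L : ℝ) ^ 4 / n ≤ 2 ^ 16 * (L : ℝ)⁻¹ ^ 12 := by
      rw [div_le_iff₀ hn0]
      calc (L : ℝ) ^ 4 = (L : ℝ)⁻¹ ^ 12 * (L : ℝ) ^ 16 := by field_simp
        _ ≤ (L : ℝ)⁻¹ ^ 12 * (2 ^ 16 * n) := by
            gcongr
            exact truncLevel_pow_le hn
        _ = _ := by ring
    have hnL : (n : ℝ) ≤ (L : ℝ) ^ 16 := le_truncLevel_pow n
    calc (n * √(n : ℝ))⁻¹ ^ 2 *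
          ((4 * C * L) ^ 2 * (3 * K * ρ ^ L * n ^ 4 + 3 * ((n : ℝ) * (8 * L)) ^ 2))
        = 48 * C ^ 2 * K * ((L : ℝ) ^ 2 * n * ρ ^ L) + 3072 * C ^ 2 * ((L : ℝ) ^ 4 / n) := by
          rw [inv_pow, mul_pow, hss]
          field_simp
          ring
      _ ≤ 48 * C ^ 2 * K * ((L : ℝ) ^ 2 * (L : ℝ) ^ 16 * ρ ^ L) +
          3072 * C ^ 2 * (2 ^ 16 * (L : ℝ)⁻¹ ^ 12) := by gcongr
      _ = _ := by ring

/-- The central limit theorem on sequence space. The truncated projections converge by Lévy's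
continuity theorem, and the remainder is negligible. -/
lemma tendstoInDistribution_uStatistic (hg : MixingKernelFamily ν g C D β K ρ)
    (happ : IsGeometricApprox ν F
      (fun L z => ∑ k ∈ Finset.range L, centeredProj ν (g k) z) B η Ψ)
    {σsq : NNReal} (hσ : Tendsto (fun n : ℕ => 1 / (n : ℝ) *
      ∫ z, (∑ i ∈ Finset.Icc 1 n, F (shift i z)) ^ 2 ∂ν) atTop (𝓝 (σsq : ℝ))) :
    TendstoInDistribution (fun (n : ℕ) z => (uStatistic (fun x y => ∑' k, g k x y) n z -
        (n : ℝ) ^ 2 * (∑' k, ∫ x, hoeffding ν id (g k) x ∂ν) / 2) / (n : ℝ) ^ (3 / 2 : ℝ))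
      atTop (id : ℝ → ℝ) (fun _ => ν) (gaussianReal 0 σsq) := by
  let X : ℕ → (ℕ → A) → ℝ := fun n z => 1 / √n * ∑ i ∈ Finset.Icc 1 n,
    ∑ k ∈ Finset.range (truncLevel n), centeredProj ν (g k) (shift i z)
  have hXm : ∀ n, Measurable (X n) := fun n =>
    (Finset.measurable_fun_sum _ fun i _ =>
      (happ.measurable_approx (truncLevel n)).comp (measurable_shift i)).const_mul _
  have hXint : ∀ n, Integrable (X n) ν := fun n =>
    (integrable_finsetSum _ fun i _ => (memLp_shift
      (happ.memLp_approx (truncLevel n)) hg.shift_preserving i).integrable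
      (by norm_num)).const_mul _
  have hYm : ∀ n : ℕ, Measurable fun z => (uStatistic (fun x y => ∑' k, g k x y) n z -
      (n : ℝ) ^ 2 * (∑' k, ∫ x, hoeffding ν id (g k) x ∂ν) / 2) / (n : ℝ) ^ (3 / 2 : ℝ) :=
    fun n => ((hg.measurable_uStatistic_tsum n).sub_const _).div_const _
  have hX : TendstoInDistribution X atTop (id : ℝ → ℝ) (fun _ => ν) (gaussianReal 0 σsq) := by
    refine ⟨fun n => (hXm n).aemeasurable, aemeasurable_id, ?_⟩
    refine ProbabilityMeasure.tendsto_iff_tendsto_charFun.2 fun t => ?_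
    have h := happ.tendsto_integral_expI hg.shift_preserving hg.mixing hg.K_nonneg hg.ρ_pos.le
      hg.ρ_lt_one hσ t
    have e₁ : charFun ((gaussianReal 0 σsq).map id) t =
        Complex.exp (-(σsq * t ^ 2 / 2 : ℝ)) := by
      rw [Measure.map_id, charFun_gaussianReal]
      congr 1
      push_cast
      ring
    have e₂ : ∀ n, charFun (ν.map (X n)) t = ∫ z, expI (t * X n z) ∂ν := fun n => by
      rw [charFun_apply_real, integral_map (hXm n).aemeasurable (by fun_prop)]
      simp only [expI, Complex.ofReal_mul]
    simp only [ProbabilityMeasure.coe_mk, e₁, e₂]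
    exact h
  refine tendstoInDistribution_of_tendstoInMeasure_sub _ id hX ?_ fun n => (hYm n).aemeasurable
  have hint : ∀ n : ℕ, Integrable ((fun z => (uStatistic (fun x y => ∑' k, g k x y) n z -
      (n : ℝ) ^ 2 * (∑' k, ∫ x, hoeffding ν id (g k) x ∂ν) / 2) / (n : ℝ) ^ (3 / 2 : ℝ)) -
      X n) ν := fun n =>
    (((hg.integrable_uStatistic_tsum n).sub (integrable_const _)).div_const _).sub (hXint n)
  refine tendstoInMeasure_of_tendsto_eLpNorm one_ne_zero (fun n => (hint n).aestronglyMeasurable)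
    aestronglyMeasurable_const ?_
  have h := ENNReal.tendsto_ofReal (hg.tendsto_integral_abs_remainder happ)
  rw [ENNReal.ofReal_zero] at h
  refine h.congr fun n => ?_
  rw [sub_zero, eLpNorm_one_eq_lintegral_enorm]
  exact ofReal_integral_norm_eq_lintegral_enorm (hint n)

end MixingKernelFamily

/-! ### Transfer from sequence space -/

section Transfer

variable {Ω A : Type*} [MeasurableSpace Ω] [MeasurableSpace A] {μ : Measure Ω} {Z : Ω → ℕ → A}

lemma hoeffding_map {g : (ℕ → A) → (ℕ → A) → ℝ} {z : ℕ → A} (hZ : Measurable Z)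
    (hg : Measurable (g z)) : hoeffding (μ.map Z) id g z = hoeffding μ Z g z := by
  simp only [hoeffding, id]
  exact integral_map hZ.aemeasurable hg.aestronglyMeasurable

variable [DiscreteMeasurableSpace A] [Fintype A] [IsProbabilityMeasure μ]
  {g : ℕ → (ℕ → A) → (ℕ → A) → ℝ} {C D β K ρ : ℝ}

namespace MixingKernelFamily

omit [IsProbabilityMeasure μ] in
lemma hoeffding_eq (hg : MixingKernelFamily (μ.map Z) g C D β K ρ) (hZ : Measurable Z) (k : ℕ) :
    hoeffding μ Z (g k) = hoeffding (μ.map Z) id (g k) :=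
  funext fun z => (hoeffding_map hZ (measurable_of_dependsOn (hg.dependsOn' k z))).symm

omit [IsProbabilityMeasure μ] in
lemma integral_hoeffding_eq (hg : MixingKernelFamily (μ.map Z) g C D β K ρ) (hZ : Measurable Z)
    (k : ℕ) : ∫ ω, hoeffding μ Z (g k) (Z ω) ∂μ =
      ∫ z, hoeffding (μ.map Z) id (g k) z ∂(μ.map Z) := by
  rw [hg.hoeffding_eq hZ, integral_map hZ.aemeasurable
    (measurable_of_dependsOn (hg.dependsOn_hoeffding k)).aestronglyMeasurable]

end MixingKernelFamily

end Transfer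

/-- The centred sum of the projections is the sum of the shifts of a single function. -/
lemma MixingKernelFamily.ae_centeredProjectionSum_eq {Ω A : Type*} [MeasurableSpace Ω]
    [MeasurableSpace A] [DiscreteMeasurableSpace A] [Fintype A] {μ : Measure Ω}
    [IsProbabilityMeasure μ] {Z : Ω → ℕ → A} {h : ℕ → (ℕ → A) → (ℕ → A) → ℝ} {C D β K ρ : ℝ}
    [IsProbabilityMeasure (μ.map Z)]
    (hg : MixingKernelFamily (μ.map Z) (fun k => h (k + 1)) C D β K ρ) (hZ : Measurable Z) :
    ∀ᵐ ω ∂μ, ∀ n, centeredProjectionSum μ Z h n (Z ω) =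
      ∑ i ∈ Finset.Icc 1 n, ∑' k, centeredProj (μ.map Z) (h (k + 1)) (shift i (Z ω)) := by
  filter_upwards [ae_of_ae_map hZ.aemeasurable
    (ae_shift hg.ae_summable_hoeffding hg.shift_preserving)] with ω hω n
  have h₁ : ∀ i, ∑' k, centeredProj (μ.map Z) (h (k + 1)) (shift i (Z ω)) =
      ∑' k, hoeffding μ Z (h (k + 1)) (shift i (Z ω)) - kappa μ Z h := fun i => by
    have h₂ : ∀ k, hoeffding μ Z (h (k + 1)) = hoeffding (μ.map Z) id (h (k + 1)) :=
      hg.hoeffding_eq hZ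
    have h₃ : kappa μ Z h =
        ∑' k, ∫ z, hoeffding (μ.map Z) id (h (k + 1)) z ∂(μ.map Z) :=
      tsum_congr (hg.integral_hoeffding_eq hZ)
    rw [h₃]
    simp only [h₂]
    exact (hω i).of_abs.tsum_sub hg.summable_integral_hoeffding
  simp only [h₁, Finset.sum_sub_distrib]
  simp [centeredProjectionSum]

end MarkovUStat

theorem mainTheorem3 {Ω A : Type*} [MeasurableSpace Ω]
    [Fintype A] [DecidableEq A] [MeasurableSpace A] [DiscreteMeasurableSpace A]
    (μ : Measure Ω) [IsProbabilityMeasure μ]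
    (p : A → ℝ) (Q : Matrix A A ℝ) (Z : Ω → ℕ → A)
    (hZ : MarkovUStat.IsStationaryMarkovChain μ p Q Z)
    (hirr : Q.IsIrreducible) (haper : MarkovUStat.IsAperiodic Q)
    (h : ℕ → (ℕ → A) → (ℕ → A) → ℝ)
    (h_symm : ∀ k, 1 ≤ k → ∀ x y, h k x y = h k y x)
    (h_bdd : ∃ C : ℝ, ∀ k, 1 ≤ k → ∀ x y, |h k x y| ≤ C)
    (h_local : ∀ k, 1 ≤ k → ∀ x x' y y' : ℕ → A,
      (∀ i < k, x i = x' i) → (∀ i < k, y i = y' i) → h k x y = h k x' y')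
    (h_decay : ∃ C β : ℝ, 0 < β ∧ β < 1 ∧ ∀ k i : ℕ, 1 ≤ k → 1 ≤ i →
      ∫ ω, |h k (Z ω) (MarkovUStat.shift i (Z ω))| ∂μ ≤ C * β ^ k) :
    -- all the series converge, and the second moments below are finite
    (∀ i j : ℕ, 1 ≤ i → i < j → ∀ᵐ ω ∂μ, Summable fun k : ℕ =>
      h (k + 1) (MarkovUStat.shift i (Z ω)) (MarkovUStat.shift j (Z ω))) ∧
    (Summable fun k : ℕ => ∫ ω, MarkovUStat.hoeffding μ Z (h (k + 1)) (Z ω) ∂μ) ∧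
    (∀ i : ℕ, ∀ᵐ ω ∂μ, Summable fun k : ℕ =>
      MarkovUStat.hoeffding μ Z (h (k + 1)) (MarkovUStat.shift i (Z ω))) ∧
    (∀ n : ℕ, MemLp (fun ω => MarkovUStat.centeredProjectionSum μ Z h n (Z ω)) 2 μ) ∧
    -- the limit defining the asymptotic variance exists, and the central limit theorem holds
    ∃ σsq : NNReal,
      Tendsto (fun n : ℕ => (1 / (n : ℝ)) *
          ∫ ω, (MarkovUStat.centeredProjectionSum μ Z h n (Z ω)) ^ 2 ∂μ)
        atTop (𝓝 (σsq : ℝ)) ∧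
      TendstoInDistribution
        (fun (n : ℕ) (ω : Ω) =>
          (MarkovUStat.uStatistic (MarkovUStat.kernelSum h) n (Z ω)
            - (n : ℝ) ^ 2 * MarkovUStat.kappa μ Z h / 2) / (n : ℝ) ^ (3 / 2 : ℝ))
        atTop (id : ℝ → ℝ) (fun _ => μ) (gaussianReal 0 σsq) := by
  open MarkovUStat in
  have hZm := hZ.measurable
  have hprob : IsProbabilityMeasure (μ.map Z) := Measure.isProbabilityMeasure_map hZm.aemeasurable
  have hlaw := hZ.map_law
  obtain ⟨K, ρ, hK, hρ0, hρ1, hQ⟩ := exists_geometric_bound hirr haper hZ.initial_nonneg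
    hZ.initial_sum hZ.trans_sum hZ.stationary
  obtain ⟨C, hC⟩ := h_bdd
  obtain ⟨D, β, hβ0, hβ1, hD⟩ := h_decay
  have hloc₁ : ∀ k y, DependsOn (fun x => h (k + 1) x y) (Set.Iic k) := fun k y x x' hx =>
    h_local (k + 1) (Nat.le_add_left 1 k) x x' y y (fun i hi => hx i (Nat.lt_succ_iff.1 hi))
      fun _ _ => rfl
  have hloc₂ : ∀ k x, DependsOn (h (k + 1) x) (Set.Iic k) := fun k x y y' hy =>
    h_local (k + 1) (Nat.le_add_left 1 k) x x y y' (fun _ _ => rfl)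
      fun i hi => hy i (Nat.lt_succ_iff.1 hi)
  have hg : MixingKernelFamily (μ.map Z) (fun k => h (k + 1)) C (D * β) β K ρ :=
    { shift_preserving := hlaw.measurePreserving_shift
      mixing := hlaw.isPsiMixing hQ
      K_nonneg := hK
      ρ_pos := hρ0
      ρ_lt_one := hρ1
      symm := fun k => h_symm (k + 1) (Nat.le_add_left 1 k)
      bdd := fun k => hC (k + 1) (Nat.le_add_left 1 k)
      dependsOn := hloc₁
      β_pos := hβ0
      β_lt_one := hβ1
      -- the index shift `k + 1` costs a factor `β`
      decay := fun k i hi => by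
        have hm : Measurable fun z : ℕ → A => |h (k + 1) z (shift i z)| := by
          have := ((measurable_uncurry_of_dependsOn (hloc₁ k) (hloc₂ k)).comp
            (measurable_id.prodMk (measurable_shift i))).abs
          exact this
        rw [integral_map hZm.aemeasurable hm.aestronglyMeasurable]
        refine (hD (k + 1) i (Nat.le_add_left 1 k) hi).trans (le_of_eq ?_)
        ring }
  obtain ⟨B, η, Ψ, happ⟩ := hg.exists_isGeometricApprox
  obtain ⟨σsq, hσ⟩ := happ.exists_tendsto_variance hg.shift_preserving hg.mixing hK hρ0.le hρ1
  have hκ : kappa μ Z h = ∑' k, ∫ z, hoeffding (μ.map Z) id (h (k + 1)) z ∂(μ.map Z) :=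
    tsum_congr (hg.integral_hoeffding_eq hZm)
  have hproj := hg.ae_centeredProjectionSum_eq hZm
  refine ⟨fun i j _ hij => ?_, ?_, fun i => ?_, fun n => ?_, σsq, ?_, ?_⟩
  · filter_upwards [ae_of_ae_map hZm.aemeasurable (hg.ae_summable_kernel hij)] with ω hω
    exact hω.of_abs
  · simp only [hg.integral_hoeffding_eq hZm]
    exact hg.summable_integral_hoeffding
  · filter_upwards [ae_of_ae_map hZm.aemeasurable (ae_shift
      hg.ae_summable_hoeffding hg.shift_preserving)] with ω hω
    simp only [hg.hoeffding_eq hZm]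
    exact (hω i).of_abs
  · have hsum : MemLp (fun z => ∑ i ∈ Finset.Icc 1 n,
        ∑' k, centeredProj (μ.map Z) (h (k + 1)) (shift i z)) 2 (μ.map Z) :=
      memLp_finsetSum _ fun i _ =>
        memLp_shift happ.memLp_limit hg.shift_preserving i
    refine (memLp_congr_ae ?_).1 (hsum.comp_of_map hZm.aemeasurable)
    filter_upwards [hproj] with ω hω
    exact (hω n).symm
  · refine hσ.congr fun n => ?_
    congr 1
    have hm : Measurable fun z => (∑ i ∈ Finset.Icc 1 n,
        ∑' k, centeredProj (μ.map Z) (h (k + 1)) (shift i z)) ^ 2 :=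
      (Finset.measurable_fun_sum _ fun i _ =>
        happ.measurable.comp (measurable_shift i)).pow_const 2
    rw [integral_map hZm.aemeasurable hm.aestronglyMeasurable]
    refine integral_congr_ae ?_
    filter_upwards [hproj] with ω hω
    rw [hω n]
  · have hclt := hg.tendstoInDistribution_uStatistic happ hσ
    have hm := fun n => ((hg.measurable_uStatistic_tsum n).sub_const ((n : ℝ) ^ 2 *
      (∑' k, ∫ z, hoeffding (μ.map Z) id (h (k + 1)) z ∂(μ.map Z)) / 2)).div_const
      ((n : ℝ) ^ (3 / 2 : ℝ))
    rw [hκ]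
    refine ⟨fun n => ((hm n).comp hZm).aemeasurable, aemeasurable_id, ?_⟩
    refine hclt.tendsto.congr fun n => ?_
    refine Subtype.ext ?_
    exact Measure.map_map (hm n) hZm
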